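/- **Setting.** Fix $\tau,\eta\in\mathbb C$ with $\operatorname{Im}\tau>0$ and let $\theta(t)=-\sum_{j\in\mathbb Z}e^{\pi i(j+\frac12)^2\tau+2\pi i(j+\frac12)(t+\frac12)}$. Let $V=\mathbb C e[1]\oplus\mathbb C e[-1]$, and let $R(z,\lambda)\in\operatorname{End}(V\otimes V)$ be $R=E_{11}\otimes E_{11}+E_{-1,-1}\otimes E_{-1,-1}+\alpha(z,\lambda)E_{11}\otimes E_{-1,-1}+\alpha(z,-\lambda)E_{-1,-1}\otimes E_{11}+\beta(z,\lambda)E_{1,-1}\otimes E_{-1,1}+\beta(z,-\lambda)E_{-1,1}\otimes E_{1,-1}$, with $\alpha(z,\lambda)=\frac{\theta(\lambda+2\eta)\theta(z)}{\theta(\lambda)\theta(z-2\eta)}$, $\beta(z,\lambda)=-\frac{\theta(\lambda+z)\theta(2\eta)}{\theta(\lambda)\theta(z-2\eta)}$. A module over $E_{\tau,\eta}(sl_2)$ is a vector space $W=\bigoplus_{\nu\in\mathbb C}W[\nu]$ with finite dimensional eigenspaces $W[\nu]$ of an operator $h$, together with a meromorphic family $L(z,\lambda)\in\operatorname{End}(V\otimes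 W)$ commuting with $h^{(1)}+h^{(2)}$ such that $R^{(12)}(z-w,\lambda-2\eta h^{(3)})L^{(13)}(z,\lambda)L^{(23)}(w,\lambda-2\eta h^{(1)})=L^{(23)}(w,\lambda)L^{(13)}(z,\lambda-2\eta h^{(2)})R^{(12)}(z-w,\lambda)$. Write $L(z,\lambda)(e[1]\otimes u)=e[1]\otimes a(z,\lambda)u+e[-1]\otimes c(z,\lambda)u$ and $L(z,\lambda)(e[-1]\otimes u)=e[1]\otimes b(z,\lambda)u+e[-1]\otimes d(z,\lambda)u$. On meromorphic $W$-valued functions of $\lambda$ put $(a(z)f)(\lambda)=a(z,\lambda)f(\lambda-2\eta)$, $(c(z)f)(\lambda)=c(z,\lambda)f(\lambda-2\eta)$, $(b(z)f)(\lambda)=b(z,\lambda)f(\lambda+2\eta)$, $(d(z)f)(\lambda)=d(z,\lambda)f(\lambda+2\eta)$, and $T(z)=a(z)+d(z)$. Let $m,n\ge0$ be integers, $z_1,\dots,z_n,\Lambda_1,\dots,\Lambda_n\in\mathbb C$ with $\Lambda=\sum_j\Lambda_j=2m$, and set $p_j=z_j+\eta(1-\Lambda_j)$, $q_j=z_j+\eta(1+\Lambda_j)$.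 Let $c\in\mathbb C$ and let $t_1,\dots,t_m\in\mathbb C$, pairwise distinct modulo $\mathbb Z+\tau\mathbb Z$, be a solution of the Bethe ansatz equations $$\prod_{j\ne i}\frac{\theta(t_j-t_i-2\eta)}{\theta(t_j-t_i+2\eta)}\prod_{k=1}^n\frac{\theta(t_i-q_k)}{\theta(t_i-p_k)}=e^{4\eta c},\qquad i=1,\dots,m.$$ **Statement.** There is a function $\varepsilon:\mathbb C\to\mathbb C$, with $$\varepsilon(w)=e^{-2\eta c}\prod_{j=1}^m\frac{\theta(t_j-w-2\eta)}{\theta(t_j-w)}+e^{2\eta c}\prod_{j=1}^m\frac{\theta(t_j-w+2\eta)}{\theta(t_j-w)}\prod_{k=1}^n\frac{\theta(w-p_k)}{\theta(w-q_k)}$$ whenever $w\not\equiv t_j,q_k$ modulo $\mathbb Z+\tau\mathbb Z$ for all $j,k$, such that the following hold. 1. Let $W$ be a module with a highest weight vector $v_0$ (in particular, any highest weight module), that is, a non-zero meromorphic function $v_0(\lambda)$ with values in $W[\Lambda]$ such that $c(z)v_0=0$, $a(z)v_0=v_0$ and $d(z)v_0=\frac{\theta(\lambda-2\eta\Lambda)}{\theta(\lambda)}\prod_{j}\frac{\theta(z-p_j)}{\theta(z-q_j)}\,v_0$.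 Assume that the operators $b(t_i)$ are defined (no $L$-matrix entry $b(z,\lambda)$ on a weight space has a pole along the whole line $z=t_i$). Let $v(\lambda)=e^{c\lambda}\prod_{j=1}^m\theta(\lambda-2\eta j)\,v_0(\lambda)$ and $\psi=b(t_1)\cdots b(t_m)v$. Then for generic $\mu$ (all $\mu$ outside a countable set), with $C_\mu=\mu+2\eta\mathbb Z$ and $\operatorname{Fun}_\mu(W)[0]$ the space of all functions $C_\mu\to W[0]$: the operator $T(w)$ is well-defined on $\operatorname{Fun}_\mu(W)[0]$ for all $w$ outside a countable set; $\psi$ has no poles on $C_\mu$, and $\psi|_{C_\mu}\in\operatorname{Fun}_\mu(W)[0]$ is a common eigenfunction: $T(w)\,\psi|_{C_\mu}=\varepsilon(w)\,\psi|_{C_\mu}$ for every $w$ for which $T(w)$ is well-defined on $\operatorname{Fun}_\mu(W)[0]$; and $\psi|_{C_\mu}\neq0$ unless $\psi$ is identically zero. 2. If $\theta(2\eta)\ne0$ and $W=V_{\Lambda_1}(z_1)\otimes\cdots\otimes V_{\Lambda_n}(z_n)$ is a tensor product of evaluation Verma modules with $v_0$ the product of the highest weight vectors $e_0$, then $\psi$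 is not identically zero. (Here $V_{\Lambda}(z_0)$ has basis $e_0,e_1,\dots$ with $he_k=(\Lambda-2k)e_k$, and, with $y=z-z_0$ and $N=\theta(y-(\Lambda+1)\eta)\theta(\lambda)$, $a(z,\lambda)e_k=N^{-1}\theta(y-(\Lambda+1-2k)\eta)\theta(\lambda+2k\eta)e_k$, $b(z,\lambda)e_k=-N^{-1}\theta(\lambda+y-(\Lambda-1-2k)\eta)\theta(2\eta)e_{k+1}$, $c(z,\lambda)e_k=N^{-1}\theta(y-\lambda+(\Lambda+1-2k)\eta)\frac{\theta(2(\Lambda+1-k)\eta)\theta(2k\eta)}{\theta(2\eta)}e_{k-1}$, $d(z,\lambda)e_k=N^{-1}\theta(y-(1-\Lambda+2k)\eta)\theta(\lambda-2(\Lambda-k)\eta)e_k$; the $L$-operator of a tensor product is $L_1^{(01)}(z,\lambda-2\eta\sum_{i>1}h^{(i)})\cdots L_n^{(0n)}(z,\lambda)$.) 3. (IRF models.) Let $\eta\neq0$ and $\Lambda_j=1$ for all $j$ (so $n=2m$), let $W=V^{\otimes n}$ with $L_j(z,\lambda)=R(z-z_j,\lambda)$ and $v_0=e[1]\otimes\cdots\otimes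 e[1]$. Define Boltzmann weights by $R(z,-2\eta d)\,e[c-d]\otimes e[b-c]=\sum_a w(a,b,c,d;z)\,e[b-a]\otimes e[a-d]$. For generic $\kappa$ (all $\kappa$ outside a countable set), and closed paths $a=(a_1,\dots,a_n,a_{n+1}=a_1)$ in $\kappa+\mathbb Z$ with $a_j-a_{j+1}=\pm1$, let $\Psi(a)$ be the coefficient of $\psi(-2\eta a_1)$ at $e[a_1-a_2]\otimes\cdots\otimes e[a_n-a_1]$. Then $\Psi$ is an eigenvector of the row-to-row transfer matrix: for all $w$ with $w\not\equiv q_k$ for all $k$, and all closed paths $b$, $$\sum_{a}\ \prod_{j=1}^n w(b_j,a_j,a_{j+1},b_{j+1};w-z_j)\,\Psi(a)=\varepsilon(w)\,\Psi(b),$$ the sum being over closed paths $a$ with $a_j-b_j=\pm1$ for all $j$; and $\Psi\ne0$ unless $\psi$ is identically zero. -/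

import Mathlib

open Filter Topology

noncomputable section

namespace EllipticBethe

/-! ### Theta function and dynamical R-matrix -/

/-- Jacobi's theta function
`θ(t) = -∑_{j ∈ ℤ} exp(πi (j+1/2)² τ + 2πi (j+1/2)(t+1/2))`. -/
def theta (τ t : ℂ) : ℂ :=
  -∑' j : ℤ, Complex.exp (Real.pi * Complex.I * ((j : ℂ) + 1 / 2) ^ 2 * τ
      + 2 * Real.pi * Complex.I * ((j : ℂ) + 1 / 2) * (t + 1 / 2))

/-- `α(z,λ) = θ(λ+2η)θ(z) / (θ(λ)θ(z-2η))`. -/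
def alphaFn (τ η z l : ℂ) : ℂ :=
  theta τ (l + 2 * η) * theta τ z / (theta τ l * theta τ (z - 2 * η))

/-- `β(z,λ) = -θ(λ+z)θ(2η) / (θ(λ)θ(z-2η))`. -/
def betaFn (τ η z l : ℂ) : ℂ :=
  -(theta τ (l + z) * theta τ (2 * η)) / (theta τ l * theta τ (z - 2 * η))

/-- The basis vectors `e[1]`, `e[-1]` of the two-dimensional space `V` are indexed by
`0, 1 : Fin 2`; `sgn` is the weight of `e[±1]`. -/
def sgn : Fin 2 → ℤ := ![1, -1]

/-- Matrix elements of the R-matrix: `R(z,λ) (e_α ⊗ e_β) = ∑_{γ,δ} (rMat z λ γ δ α β) e_γ ⊗ e_δ`.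
-/
def rMat (τ η z l : ℂ) (γ δ α β : Fin 2) : ℂ :=
  if γ = δ ∧ α = γ ∧ β = γ then 1
  else if γ = 0 ∧ δ = 1 ∧ α = 0 ∧ β = 1 then alphaFn τ η z l
  else if γ = 1 ∧ δ = 0 ∧ α = 1 ∧ β = 0 then alphaFn τ η z (-l)
  else if γ = 0 ∧ δ = 1 ∧ α = 1 ∧ β = 0 then betaFn τ η z l
  else if γ = 1 ∧ δ = 0 ∧ α = 0 ∧ β = 1 then betaFn τ η z (-l)
  else 0

/-! ### Meromorphic dependence on two variables

A meromorphic function is represented by a function which takes arbitrary values at its poles;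
identities between meromorphic functions are imposed at the points where everything is regular. -/

/-- `F` is meromorphic on `ℂ²`: near every point it is a quotient `f / g` of analytic functions,
where `g` does not vanish identically near that point. -/
def IsMeromorphic₂ (F : ℂ × ℂ → ℂ) : Prop :=
  ∀ p : ℂ × ℂ, ∃ f g : ℂ × ℂ → ℂ, AnalyticAt ℂ f p ∧ AnalyticAt ℂ g p ∧
    (∃ᶠ q in 𝓝 p, g q ≠ 0) ∧ ∀ᶠ q in 𝓝 p, g q ≠ 0 → F q = f q / g q

section
variable {W : Type*} [AddCommGroup W] [Module ℂ W]

/-- The matrix entry `(β, α)` of the family `L`, on the weight space `W[ν]` of `h`, is regular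
(jointly analytic) at the point `(z, λ)`. -/
def EntryRegularAt (h : Module.End ℂ W) (L : ℂ → ℂ → Fin 2 → Fin 2 → Module.End ℂ W)
    (β α : Fin 2) (ν z l : ℂ) : Prop :=
  ∀ u ∈ h.eigenspace ν, ∀ φ : Module.Dual ℂ W,
    AnalyticAt ℂ (fun p : ℂ × ℂ => φ (L p.1 p.2 β α u)) (z, l)

/-- A vector-valued function of `λ` is regular (analytic) at the point `l`. -/
def VecRegularAt (f : ℂ → W) (l : ℂ) : Prop :=
  ∀ φ : Module.Dual ℂ W, AnalyticAt ℂ (fun x => φ (f x)) l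

end

/-! ### Modules over the elliptic quantum group -/

/-- A module over `E_{τ,η}(sl₂)`: a diagonalizable `h`-module `W` with finite dimensional weight
spaces, with an `L`-operator `L(z,λ) ∈ End(V ⊗ W)`, written as a two by two matrix of operators on
`W`: `L(z,λ) (e_α ⊗ u) = ∑_β e_β ⊗ (L z λ β α) u`.  So `L z λ 0 0`, `L z λ 0 1`, `L z λ 1 0`,
`L z λ 1 1` are the coefficients of the operators `a(z)`, `b(z)`, `c(z)`, `d(z)`. -/
structure EModule (τ η : ℂ) (W : Type*) [AddCommGroup W] [Module ℂ W] where
  h : Module.End ℂ W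
  L : ℂ → ℂ → Fin 2 → Fin 2 → Module.End ℂ W
  iSup_weight : ⨆ ν : ℂ, h.eigenspace ν = ⊤
  finite_weight : ∀ ν : ℂ, FiniteDimensional ℂ (h.eigenspace ν)
  /-- `L(z,λ)` commutes with `h⁽¹⁾ + h⁽²⁾`. -/
  L_weight : ∀ (z l : ℂ) (β α : Fin 2) (ν : ℂ), ∀ u ∈ h.eigenspace ν,
    L z l β α u ∈ h.eigenspace (ν + sgn α - sgn β)
  L_merom : ∀ (β α : Fin 2) (u : W) (φ : Module.Dual ℂ W),
    IsMeromorphic₂ fun p => φ (L p.1 p.2 β α u)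
  /-- The relation
  `R⁽¹²⁾(z-w, λ-2ηh⁽³⁾) L⁽¹³⁾(z,λ) L⁽²³⁾(w, λ-2ηh⁽¹⁾)
    = L⁽²³⁾(w,λ) L⁽¹³⁾(z, λ-2ηh⁽²⁾) R⁽¹²⁾(z-w,λ)`,
  applied to `e_α ⊗ e_β ⊗ u` with `u ∈ W[ν]`, coefficient of `e_γ ⊗ e_δ`, at all points where all
  the factors are regular. -/
  rll : ∀ (z w l ν : ℂ), theta τ (z - w - 2 * η) ≠ 0 → theta τ l ≠ 0 →
    (∀ k : ℤ, theta τ (l - 2 * η * (ν + k)) ≠ 0) →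
    (∀ k ∈ ({-1, 0, 1} : Set ℤ), ∀ s ∈ ({-1, 0, 1} : Set ℤ), ∀ β α : Fin 2,
      EntryRegularAt h L β α (ν + 2 * k) z (l + 2 * η * s) ∧
      EntryRegularAt h L β α (ν + 2 * k) w (l + 2 * η * s)) →
    ∀ u ∈ h.eigenspace ν, ∀ γ δ α β : Fin 2,
      ∑ α' : Fin 2, ∑ β' : Fin 2,
          rMat τ η (z - w) (l - 2 * η * (ν + sgn α + sgn β - sgn α' - sgn β')) γ δ α' β' •
            L z l α' α (L w (l - 2 * η * sgn α) β' β u)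
        = ∑ α' : Fin 2, ∑ β' : Fin 2,
          rMat τ η (z - w) l α' β' α β •
            L w l δ β' (L z (l - 2 * η * sgn β') γ α' u)

/-! ### The parameters -/

/-- `p_j = z_j + η(1 - Λ_j)`. -/
def pPar {n : ℕ} (η : ℂ) (z Λ : Fin n → ℂ) (j : Fin n) : ℂ := z j + η * (-Λ j + 1)

/-- `q_j = z_j + η(1 + Λ_j)`. -/
def qPar {n : ℕ} (η : ℂ) (z Λ : Fin n → ℂ) (j : Fin n) : ℂ := z j + η * (Λ j + 1)

/-- The highest weight function
`D(x,λ) = θ(λ-2ηΛ)/θ(λ) ∏_j θ(x-p_j)/θ(x-q_j)`, where `Λ = ∑ Λ_j`. -/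
def highestD {n : ℕ} (τ η : ℂ) (z Λ : Fin n → ℂ) (x l : ℂ) : ℂ :=
  theta τ (l - 2 * η * ∑ j, Λ j) / theta τ l *
    ∏ j, theta τ (x - pPar η z Λ j) / theta τ (x - qPar η z Λ j)

/-- The function `e^{cλ} ∏_{j=1}^m θ(λ-2ηj)`. -/
def gFn (τ η c : ℂ) (m : ℕ) (l : ℂ) : ℂ :=
  Complex.exp (c * l) * ∏ j ∈ Finset.Icc 1 m, theta τ (l - 2 * η * j)

/-- `b(t₁) ⋯ b(t_m) v` for the difference operators `(b(t)f)(λ) = b(t,λ) f(λ+2η)`. -/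
def betheVector {W : Type*} [AddCommGroup W] [Module ℂ W] (η : ℂ)
    (b : ℂ → ℂ → Module.End ℂ W) (v : ℂ → W) : List ℂ → ℂ → W
  | [] => v
  | t :: ts => fun l => b t l (betheVector η b v ts (l + 2 * η))

/-- The Bethe ansatz equations. Since the right-hand side is not zero, they force all the theta
functions in the numerators and denominators to be non-zero. -/
def BetheEquations {n m : ℕ} (τ η : ℂ) (z Λ : Fin n → ℂ) (c : ℂ) (t : Fin m → ℂ) : Prop :=
  ∀ i, (∏ j ∈ Finset.univ.erase i,
        theta τ (t j - t i - 2 * η) / theta τ (t j - t i + 2 * η)) *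
      (∏ k, theta τ (t i - qPar η z Λ k) / theta τ (t i - pPar η z Λ k))
    = Complex.exp (4 * η * c)

/-- The eigenvalue `ε(w)`. -/
def betheEigenvalue {n m : ℕ} (τ η : ℂ) (z Λ : Fin n → ℂ) (c : ℂ) (t : Fin m → ℂ) (w : ℂ) : ℂ :=
  Complex.exp (-2 * η * c) * (∏ j, theta τ (t j - w - 2 * η) / theta τ (t j - w)) +
    Complex.exp (2 * η * c) * (∏ j, theta τ (t j - w + 2 * η) / theta τ (t j - w)) *
      ∏ k, theta τ (w - pPar η z Λ k) / theta τ (w - qPar η z Λ k)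

/-- The set `C_μ = {μ + 2ηj, j ∈ ℤ}`. -/
def latticeC (η μ : ℂ) : Set ℂ := {l | ∃ j : ℤ, l = μ + 2 * η * j}

theorem latticeC_sub {η μ l : ℂ} (hl : l ∈ latticeC η μ) : l - 2 * η ∈ latticeC η μ := by
  obtain ⟨j, rfl⟩ := hl
  exact ⟨j - 1, by push_cast; ring⟩

theorem latticeC_add {η μ l : ℂ} (hl : l ∈ latticeC η μ) : l + 2 * η ∈ latticeC η μ := by
  obtain ⟨j, rfl⟩ := hl
  exact ⟨j + 1, by push_cast; ring⟩

namespace EModule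

variable {τ η : ℂ} {W : Type*} [AddCommGroup W] [Module ℂ W] (M : EModule τ η W)

/-- `v₀ ∈ Fun(W)` is a highest weight vector of weight `(Λ, A, D)` with `A = 1` and `D` as in
`highestD`: it is a non-zero meromorphic function with values in `W[Λ]`, `Λ = ∑ Λ_j`, such that
`c(x)v₀ = 0`, `a(x)v₀ = v₀`, `d(x)v₀ = D(x,λ)v₀`, where `(a(x)f)(λ) = a(x,λ)f(λ-2η)`,
`(c(x)f)(λ) = c(x,λ)f(λ-2η)` and `(d(x)f)(λ) = d(x,λ)f(λ+2η)`. -/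
structure IsHighestWeightVector {n : ℕ} (z Λ : Fin n → ℂ) (v₀ : ℂ → W) : Prop where
  mem : ∀ l, v₀ l ∈ M.h.eigenspace (∑ j, Λ j)
  merom : ∀ φ : Module.Dual ℂ W, Meromorphic fun l => φ (v₀ l)
  ne_zero : ¬ (v₀ =ᶠ[codiscrete ℂ] 0)
  c_apply : ∀ x l, EntryRegularAt M.h M.L 1 0 (∑ j, Λ j) x l → VecRegularAt v₀ (l - 2 * η) →
    M.L x l 1 0 (v₀ (l - 2 * η)) = 0
  a_apply : ∀ x l, EntryRegularAt M.h M.L 0 0 (∑ j, Λ j) x l → VecRegularAt v₀ (l - 2 * η) →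
    VecRegularAt v₀ l → M.L x l 0 0 (v₀ (l - 2 * η)) = v₀ l
  d_apply : ∀ x l, EntryRegularAt M.h M.L 1 1 (∑ j, Λ j) x l → VecRegularAt v₀ (l + 2 * η) →
    VecRegularAt v₀ l → theta τ l ≠ 0 → (∀ j, theta τ (x - qPar η z Λ j) ≠ 0) →
    M.L x l 1 1 (v₀ (l + 2 * η)) = highestD τ η z Λ x l • v₀ l

/-- The operator `b(x)` on `Fun(W)` is defined: on each weight space, `x` is not in the singular
locus of the entry `b` for all but a discrete set of `λ`. -/
def BDefinedAt (x : ℂ) : Prop :=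
  ∀ ν : ℂ, ∀ᶠ l in codiscrete ℂ, EntryRegularAt M.h M.L 0 1 ν x l

/-- The Bethe vector `b(t₁)⋯b(t_m)v`, `v(λ) = e^{cλ} ∏_{j=1}^m θ(λ-2ηj) v₀(λ)`. -/
def bethe (v₀ : ℂ → W) (c : ℂ) {m : ℕ} (t : Fin m → ℂ) : ℂ → W :=
  betheVector η (fun x l => M.L x l 0 1) (fun l => gFn τ η c m l • v₀ l) (List.ofFn t)

/-- `Fun_μ(W)[0]`: all functions `C_μ → W[0]`. -/
abbrev FunZero (μ : ℂ) : Type _ := latticeC η μ → M.h.eigenspace (0 : ℂ)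

/-- The operator `T(w) = a(w) + d(w)` is well-defined on `Fun_μ(W)[0]`: its coefficients have no
poles at the points of `C_μ`. -/
def TransferDefinedOn (μ w : ℂ) : Prop :=
  ∀ l ∈ latticeC η μ, EntryRegularAt M.h M.L 0 0 0 w l ∧ EntryRegularAt M.h M.L 1 1 0 w l

theorem diag_mem (x l : ℂ) (α : Fin 2) (u : M.h.eigenspace (0 : ℂ)) :
    M.L x l α α u ∈ M.h.eigenspace (0 : ℂ) := by
  have := M.L_weight x l α α 0 u u.2
  simpa using this

/-- The transfer matrix `(T(w)f)(λ) = a(w,λ)f(λ-2η) + d(w,λ)f(λ+2η)` on `Fun_μ(W)[0]`. -/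
def transfer (μ w : ℂ) : Module.End ℂ (M.FunZero μ) where
  toFun f l :=
    ⟨M.L w l 0 0 (f ⟨(l : ℂ) - 2 * η, latticeC_sub l.2⟩), M.diag_mem _ _ _ _⟩ +
    ⟨M.L w l 1 1 (f ⟨(l : ℂ) + 2 * η, latticeC_add l.2⟩), M.diag_mem _ _ _ _⟩
  map_add' f g := by
    ext l
    simp only [Pi.add_apply, Submodule.coe_add, map_add]
    abel
  map_smul' r f := by
    ext l
    simp

end EModule

/-! ### Tensor products of modules with explicit bases -/

/-- The `L`-operator
`L(x,λ) = L₁⁽⁰¹⁾(x, λ-2η∑_{i>1}h⁽ⁱ⁾) ⋯ L_{n-1}⁽⁰ⁿ⁻¹⁾(x, λ-2ηh⁽ⁿ⁾) L_n⁽⁰ⁿ⁾(x,λ)` of a tensor product of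
`n` modules. All factors have bases labelled by `ι`, the `k`-th basis vector of the `j`-th factor
has weight `wt j k`, and
`L_j(x,λ)(e_α ⊗ e_k) = ∑_β (coef j x λ β α k) e_β ⊗ e_{next β α k}`.
The sum is over the values `σ` of the index of `V` between the factors. -/
def tensorL {ι : Type} {n : ℕ} (η : ℂ) (wt : Fin n → ι → ℂ) (next : Fin 2 → Fin 2 → ι → ι)
    (coef : Fin n → ℂ → ℂ → Fin 2 → Fin 2 → ι → ℂ) (x l : ℂ) (β α : Fin 2) :
    Module.End ℂ ((Fin n → ι) →₀ ℂ) :=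
  Finsupp.linearCombination ℂ fun k : Fin n → ι =>
    ∑ σ : Fin (n + 1) → Fin 2,
      if σ 0 = β ∧ σ (Fin.last n) = α then
        Finsupp.single (fun j => next (σ j.castSucc) (σ j.succ) (k j))
          (∏ j, coef j x
            (l - 2 * η * ∑ i ∈ Finset.Ioi j, wt i (next (σ i.castSucc) (σ i.succ) (k i)))
            (σ j.castSucc) (σ j.succ) (k j))
      else 0

/-- Matrix elements of the evaluation Verma module `V_Λ(z)` in the basis `e_0, e_1, e_2, …`, with
`h e_k = (Λ-2k) e_k`; here `y = x - z`. They are the coefficients of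
`a(x)e_k ∝ e_k`, `b(x)e_k ∝ e_{k+1}`, `c(x)e_k ∝ e_{k-1}`, `d(x)e_k ∝ e_k`. -/
def evalCoef (τ η Λ y l : ℂ) (β α : Fin 2) (k : ℕ) : ℂ :=
  (if β = 0 ∧ α = 0 then
    theta τ (y - (Λ + 1 - 2 * k) * η) * theta τ (l + 2 * k * η)
  else if β = 0 ∧ α = 1 then
    -(theta τ (l + y - (Λ - 1 - 2 * k) * η) * theta τ (2 * η))
  else if β = 1 ∧ α = 0 then
    theta τ (y - l + (Λ + 1 - 2 * k) * η) * theta τ (2 * (Λ + 1 - k) * η) * theta τ (2 * k * η)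
      / theta τ (2 * η)
  else
    theta τ (y - (1 - Λ + 2 * k) * η) * theta τ (l - 2 * (Λ - k) * η))
  / (theta τ (y - (Λ + 1) * η) * theta τ l)

/-- The `L`-operator of `V_{Λ_1}(z_1) ⊗ ⋯ ⊗ V_{Λ_n}(z_n)`. -/
def vermaL {n : ℕ} (τ η : ℂ) (z Λ : Fin n → ℂ) :
    ℂ → ℂ → Fin 2 → Fin 2 → Module.End ℂ ((Fin n → ℕ) →₀ ℂ) :=
  tensorL η (fun j k => Λ j - 2 * k) (fun β α k => k + (α : ℕ) - (β : ℕ))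
    (fun j x l β α k => evalCoef τ η (Λ j) (x - z j) l β α k)

/-- The Bethe vector in `V_{Λ_1}(z_1) ⊗ ⋯ ⊗ V_{Λ_n}(z_n)`, for `v₀ = e_0 ⊗ ⋯ ⊗ e_0`. -/
def vermaBethe {n m : ℕ} (τ η : ℂ) (z Λ : Fin n → ℂ) (c : ℂ) (t : Fin m → ℂ) :
    ℂ → ((Fin n → ℕ) →₀ ℂ) :=
  betheVector η (fun x l => vermaL τ η z Λ x l 0 1)
    (fun l => gFn τ η c m l • Finsupp.single 0 1) (List.ofFn t)

/-! ### Interaction-round-a-face models -/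

/-- The `L`-operator of the tensor product of the fundamental representations `V(z_j)`, for which
`L_j(x,λ) = R(x-z_j,λ)`. The matrix elements of `R` with `β ≠ α` vanish unless the second factor
goes from `e_β` to `e_α`. -/
def fundL {n : ℕ} (τ η : ℂ) (z : Fin n → ℂ) :
    ℂ → ℂ → Fin 2 → Fin 2 → Module.End ℂ ((Fin n → Fin 2) →₀ ℂ) :=
  tensorL η (fun _ k => (sgn k : ℂ)) (fun β α k => if β = α then k else α)
    (fun j x l β α k => rMat τ η (x - z j) l β (if β = α then k else α) α k)

/-- The Bethe vector in `V(z_1) ⊗ ⋯ ⊗ V(z_n)`, for `v₀ = e[1] ⊗ ⋯ ⊗ e[1]`. -/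
def fundBethe {n m : ℕ} (τ η : ℂ) (z : Fin n → ℂ) (c : ℂ) (t : Fin m → ℂ) :
    ℂ → ((Fin n → Fin 2) →₀ ℂ) :=
  betheVector η (fun x l => fundL τ η z x l 0 1)
    (fun l => gFn τ η c m l • Finsupp.single 0 1) (List.ofFn t)

/-- The index of the basis vector `e[s]`, `s = ±1`. -/
def idx (s : ℤ) : Fin 2 := if s = 1 then 0 else 1

/-- The Boltzmann weight `w(κ+a, κ+b, κ+c, κ+d; x)`, defined by
`R(x, -2η(κ+d)) e[c-d] ⊗ e[b-c] = ∑_a w(κ+a, κ+b, κ+c, κ+d; x) e[b-a] ⊗ e[a-d]`. The heights of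
the model are the numbers `κ + a` with `a ∈ ℤ`. -/
def boltzmann (τ η κ : ℂ) (a b c d : ℤ) (x : ℂ) : ℂ :=
  rMat τ η x (-2 * η * (κ + d)) (idx (b - a)) (idx (a - d)) (idx (c - d)) (idx (b - c))

/-- `(a_1, …, a_n, a_{n+1} = a_1)` is a closed path: neighbouring heights differ by `±1`. -/
def IsClosedPath {n : ℕ} (a : Fin (n + 1) → ℤ) : Prop :=
  a 0 = a (Fin.last n) ∧ ∀ j : Fin n, |a j.castSucc - a j.succ| = 1

open Classical in
/-- The row-to-row transfer matrix
`∑_a (∏_j w(b_j, a_j, a_{j+1}, b_{j+1}; x-z_j)) Ψ(a)` of the inhomogeneous IRF model. The sum is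
over the closed paths `a` with `a_j - b_j = ±1` for all `j`. -/
def irfTransfer {n : ℕ} (τ η κ : ℂ) (z : Fin n → ℂ) (x : ℂ) (Ψ : (Fin (n + 1) → ℤ) → ℂ)
    (b : Fin (n + 1) → ℤ) : ℂ :=
  ∑ s : Fin (n + 1) → Fin 2,
    let a : Fin (n + 1) → ℤ := fun j => b j + sgn (s j)
    if IsClosedPath a then
      (∏ j : Fin n, boltzmann τ η κ (b j.castSucc) (a j.castSucc) (a j.succ) (b j.succ) (x - z j))
        * Ψ a
    else 0

/-- The coefficients `Ψ(a)` of `ψ = ∑_a Ψ(a)|a⟩`, where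
`|a⟩(λ) = δ(λ+2ηa_1) e[a_1-a_2] ⊗ ⋯ ⊗ e[a_n-a_1]` and the heights are `κ + a_j`. -/
def pathCoeff {n : ℕ} (η κ : ℂ) (ψ : ℂ → ((Fin n → Fin 2) →₀ ℂ)) (a : Fin (n + 1) → ℤ) : ℂ :=
  ψ (-2 * η * (κ + a 0)) fun j => idx (a j.castSucc - a j.succ)

end EllipticBethe

end

/-!
The `RLL` relation says that the operators `b(t_i)` commute and how `a(w)` and `d(w)` move past
them. Moving `T(w) = a(w) + d(w)` through `b(t_1) ⋯ b(t_m) v` yields `ε(w) ψ` plus, for each `i`, a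
vector in which `t_i` is replaced by `w`; its coefficient vanishes exactly when the `i`-th Bethe
equation holds. All the identities between coefficients are instances of the three-term identity of
theta functions. The argument needs the spectral parameters to avoid a countable set of poles; the
general case follows by translating all the `t_i` by a common `s → 0`, which preserves everything
that depends on the differences `t_i - t_j`. Since poles and zeros of meromorphic functions
are countable, `C_μ` avoids all those that matter for all but countably many `μ`.

That `θ` vanishes only on `ℤ + τℤ` comes from the three-term identity as well: if `θ(a) = 0`, then
its derivative shows that the Wronskian of `θ(u)` and `θ(u - a)` is a multiple of their product, so
that `θ(u) = C exp(Bu) θ(u - a)`, and comparing multipliers gives `a ∈ ℤ + τℤ`.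

In a tensor product of evaluation Verma modules, `e_m ⊗ e_0 ⊗ ⋯ ⊗ e_0` is reached from
`e_0 ⊗ ⋯ ⊗ e_0` only by applying each `b(t_i)` to the first factor, so its coefficient in `ψ` is an
explicit product of theta functions, not identically zero.

For the fundamental representations, the `RLL` relation is the dynamical Yang-Baxter equation,
carried through the tensor factors by induction. In the basis of paths, `T(w)` at `λ = -2ηa_1` is
the row-to-row transfer matrix, because `R(z, λ)` preserves the weight.
-/

noncomputable section

namespace EllipticBethe

/-! ### The theta function -/

theorem theta_eq_jacobiTheta₂ (τ t : ℂ) :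
    theta τ t = -(Complex.exp (Real.pi * Complex.I * (τ / 4 + (t + 1 / 2))) *
      jacobiTheta₂ (t + 1 / 2 + τ / 2) τ) := by
  unfold theta jacobiTheta₂ jacobiTheta₂_term
  rw [← tsum_mul_left]
  congr 2
  ext j
  rw [← Complex.exp_add]
  congr 1
  ring

theorem theta_add_one (τ t : ℂ) : theta τ (t + 1) = -theta τ t := by
  rw [theta_eq_jacobiTheta₂, theta_eq_jacobiTheta₂,
    show t + 1 + 1 / 2 + τ / 2 = (t + 1 / 2 + τ / 2) + 1 by ring, jacobiTheta₂_add_left,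
    show (Real.pi * Complex.I * (τ / 4 + (t + 1 + 1 / 2)) : ℂ)
      = Real.pi * Complex.I * (τ / 4 + (t + 1 / 2)) + Real.pi * Complex.I by ring,
    Complex.exp_add, Complex.exp_pi_mul_I]
  ring

theorem theta_add_tau (τ t : ℂ) :
    theta τ (t + τ) = -(Complex.exp (-Real.pi * Complex.I * (τ + 2 * t)) * theta τ t) := by
  have hexp : (Real.pi * Complex.I * (τ / 4 + (t + τ + 1 / 2)) +
      -Real.pi * Complex.I * (τ + 2 * (t + 1 / 2 + τ / 2)) : ℂ)
      = (-Real.pi * Complex.I * (τ + 2 * t) + Real.pi * Complex.I * (τ / 4 + (t + 1 / 2)))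
        - Real.pi * Complex.I := by ring
  rw [theta_eq_jacobiTheta₂, theta_eq_jacobiTheta₂,
    show t + τ + 1 / 2 + τ / 2 = (t + 1 / 2 + τ / 2) + τ by ring, jacobiTheta₂_add_left',
    mul_neg, ← mul_assoc, ← mul_assoc, ← Complex.exp_add, ← Complex.exp_add, neg_neg,
    ← neg_mul, hexp, Complex.exp_sub, Complex.exp_pi_mul_I, div_neg, div_one, neg_neg]

theorem theta_neg (τ t : ℂ) : theta τ (-t) = -theta τ t := by
  unfold theta
  congr 1
  rw [← tsum_neg, ← (Equiv.subLeft (-1 : ℤ)).tsum_eq]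
  refine tsum_congr fun j => ?_
  rw [← neg_one_mul (Complex.exp _), ← Complex.exp_pi_mul_I, ← Complex.exp_add,
    Complex.exp_eq_exp_iff_exists_int]
  refine ⟨-j - 1, ?_⟩
  simp only [Equiv.subLeft_apply]
  push_cast
  ring

theorem theta_eq_neg_theta {τ x y : ℂ} (h : x = -y) : theta τ x = -theta τ y := by
  rw [h, theta_neg]

@[simp] theorem theta_zero (τ : ℂ) : theta τ 0 = 0 :=
  self_eq_neg.1 (theta_eq_neg_theta neg_zero.symm)

theorem theta_sub_comm (τ x y : ℂ) : theta τ (x - y) = -theta τ (y - x) :=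
  theta_eq_neg_theta (neg_sub y x).symm

theorem differentiable_theta {τ : ℂ} (hτ : 0 < τ.im) : Differentiable ℂ (theta τ) := by
  rw [funext (theta_eq_jacobiTheta₂ τ)]
  intro t
  have h₂ : DifferentiableAt ℂ (fun t : ℂ => jacobiTheta₂ (t + 1 / 2 + τ / 2) τ) t :=
    (differentiableAt_jacobiTheta₂_fst (t + 1 / 2 + τ / 2) hτ).comp
      (f := fun t : ℂ => t + 1 / 2 + τ / 2) t (by fun_prop)
  fun_prop

theorem analyticAt_theta {τ : ℂ} (hτ : 0 < τ.im) (t : ℂ) : AnalyticAt ℂ (theta τ) t :=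
  (differentiable_theta hτ).analyticAt t

/-! ### The three-term identity -/

/-- The `j`-th summand of the series `-θ(t)`. -/
def thetaTerm (τ t : ℂ) (j : ℤ) : ℂ :=
  Complex.exp (Real.pi * Complex.I * ((j : ℂ) + 1 / 2) ^ 2 * τ
    + 2 * Real.pi * Complex.I * ((j : ℂ) + 1 / 2) * (t + 1 / 2))

theorem summable_norm_thetaTerm {τ : ℂ} (hτ : 0 < τ.im) (t : ℂ) :
    Summable fun j => ‖thetaTerm τ t j‖ := by
  refine Summable.norm ((((summable_jacobiTheta₂_term_iff (t + 1 / 2 + τ / 2) τ).2 hτ).mul_left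
    (Complex.exp (Real.pi * Complex.I * (τ / 4 + (t + 1 / 2))))).congr fun j => ?_)
  rw [jacobiTheta₂_term, thetaTerm, ← Complex.exp_add]
  congr 1
  ring

/-- The summand of index `p = 2a` of the series `∑_p exp(πiτp²/2 + 2πipx)`. -/
def thetaEvenTerm (τ x : ℂ) (a : ℤ) : ℂ := jacobiTheta₂_term a (2 * x) (2 * τ)

/-- The summand of index `p = 2a + 1` of the series `∑_p exp(πiτp²/2 + 2πipx)`. -/
def thetaOddTerm (τ x : ℂ) (a : ℤ) : ℂ :=
  Complex.exp (Real.pi * Complex.I * (τ / 2 + 2 * x)) * jacobiTheta₂_term a (2 * x + τ) (2 * τ)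

/-- The part of `∑_p exp(πiτp²/2 + 2πipx)` with even `p`, in which (together with `thetaOdd`)
`θ(x+y)θ(x-y)` is bilinear. -/
def thetaEven (τ x : ℂ) : ℂ := ∑' a : ℤ, thetaEvenTerm τ x a

/-- The part of `∑_p exp(πiτp²/2 + 2πipx)` with odd `p`. -/
def thetaOdd (τ x : ℂ) : ℂ := ∑' a : ℤ, thetaOddTerm τ x a

theorem summable_norm_thetaEvenTerm {τ : ℂ} (hτ : 0 < τ.im) (x : ℂ) :
    Summable fun a => ‖thetaEvenTerm τ x a‖ :=
  ((summable_jacobiTheta₂_term_iff (2 * x) (2 * τ)).2 (by simpa using hτ)).norm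

theorem summable_norm_thetaOddTerm {τ : ℂ} (hτ : 0 < τ.im) (x : ℂ) :
    Summable fun a => ‖thetaOddTerm τ x a‖ :=
  (((summable_jacobiTheta₂_term_iff (2 * x + τ) (2 * τ)).2 (by simpa using hτ)).mul_left _).norm

/-- The bijection `(a, b) ↦ (a + b, a - b - 1)`, resp. `(a + b, a - b)`, of two copies of `ℤ × ℤ`
onto the pairs with odd, resp. even, sum. It reindexes the double series `θ(x+y)θ(x-y)`. -/
def sumDiffEquiv : (ℤ × ℤ) ⊕ (ℤ × ℤ) ≃ ℤ × ℤ where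
  toFun := Sum.elim (fun p => (p.1 + p.2, p.1 - p.2 - 1)) (fun p => (p.1 + p.2, p.1 - p.2))
  invFun p := if (p.1 + p.2) % 2 = 0 then Sum.inr ((p.1 + p.2) / 2, (p.1 - p.2) / 2)
    else Sum.inl ((p.1 + p.2 + 1) / 2, (p.1 - p.2 - 1) / 2)
  left_inv := by
    rintro (⟨a, b⟩ | ⟨a, b⟩)
    · have hodd : ¬ (a + b + (a - b - 1)) % 2 = 0 := by omega
      simp only [Sum.elim_inl, hodd, if_false, Sum.inl.injEq, Prod.mk.injEq]
      omega
    · have heven : (a + b + (a - b)) % 2 = 0 := by omega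
      simp only [Sum.elim_inr, heven, if_true, Sum.inr.injEq, Prod.mk.injEq]
      omega
  right_inv := by
    rintro ⟨j, k⟩
    by_cases h : (j + k) % 2 = 0
    · simp only [h, if_true, Sum.elim_inr, Prod.mk.injEq]
      omega
    · simp only [h, if_false, Sum.elim_inl, Prod.mk.injEq]
      omega

theorem thetaTerm_mul_thetaTerm_sub_one (τ x y : ℂ) (a b : ℤ) :
    thetaTerm τ (x + y) (a + b) * thetaTerm τ (x - y) (a - b - 1) =
      thetaEvenTerm τ x a * thetaOddTerm τ y b := by
  simp only [thetaTerm, thetaEvenTerm, thetaOddTerm, jacobiTheta₂_term, ← Complex.exp_add]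
  rw [Complex.exp_eq_exp_iff_exists_int]
  refine ⟨a, ?_⟩
  push_cast
  ring

theorem thetaTerm_mul_thetaTerm (τ x y : ℂ) (a b : ℤ) :
    thetaTerm τ (x + y) (a + b) * thetaTerm τ (x - y) (a - b) =
      -(thetaOddTerm τ x a * thetaEvenTerm τ y b) := by
  simp only [thetaTerm, thetaEvenTerm, thetaOddTerm, jacobiTheta₂_term, ← Complex.exp_add]
  rw [← neg_one_mul (Complex.exp _), ← Complex.exp_pi_mul_I, ← Complex.exp_add,
    Complex.exp_eq_exp_iff_exists_int]
  refine ⟨a, ?_⟩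
  push_cast
  ring

theorem theta_mul_theta {τ : ℂ} (hτ : 0 < τ.im) (x y : ℂ) :
    theta τ (x + y) * theta τ (x - y) =
      thetaEven τ x * thetaOdd τ y - thetaOdd τ x * thetaEven τ y := by
  have hθ := fun t => summable_norm_thetaTerm hτ t
  have hE := fun t => summable_norm_thetaEvenTerm hτ t
  have hO := fun t => summable_norm_thetaOddTerm hτ t
  have hodd (p : ℤ × ℤ) := (thetaTerm_mul_thetaTerm_sub_one τ x y p.1 p.2).symm
  have heven (p : ℤ × ℤ) := (thetaTerm_mul_thetaTerm τ x y p.1 p.2).symm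
  calc theta τ (x + y) * theta τ (x - y)
      = (∑' j, thetaTerm τ (x + y) j) * ∑' k, thetaTerm τ (x - y) k := neg_mul_neg _ _
    _ = ∑' p : ℤ × ℤ, thetaTerm τ (x + y) p.1 * thetaTerm τ (x - y) p.2 :=
        tsum_mul_tsum_of_summable_norm (hθ _) (hθ _)
    _ = ∑' s, thetaTerm τ (x + y) (sumDiffEquiv s).1 * thetaTerm τ (x - y) (sumDiffEquiv s).2 :=
        (sumDiffEquiv.tsum_eq _).symm
    _ = (∑' p : ℤ × ℤ, thetaEvenTerm τ x p.1 * thetaOddTerm τ y p.2) +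
          ∑' p : ℤ × ℤ, -(thetaOddTerm τ x p.1 * thetaEvenTerm τ y p.2) := by
        rw [tsum_congr hodd, tsum_congr heven]
        exact Summable.tsum_sum
          (f := fun s => thetaTerm τ (x + y) (sumDiffEquiv s).1 *
            thetaTerm τ (x - y) (sumDiffEquiv s).2)
          ((summable_mul_of_summable_norm (hE x) (hO y)).congr hodd)
          ((summable_mul_of_summable_norm (hO x) (hE y)).neg.congr heven)
    _ = thetaEven τ x * thetaOdd τ y - thetaOdd τ x * thetaEven τ y := by
        rw [tsum_neg, ← sub_eq_add_neg, ← tsum_mul_tsum_of_summable_norm (hE x) (hO y),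
          ← tsum_mul_tsum_of_summable_norm (hO x) (hE y)]
        rfl

theorem theta_three_term {τ : ℂ} (hτ : 0 < τ.im) (x y z w : ℂ) :
    theta τ (x + z) * theta τ (x - z) * (theta τ (y + w) * theta τ (y - w)) =
      theta τ (x + y) * theta τ (x - y) * (theta τ (z + w) * theta τ (z - w)) +
      theta τ (x + w) * theta τ (x - w) * (theta τ (y + z) * theta τ (y - z)) := by
  simp only [theta_mul_theta hτ]
  ring

theorem theta_three_term_of_eq {τ : ℂ} (hτ : 0 < τ.im) (x y z w : ℂ)
    {a₁ a₂ a₃ a₄ b₁ b₂ b₃ b₄ c₁ c₂ c₃ c₄ : ℂ}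
    (ha₁ : a₁ = x + z := by ring) (ha₂ : a₂ = x - z := by ring)
    (ha₃ : a₃ = y + w := by ring) (ha₄ : a₄ = y - w := by ring)
    (hb₁ : b₁ = x + y := by ring) (hb₂ : b₂ = x - y := by ring)
    (hb₃ : b₃ = z + w := by ring) (hb₄ : b₄ = z - w := by ring)
    (hc₁ : c₁ = x + w := by ring) (hc₂ : c₂ = x - w := by ring)
    (hc₃ : c₃ = y + z := by ring) (hc₄ : c₄ = y - z := by ring) :
    theta τ a₁ * theta τ a₂ * (theta τ a₃ * theta τ a₄) =
      theta τ b₁ * theta τ b₂ * (theta τ b₃ * theta τ b₄) +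
      theta τ c₁ * theta τ c₂ * (theta τ c₃ * theta τ c₄) := by
  subst_vars
  exact theta_three_term hτ x y z w

/-! ### Zeros of the theta function -/

theorem integral_jacobiTheta₂_term (n : ℤ) (τ : ℂ) :
    ∫ x in (0 : ℝ)..1, jacobiTheta₂_term n x τ = if n = 0 then 1 else 0 := by
  split_ifs with hn
  · simp [hn, jacobiTheta₂_term]
  · have hfreq : (2 * Real.pi * Complex.I * n : ℂ) ≠ 0 := by simp [Real.pi_ne_zero, hn]
    have hperiod : Complex.exp (2 * Real.pi * Complex.I * n * (1 : ℝ)) = 1 :=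
      Complex.exp_eq_one_iff.2 ⟨n, by push_cast; ring⟩
    have hterm (x : ℝ) : jacobiTheta₂_term n x τ = Complex.exp (Real.pi * Complex.I * n ^ 2 * τ) *
        Complex.exp ((2 * Real.pi * Complex.I * n) * x) := by
      rw [jacobiTheta₂_term, ← Complex.exp_add]
      congr 1
      ring
    simp only [hterm]
    rw [intervalIntegral.integral_const_mul, integral_exp_mul_complex hfreq, hperiod]
    simp

theorem integral_jacobiTheta₂ {τ : ℂ} (hτ : 0 < τ.im) :
    ∫ x in (0 : ℝ)..1, jacobiTheta₂ x τ = 1 := by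
  let term (n : ℤ) : C(ℝ, ℂ) :=
    ⟨fun x => jacobiTheta₂_term n x τ, by unfold jacobiTheta₂_term; fun_prop⟩
  have hnorm (n : ℤ) (x : ℝ) : ‖term n x‖ = ‖jacobiTheta₂_term n 0 τ‖ := by
    simp [term, norm_jacobiTheta₂_term]
  have hsummable : Summable fun n => ‖(term n).restrict (⟨Set.uIcc 0 1, isCompact_uIcc⟩ :
      TopologicalSpace.Compacts ℝ)‖ := by
    refine Summable.of_nonneg_of_le (fun _ => norm_nonneg _) (fun n => ?_)
      (((summable_jacobiTheta₂_term_iff 0 τ).2 hτ).norm)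
    exact (ContinuousMap.norm_le _ (norm_nonneg _)).2 fun x => (hnorm n x).le
  have hsum := intervalIntegral.hasSum_intervalIntegral_of_summable_norm hsummable
  refine hsum.unique ?_
  simp only [term, ContinuousMap.coe_mk, integral_jacobiTheta₂_term]
  exact hasSum_ite_eq 0 1

theorem exists_theta_ne_zero {τ : ℂ} (hτ : 0 < τ.im) : ∃ t, theta τ t ≠ 0 := by
  obtain ⟨z, hz⟩ : ∃ z, jacobiTheta₂ z τ ≠ 0 := by
    by_contra! h
    simpa [h] using integral_jacobiTheta₂ hτ
  refine ⟨z - 1 / 2 - τ / 2, ?_⟩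
  rw [theta_eq_jacobiTheta₂, show z - 1 / 2 - τ / 2 + 1 / 2 + τ / 2 = z by ring]
  exact neg_ne_zero.2 (mul_ne_zero (Complex.exp_ne_zero _) hz)

theorem eventually_theta_ne_zero {τ : ℂ} (hτ : 0 < τ.im) (t : ℂ) :
    ∀ᶠ x in 𝓝[≠] t, theta τ x ≠ 0 := by
  refine (analyticAt_theta hτ t).eventually_eq_zero_or_eventually_ne_zero.resolve_left fun h => ?_
  obtain ⟨x, hx⟩ := exists_theta_ne_zero hτ
  have hanalytic : AnalyticOnNhd ℂ (theta τ) Set.univ := fun y _ => analyticAt_theta hτ y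
  exact hx (hanalytic.eqOn_zero_of_preconnected_of_eventuallyEq_zero isPreconnected_univ
    (Set.mem_univ t) h (Set.mem_univ x))

theorem eventually_theta_add_ne_zero {τ : ℂ} (hτ : 0 < τ.im) (a t : ℂ) :
    ∀ᶠ x in 𝓝[≠] t, theta τ (x + a) ≠ 0 := by
  have htranslate : Tendsto (fun x => x + a) (𝓝[≠] t) (𝓝[≠] (t + a)) := by
    refine tendsto_nhdsWithin_iff.2 ⟨?_, ?_⟩
    · exact ((continuous_id.add continuous_const).tendsto t).mono_left nhdsWithin_le_nhds
    · filter_upwards [self_mem_nhdsWithin] with x hx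
      simpa using hx
  exact htranslate.eventually (eventually_theta_ne_zero hτ (t + a))

/-- A linear differential equation of first order, `(log f / g)' = B`, written without division. -/
theorem eq_exp_mul_of_wronskian_eq {f g : ℂ → ℂ} (hf : Differentiable ℂ f)
    (hg : Differentiable ℂ g) {B s : ℂ} (hs : g s ≠ 0)
    (hB : ∀ u, deriv f u * g u - f u * deriv g u = B * (f u * g u)) (u : ℂ) :
    f u * g s = f s * Complex.exp (B * (u - s)) * g u := by
  have hderiv (u : ℂ) (hu : g u ≠ 0) :
      HasDerivAt (fun u => f u * Complex.exp (-(B * (u - s))) / g u) 0 u := by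
    have hexp : HasDerivAt (fun u : ℂ => Complex.exp (-(B * (u - s))))
        (Complex.exp (-(B * (u - s))) * (-(B * 1))) u :=
      ((((hasDerivAt_id u).sub_const s).const_mul B).neg).cexp
    refine (((hf u).hasDerivAt.mul hexp).div (hg u).hasDerivAt hu).congr_deriv ?_
    rw [div_eq_zero_iff]
    left
    simp only [Pi.mul_apply]
    linear_combination Complex.exp (-(B * (u - s))) * hB u
  obtain ⟨r, hr, hball⟩ := Metric.mem_nhds_iff.1
    ((hg.continuous.isOpen_preimage _ isOpen_compl_singleton).mem_nhds hs)
  have hlocal : ∀ u ∈ Metric.ball s r, f u * g s = f s * Complex.exp (B * (u - s)) * g u := by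
    intro u hu
    have hconst := Metric.isOpen_ball.is_const_of_deriv_eq_zero
      (convex_ball s r).isPreconnected
      (fun x hx => (hderiv x (hball hx)).differentiableAt.differentiableWithinAt)
      (fun x hx => (hderiv x (hball hx)).deriv) hu (Metric.mem_ball_self hr)
    have hu' : g u ≠ 0 := hball hu
    simp only [sub_self, mul_zero, neg_zero, Complex.exp_zero, mul_one, Complex.exp_neg] at hconst
    have hne := Complex.exp_ne_zero (B * (u - s))
    field_simp at hconst
    linear_combination hconst
  have hleft : AnalyticOnNhd ℂ (fun u => f u * g s) Set.univ := fun u _ =>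
    (hf.mul_const _).analyticAt u
  have hright : AnalyticOnNhd ℂ (fun u => f s * Complex.exp (B * (u - s)) * g u) Set.univ :=
    fun u _ => Differentiable.analyticAt (by fun_prop) u
  exact congrFun (hleft.eq_of_eventuallyEq hright (z₀ := s)
    (eventually_of_mem (Metric.ball_mem_nhds s hr) hlocal)) u

theorem theta_mul_theta_translate {τ : ℂ} (hτ : 0 < τ.im) {a : ℂ} (ha : theta τ a = 0)
    (u v e : ℂ) :
    theta τ u * theta τ v * (theta τ (u + e - a) * theta τ (v - e - a)) =
      theta τ (u + e) * theta τ (v - e) * (theta τ (u - a) * theta τ (v - a)) := by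
  have h : theta τ u * theta τ v * (theta τ (u + e - a) * theta τ (v - e - a)) =
      theta τ (u + v - a) * theta τ a * (theta τ (u - v + e) * theta τ (-e)) +
        theta τ (u + e) * theta τ (v - e) * (theta τ (u - a) * theta τ (v - a)) :=
    theta_three_term_of_eq hτ ((u + v) / 2) ((u + v) / 2 - a) ((u - v) / 2) ((u - v) / 2 + e)
  rw [h, ha]
  ring

theorem theta_wronskian_translate {τ : ℂ} (hτ : 0 < τ.im) {a : ℂ} (ha : theta τ a = 0)
    (u v : ℂ) :
    theta τ u * theta τ v *
        (deriv (theta τ) (u - a) * theta τ (v - a) - theta τ (u - a) * deriv (theta τ) (v - a)) =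
      (deriv (theta τ) u * theta τ v - theta τ u * deriv (theta τ) v) *
        (theta τ (u - a) * theta τ (v - a)) := by
  have hderiv (x : ℂ) : HasDerivAt (theta τ) (deriv (theta τ) x) x :=
    (differentiable_theta hτ x).hasDerivAt
  have hadd (x b : ℂ) : HasDerivAt (fun e => theta τ (x + e - b)) (deriv (theta τ) (x - b)) 0 := by
    simpa using! (hderiv (x - b)).comp_of_eq (0 : ℂ)
      (((hasDerivAt_id (0 : ℂ)).const_add x).sub_const b) (by simp)
  have hsub (x b : ℂ) : HasDerivAt (fun e => theta τ (x - e - b)) (-deriv (theta τ) (x - b)) 0 := by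
    simpa using! (hderiv (x - b)).comp_of_eq (0 : ℂ)
      (((hasDerivAt_id (0 : ℂ)).const_sub x).sub_const b) (by simp)
  -- both sides of `theta_mul_theta_translate` are differentiated at `e = 0`
  have hleft := ((hadd u a).mul (hsub v a)).const_mul (theta τ u * theta τ v)
  have hright := ((hadd u 0).mul (hsub v 0)).mul_const (theta τ (u - a) * theta τ (v - a))
  have h := hleft.unique (hright.congr_of_eventuallyEq (Eventually.of_forall fun e => by
    simpa using! theta_mul_theta_translate hτ ha u v e))
  simp only [add_zero, sub_zero] at h
  linear_combination h

theorem exists_theta_eq_exp_mul_theta_sub {τ : ℂ} (hτ : 0 < τ.im) {a : ℂ} (ha : theta τ a = 0) :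
    ∃ s B : ℂ, theta τ s ≠ 0 ∧ theta τ (s - a) ≠ 0 ∧
      ∀ u, theta τ u * theta τ (s - a) =
        theta τ s * Complex.exp (B * (u - s)) * theta τ (u - a) := by
  obtain ⟨s, hs, hsa⟩ := ((eventually_theta_ne_zero hτ 0).and
    (eventually_theta_add_ne_zero hτ (-a) 0)).exists
  rw [← sub_eq_add_neg] at hsa
  have hθ := differentiable_theta hτ
  refine ⟨s, deriv (theta τ) s / theta τ s - deriv (theta τ) (s - a) / theta τ (s - a), hs, hsa,
    eq_exp_mul_of_wronskian_eq (g := fun u => theta τ (u - a)) hθ (by fun_prop) hsa fun u => ?_⟩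
  rw [deriv_comp_sub_const]
  have h := theta_wronskian_translate hτ ha u s
  field_simp
  linear_combination -h

theorem periodic_one_theta_eq_zero (τ : ℂ) : Function.Periodic (fun t => theta τ t = 0) 1 :=
  fun t => by simp only [theta_add_one, neg_eq_zero]

theorem periodic_tau_theta_eq_zero (τ : ℂ) : Function.Periodic (fun t => theta τ t = 0) τ :=
  fun t => by simp only [theta_add_tau, neg_eq_zero, mul_eq_zero, Complex.exp_ne_zero, false_or]

theorem theta_int_add_int_mul_tau (τ : ℂ) (r s : ℤ) : theta τ (r + s * τ) = 0 := by
  have hperiodic :=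
    ((periodic_one_theta_eq_zero τ).int_mul r).add_period ((periodic_tau_theta_eq_zero τ).int_mul s)
  simpa using hperiodic 0

theorem theta_eq_zero_iff {τ : ℂ} (hτ : 0 < τ.im) {a : ℂ} :
    theta τ a = 0 ↔ ∃ r s : ℤ, a = r + s * τ := by
  refine ⟨fun ha => ?_, by rintro ⟨r, s, rfl⟩; exact theta_int_add_int_mul_tau τ r s⟩
  obtain ⟨s, B, hs, hsa, h⟩ := exists_theta_eq_exp_mul_theta_sub hτ ha
  -- the multipliers of `θ(u)` and `exp(Bu)θ(u-a)` under `u ↦ u + 1` and `u ↦ u + τ` agree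
  have hone := h (s + 1)
  have htau := h (s + τ)
  rw [theta_add_one, add_sub_right_comm s 1 a, theta_add_one, add_sub_cancel_left, mul_one] at hone
  rw [theta_add_tau, add_sub_right_comm s τ a, theta_add_tau, add_sub_cancel_left] at htau
  have hexp_one : Complex.exp B = 1 :=
    mul_left_cancel₀ (mul_ne_zero hs hsa) (by linear_combination hone)
  have hexp_tau : Complex.exp (-Real.pi * Complex.I * (τ + 2 * s)) =
      Complex.exp (B * τ) * Complex.exp (-Real.pi * Complex.I * (τ + 2 * (s - a))) :=
    mul_left_cancel₀ (mul_ne_zero hs hsa) (by linear_combination -htau)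
  obtain ⟨k, hk⟩ := Complex.exp_eq_one_iff.1 hexp_one
  rw [← Complex.exp_add, Complex.exp_eq_exp_iff_exists_int] at hexp_tau
  obtain ⟨j, hj⟩ := hexp_tau
  refine ⟨-j, -k, mul_left_cancel₀ Complex.two_pi_I_ne_zero ?_⟩
  rw [hk] at hj
  push_cast
  linear_combination -hj

/-! ### The algebraic Bethe ansatz -/

@[simp] theorem sgn_zero : sgn 0 = 1 := rfl

@[simp] theorem sgn_one : sgn 1 = -1 := rfl

theorem latticeC_add_int {η μ l : ℂ} (hl : l ∈ latticeC η μ) (k : ℤ) :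
    l + 2 * η * k ∈ latticeC η μ := by
  obtain ⟨j, rfl⟩ := hl
  exact ⟨j + k, by push_cast; ring⟩

/-- Spectral parameters in general position: none of `θ(x-y)`, `θ(x-y±2η)` vanishes. -/
def Separated (τ η x y : ℂ) : Prop :=
  theta τ (x - y) ≠ 0 ∧ theta τ (x - y - 2 * η) ≠ 0 ∧ theta τ (x - y + 2 * η) ≠ 0

theorem Separated.symm {τ η x y : ℂ} (h : Separated τ η x y) : Separated τ η y x := by
  refine ⟨?_, ?_, ?_⟩
  · rw [theta_sub_comm]
    exact neg_ne_zero.2 h.1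
  · rw [theta_eq_neg_theta (y := x - y + 2 * η) (by ring)]
    exact neg_ne_zero.2 h.2.2
  · rw [theta_eq_neg_theta (y := x - y - 2 * η) (by ring)]
    exact neg_ne_zero.2 h.2.1

theorem pairwise_update_of_symm {ι α : Type*} [DecidableEq ι] {r : α → α → Prop}
    (hr : ∀ {x y}, r x y → r y x) {t : ι → α} (ht : Pairwise fun i j => r (t i) (t j)) {i : ι}
    {x : α} (hx : ∀ j ≠ i, r (t j) x) :
    Pairwise fun j k => r (Function.update t i x j) (Function.update t i x k) := by
  intro j k hjk
  rcases eq_or_ne j i with rfl | hj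
  · simpa [hjk.symm] using hr (hx k hjk.symm)
  · rcases eq_or_ne k i with rfl | hk
    · simpa [hj] using hx j hj
    · simpa [hj, hk] using ht hjk

theorem prod_univ_erase_zero {M : Type*} [CommMonoid M] {m : ℕ} (F : Fin (m + 1) → M) :
    ∏ j ∈ Finset.univ.erase 0, F j = ∏ j : Fin m, F j.succ := by
  simp [Fin.univ_succ]

theorem prod_univ_erase_succ {M : Type*} [CommMonoid M] {m : ℕ} (F : Fin (m + 1) → M)
    (i : Fin m) :
    ∏ j ∈ Finset.univ.erase i.succ, F j = F 0 * ∏ j ∈ Finset.univ.erase i, F j.succ := by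
  have h : Finset.univ.erase i.succ =
      insert 0 ((Finset.univ.erase i).map (Fin.succEmb m)) := by
    ext j
    refine Fin.cases ?_ (fun j => ?_) j
    · simp [(Fin.succ_ne_zero i).symm]
    · simp [Fin.succ_ne_zero]
  rw [h, Finset.prod_insert (by simp [Fin.succ_ne_zero]), Finset.prod_map]
  rfl

theorem ofFn_update_succ_perm_cons {α : Type*} {m : ℕ} (x y : α) (r : Fin m → α) (i : Fin m) :
    (List.ofFn (Function.update (Fin.cons x r : Fin (m + 1) → α) i.succ y)).Perm
      (y :: List.ofFn (Function.update r i x)) := by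
  have h : Function.update (Fin.cons x r : Fin (m + 1) → α) i.succ y ∘ Equiv.swap 0 i.succ =
      Fin.cons y (Function.update r i x) := by
    rw [Equiv.comp_swap_eq_update, Fin.cons_update]
    simp [Function.update_of_ne (Fin.succ_ne_zero i).symm, ← Fin.cons_update]
  rw [← List.ofFn_cons, ← h]
  exact (Equiv.Perm.ofFn_comp_perm _ _).symm

section
variable {W : Type*} [AddCommGroup W] [Module ℂ W]

/-- The `RLL` relation applied to the vector `u` of weight `ν`. -/
def RLLRelation (τ η : ℂ) (L : ℂ → ℂ → Fin 2 → Fin 2 → Module.End ℂ W) (z w l ν : ℂ) (u : W) :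
    Prop :=
  ∀ γ δ α β : Fin 2,
    ∑ α' : Fin 2, ∑ β' : Fin 2,
        rMat τ η (z - w) (l - 2 * η * (ν + sgn α + sgn β - sgn α' - sgn β')) γ δ α' β' •
          L z l α' α (L w (l - 2 * η * sgn α) β' β u)
      = ∑ α' : Fin 2, ∑ β' : Fin 2,
        rMat τ η (z - w) l α' β' α β • L w l δ β' (L z (l - 2 * η * sgn β') γ α' u)

variable {τ η μ : ℂ} {h : Module.End ℂ W} {L : ℂ → ℂ → Fin 2 → Fin 2 → Module.End ℂ W} {S : Set ℂ}

theorem RLLRelation.b_b {z w l ν : ℂ} {u : W} (H : RLLRelation τ η L z w l ν u) :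
    L z l 0 1 (L w (l + 2 * η) 0 1 u) = L w l 0 1 (L z (l + 2 * η) 0 1 u) := by
  simpa [Fin.sum_univ_two, rMat] using H 0 0 1 1

theorem RLLRelation.a_b {t w l ν : ℂ} {u : W} (H : RLLRelation τ η L t w l ν u)
    (hl : theta τ l ≠ 0) (hl' : theta τ (l - 2 * η) ≠ 0)
    (htw : theta τ (t - w) ≠ 0) (htw' : theta τ (t - w - 2 * η) ≠ 0) :
    L w l 0 0 (L t (l - 2 * η) 0 1 u) =
      (theta τ l * theta τ (t - w - 2 * η) / (theta τ (l - 2 * η) * theta τ (t - w))) •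
        L t l 0 1 (L w (l + 2 * η) 0 0 u) +
      (theta τ (l + t - w) * theta τ (2 * η) / (theta τ (l - 2 * η) * theta τ (t - w))) •
        L w l 0 1 (L t (l + 2 * η) 0 0 u) := by
  have hrel : L t l 0 1 (L w (l + 2 * η) 0 0 u) =
      alphaFn τ η (t - w) (-l) • L w l 0 0 (L t (l - 2 * η) 0 1 u) +
        betaFn τ η (t - w) l • L w l 0 1 (L t (l + 2 * η) 0 0 u) := by
    simpa [Fin.sum_univ_two, rMat, add_comm] using H 0 0 1 0
  have halpha : theta τ l * theta τ (t - w - 2 * η) / (theta τ (l - 2 * η) * theta τ (t - w)) *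
      alphaFn τ η (t - w) (-l) = 1 := by
    rw [alphaFn, theta_eq_neg_theta (show -l + 2 * η = -(l - 2 * η) by ring), theta_neg]
    field_simp
  have hbeta : theta τ l * theta τ (t - w - 2 * η) / (theta τ (l - 2 * η) * theta τ (t - w)) *
      betaFn τ η (t - w) l =
      -(theta τ (l + t - w) * theta τ (2 * η) / (theta τ (l - 2 * η) * theta τ (t - w))) := by
    rw [betaFn, ← add_sub_assoc]
    field_simp
  rw [hrel, smul_add, smul_smul, smul_smul, halpha, hbeta, one_smul, neg_smul,
    neg_add_cancel_right]

theorem RLLRelation.d_b {t w l l' ν : ℂ} {u : W} (H : RLLRelation τ η L w t l ν u)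
    (hl'_eq : l' = l - 2 * η * (ν - 2))
    (hl : theta τ l' ≠ 0) (hl' : theta τ (l' - 2 * η) ≠ 0)
    (htw : theta τ (t - w) ≠ 0) (htw' : theta τ (t - w + 2 * η) ≠ 0) :
    L w l 1 1 (L t (l + 2 * η) 0 1 u) =
      (theta τ l' * theta τ (t - w + 2 * η) / (theta τ (l' - 2 * η) * theta τ (t - w))) •
        L t l 0 1 (L w (l + 2 * η) 1 1 u) +
      (-(theta τ (l' + t - w) * theta τ (2 * η)) / (theta τ (l' - 2 * η) * theta τ (t - w))) •
        L w l 0 1 (L t (l + 2 * η) 1 1 u) := by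
  have hrel : betaFn τ η (w - t) (-l') • L w l 0 1 (L t (l + 2 * η) 1 1 u) +
      alphaFn τ η (w - t) (-l') • L w l 1 1 (L t (l + 2 * η) 0 1 u) =
        L t l 0 1 (L w (l + 2 * η) 1 1 u) := by
    have hneg : 2 * η * (ν + -1 + -1) - l = -l' := by rw [hl'_eq]; ring
    have hneg' : 2 * η * (ν + -1 - 1) - l = -l' := by rw [hl'_eq]; ring
    simpa [Fin.sum_univ_two, rMat, hneg, hneg'] using H 1 0 1 1
  have hsub : theta τ (w - t - 2 * η) = -theta τ (t - w + 2 * η) := theta_eq_neg_theta (by ring)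
  have halpha : theta τ l' * theta τ (t - w + 2 * η) / (theta τ (l' - 2 * η) * theta τ (t - w)) *
      alphaFn τ η (w - t) (-l') = 1 := by
    rw [alphaFn, theta_eq_neg_theta (show -l' + 2 * η = -(l' - 2 * η) by ring), hsub,
      theta_neg, theta_sub_comm τ w t]
    field_simp
  have hbeta : theta τ l' * theta τ (t - w + 2 * η) / (theta τ (l' - 2 * η) * theta τ (t - w)) *
      betaFn τ η (w - t) (-l') =
      -(-(theta τ (l' + t - w) * theta τ (2 * η)) / (theta τ (l' - 2 * η) * theta τ (t - w))) := by
    rw [betaFn, theta_eq_neg_theta (show -l' + (w - t) = -(l' + t - w) by ring), hsub, theta_neg]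
    field_simp
  rw [← hrel, smul_add, smul_smul, smul_smul, halpha, hbeta, one_smul, neg_smul]
  abel

/-- The `RLL` relations on even weight spaces, for dynamical parameters in `C_μ` and spectral
parameters in `S`. -/
structure RLLOn (τ η μ : ℂ) (h : Module.End ℂ W) (L : ℂ → ℂ → Fin 2 → Fin 2 → Module.End ℂ W)
    (S : Set ℂ) : Prop where
  theta_ne : ∀ l ∈ latticeC η μ, theta τ l ≠ 0
  weight : ∀ (z l : ℂ) (β α : Fin 2) (ν : ℂ), ∀ u ∈ h.eigenspace ν,
    L z l β α u ∈ h.eigenspace (ν + sgn α - sgn β)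
  rll : ∀ z ∈ S, ∀ w ∈ S, theta τ (z - w - 2 * η) ≠ 0 → ∀ l ∈ latticeC η μ, ∀ k : ℤ,
    ∀ u ∈ h.eigenspace (2 * (k : ℂ)), RLLRelation τ η L z w l (2 * k) u

theorem RLLOn.theta_add_int_ne {l : ℂ} (H : RLLOn τ η μ h L S) (hl : l ∈ latticeC η μ) {l' : ℂ}
    (k : ℤ) (hl' : l' = l + 2 * η * k) : theta τ l' ≠ 0 :=
  hl' ▸ H.theta_ne _ (latticeC_add_int hl k)

theorem b_mem_eigenspace (hL : ∀ (z l : ℂ) (β α : Fin 2) (ν : ℂ), ∀ u ∈ h.eigenspace ν,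
    L z l β α u ∈ h.eigenspace (ν + sgn α - sgn β)) (z l ν : ℂ) (u : W) (hu : u ∈ h.eigenspace ν) :
    L z l 0 1 u ∈ h.eigenspace (ν - 2) := by
  convert hL z l 0 1 ν u hu using 2
  rw [sgn_one, sgn_zero]
  push_cast
  ring

theorem betheVector_mem {b : ℂ → ℂ → Module.End ℂ W} {v : ℂ → W} {k : ℤ}
    (hb : ∀ (z l ν : ℂ), ∀ u ∈ h.eigenspace ν, b z l u ∈ h.eigenspace (ν - 2))
    (hv : ∀ l, v l ∈ h.eigenspace (2 * (k : ℂ))) (ts : List ℂ) (l : ℂ) :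
    betheVector η b v ts l ∈ h.eigenspace (2 * ((k - ts.length : ℤ) : ℂ)) := by
  induction ts generalizing l with
  | nil => simpa [betheVector] using hv l
  | cons t ts ih =>
    rw [betheVector]
    convert hb t l _ _ (ih (l + 2 * η)) using 2
    push_cast [List.length_cons]
    ring

theorem betheVector_smul (b : ℂ → ℂ → Module.End ℂ W) (g : ℂ → ℂ) (v : ℂ → W)
    (ts : List ℂ) (l : ℂ) :
    betheVector η b (fun l => g l • v l) ts l =
      g (l + 2 * η * ts.length) • betheVector η b v ts l := by
  induction ts generalizing l with
  | nil => simp [betheVector]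
  | cons t ts ih =>
    simp only [betheVector, ih, map_smul]
    congr 2
    push_cast [List.length_cons]
    ring

theorem RLLOn.betheVector_perm (H : RLLOn τ η μ h L S)
    {v : ℂ → W} {k : ℤ} (hv : ∀ l, v l ∈ h.eigenspace (2 * (k : ℂ))) {ts ts' : List ℂ}
    (hp : ts.Perm ts') (hS : ∀ t ∈ ts, t ∈ S) (hsep : ts.Pairwise (Separated τ η)) :
    ∀ l ∈ latticeC η μ, betheVector η (fun x l => L x l 0 1) v ts l =
      betheVector η (fun x l => L x l 0 1) v ts' l := by
  induction hp with
  | nil => exact fun _ _ => rfl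
  | cons x _ ih =>
    intro l hl
    simp only [betheVector]
    rw [ih (fun t ht => hS t (List.mem_cons_of_mem _ ht)) hsep.of_cons _ (latticeC_add hl)]
  | swap x y ts =>
    intro l hl
    simp only [betheVector]
    have hyx : Separated τ η y x := (List.pairwise_cons.1 hsep).1 x (by simp)
    exact (H.rll y (hS y (by simp)) x (hS x (by simp)) hyx.2.1 l hl (k - ts.length)
      _ (betheVector_mem (b_mem_eigenspace H.weight) hv ts _)).b_b
  | trans hp _ ih ih' =>
    intro l hl
    rw [ih hS hsep l hl]
    exact ih' (fun t ht => hS t (hp.mem_iff.2 ht)) (hp.pairwise hsep fun h => h.symm) l hl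

theorem RLLOn.b_betheVector_update (H : RLLOn τ η μ h L S) {v : ℂ → W} {k : ℤ}
    (hv : ∀ l, v l ∈ h.eigenspace (2 * (k : ℂ))) {m : ℕ} {s w l : ℂ} {r : Fin m → ℂ}
    (hS : ∀ i, (Fin.cons s r : Fin (m + 1) → ℂ) i ∈ S) (hw : w ∈ S)
    (hsep : Pairwise fun i j => Separated τ η ((Fin.cons s r : Fin (m + 1) → ℂ) i)
      ((Fin.cons s r : Fin (m + 1) → ℂ) j))
    (hsw : ∀ i, Separated τ η ((Fin.cons s r : Fin (m + 1) → ℂ) i) w)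
    (hl : l ∈ latticeC η μ) (i : Fin m) :
    L w l 0 1 (betheVector η (fun x l => L x l 0 1) v (List.ofFn (Function.update r i s))
        (l + 2 * η)) =
      L s l 0 1 (betheVector η (fun x l => L x l 0 1) v (List.ofFn (Function.update r i w))
        (l + 2 * η)) := by
  set t : Fin (m + 1) → ℂ := Fin.cons s r
  have hmem : ∀ x ∈ List.ofFn (Function.update t i.succ w), x ∈ S := by
    simp only [List.mem_ofFn, forall_exists_index, forall_apply_eq_imp_iff]
    exact (Function.forall_update_iff t fun _ x => x ∈ S).2 ⟨hw, fun j _ => hS j⟩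
  have hpair : (List.ofFn (Function.update t i.succ w)).Pairwise (Separated τ η) :=
    List.pairwise_ofFn.2 fun j j' hjj' =>
      pairwise_update_of_symm (r := Separated τ η) Separated.symm hsep (fun j _ => hsw j) hjj'.ne
  have hperm := H.betheVector_perm hv (ofFn_update_succ_perm_cons s w r i) hmem hpair l hl
  rw [← Fin.cons_update, List.ofFn_cons] at hperm
  exact hperm.symm

/-- The coefficients in the relation
`X(w)b(t) = f(w,t)b(t)X(w) + g(w,t)b(w)X(t)`, for `X = a` or `X = d`, on a Bethe vector with `m`
factors (`keep` is `f`, `swap` is `g`), together with the coefficients `diag` and `offDiag` of the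
wanted and unwanted terms to which they add up when `X(w)` is moved past all the factors, up to
products of the function `ratio` of the differences of spectral parameters. -/
structure ExchangeCoefficients (τ η μ : ℂ) where
  keep : ℕ → ℂ → ℂ → ℂ → ℂ
  swap : ℕ → ℂ → ℂ → ℂ → ℂ
  diag : ℕ → ℂ → ℂ
  offDiag : ℕ → ℂ → ℂ → ℂ → ℂ
  ratio : ℂ → ℂ
  keep_mul_diag : ∀ m t w l, l ∈ latticeC η μ → Separated τ η t w →
    keep m w t l * diag m (l + 2 * η) = diag (m + 1) l * ratio (t - w)
  swap_mul_diag : ∀ m t w l, l ∈ latticeC η μ → Separated τ η t w →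
    swap m w t l * diag m (l + 2 * η) = offDiag (m + 1) t w l
  keep_mul_offDiag_add : ∀ m t s w l, l ∈ latticeC η μ → Separated τ η t w → Separated τ η s w →
    Separated τ η s t →
    keep m w t l * offDiag m s w (l + 2 * η) + swap m w t l * offDiag m s t (l + 2 * η) =
      offDiag (m + 1) s w l * ratio (t - s)

theorem RLLOn.diagonal_betheVector (H : RLLOn τ η μ h L S) (C : ExchangeCoefficients τ η μ)
    {v : ℂ → W} {k : ℤ} (hv : ∀ l, v l ∈ h.eigenspace (2 * (k : ℂ)))
    (X : ℂ → ℂ → (ℂ → W) → W) (ρ : ℂ → ℂ)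
    (hXv : ∀ w ∈ S, ∀ l ∈ latticeC η μ, X w l v = (C.diag 0 l * ρ w) • v l)
    (hXb : ∀ ts : List ℂ, ∀ t ∈ S, ∀ w ∈ S, Separated τ η t w →
      ∀ l ∈ latticeC η μ, X w l (betheVector η (fun x l => L x l 0 1) v (t :: ts)) =
        C.keep ts.length w t l •
          L t l 0 1 (X w (l + 2 * η) (betheVector η (fun x l => L x l 0 1) v ts)) +
        C.swap ts.length w t l •
          L w l 0 1 (X t (l + 2 * η) (betheVector η (fun x l => L x l 0 1) v ts)))
    {m : ℕ} (t : Fin m → ℂ) (htS : ∀ i, t i ∈ S)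
    (hsep : Pairwise fun i j => Separated τ η (t i) (t j)) :
    ∀ w ∈ S, (∀ i, Separated τ η (t i) w) → ∀ l ∈ latticeC η μ,
      X w l (betheVector η (fun x l => L x l 0 1) v (List.ofFn t)) =
        (C.diag m l * ρ w * ∏ j, C.ratio (t j - w)) •
          betheVector η (fun x l => L x l 0 1) v (List.ofFn t) l +
        ∑ i, (C.offDiag m (t i) w l * ρ (t i) *
            ∏ j ∈ Finset.univ.erase i, C.ratio (t j - t i)) •
          betheVector η (fun x l => L x l 0 1) v (List.ofFn (Function.update t i w)) l := by
  induction t using Fin.consInduction with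
  | elim0 =>
    intro w hw _ l hl
    simp [betheVector, hXv w hw l hl]
  | @cons m s r ih =>
    intro w hw htw l hl
    have hl₂ := latticeC_add hl
    have hsS : s ∈ S := htS 0
    have hrs (i : Fin m) : Separated τ η (r i) s := by simpa using hsep (Fin.succ_ne_zero i)
    have hsw : Separated τ η s w := htw 0
    have hrw (i : Fin m) : Separated τ η (r i) w := htw i.succ
    have hrr : Pairwise fun i j => Separated τ η (r i) (r j) := fun i j hij => by
      simpa using hsep ((Fin.succ_injective m).ne hij)
    replace ih := ih (fun i => htS i.succ) hrr
    have hswap := H.b_betheVector_update hv htS hw hsep htw hl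
    rw [List.ofFn_cons, hXb _ s hsS w hw hsw l hl, List.length_ofFn, ih w hw hrw _ hl₂,
      ih s hsS hrs _ hl₂, Fin.sum_univ_succ, Fin.prod_univ_succ, prod_univ_erase_zero]
    simp only [prod_univ_erase_succ, Fin.cons_zero, Fin.cons_succ, Fin.update_cons_zero,
      ← Fin.cons_update, List.ofFn_cons, betheVector, map_add, map_smul, map_sum, smul_add,
      smul_smul, Finset.smul_sum, hswap]
    rw [add_add_add_comm, ← Finset.sum_add_distrib, add_assoc]
    congr 1
    · congr 1
      linear_combination (ρ w * ∏ j, C.ratio (r j - w)) * C.keep_mul_diag m s w l hl hsw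
    congr 1
    · congr 1
      linear_combination (ρ s * ∏ j, C.ratio (r j - s)) * C.swap_mul_diag m s w l hl hsw
    · refine Finset.sum_congr rfl fun i _ => ?_
      rw [← add_smul]
      congr 1
      linear_combination (ρ (r i) * ∏ j ∈ Finset.univ.erase i, C.ratio (r j - r i)) *
        C.keep_mul_offDiag_add m s (r i) w l hl hsw (hrw i) (hrs i)

theorem theta_exchange {τ : ℂ} (hτ : 0 < τ.im) (l t s w e : ℂ) :
    theta τ l * theta τ (t - w - e) * (theta τ (l + e + s - w) * theta τ (s - t)) +
      theta τ (l + t - w) * theta τ e * (theta τ (l + e + s - t) * theta τ (s - w)) =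
    theta τ (l + s - w) * theta τ (s - t + e) * (theta τ (l + e) * theta τ (t - w)) := by
  have hthree : theta τ (l + s - w) * theta τ (l + e) * (theta τ (t - w) * theta τ (s - t + e)) =
      theta τ (l + e + s - w) * theta τ l * (theta τ (t - w - e) * theta τ (s - t)) +
        theta τ (l + t - w) * theta τ (l + e + s - t) * (theta τ (s - w) * theta τ e) :=
    theta_three_term_of_eq hτ (l + e / 2 + (s - w) / 2) (e / 2 + (s - w) / 2)
      ((s - w) / 2 - e / 2) (t - e / 2 - (s + w) / 2)
  linear_combination -hthree

/-- The exchange coefficients of `a`. -/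
def aExchange (hτ : 0 < τ.im) (hθ : ∀ l ∈ latticeC η μ, theta τ l ≠ 0) :
    ExchangeCoefficients τ η μ where
  keep _ w t l := theta τ l * theta τ (t - w - 2 * η) / (theta τ (l - 2 * η) * theta τ (t - w))
  swap _ w t l := theta τ (l + t - w) * theta τ (2 * η) / (theta τ (l - 2 * η) * theta τ (t - w))
  diag m l := theta τ (l + 2 * η * (m - 1)) / theta τ (l - 2 * η)
  offDiag m t w l := theta τ (l + t - w) * theta τ (2 * η) * theta τ (l + 2 * η * (m - 1)) /
    (theta τ (l - 2 * η) * theta τ l * theta τ (t - w))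
  ratio x := theta τ (x - 2 * η) / theta τ x
  keep_mul_diag m t w l hl htw := by
    have hl₀ := hθ l hl
    have htw₀ := htw.1
    rw [show l + 2 * η + 2 * η * (m - 1) = l + 2 * η * m by ring, add_sub_cancel_right,
      Nat.cast_succ, add_sub_cancel_right]
    field_simp
  swap_mul_diag m t w l hl htw := by
    have hl₀ := hθ l hl
    have htw₀ := htw.1
    rw [show l + 2 * η + 2 * η * (m - 1) = l + 2 * η * m by ring, add_sub_cancel_right,
      Nat.cast_succ, add_sub_cancel_right]
    field_simp
  keep_mul_offDiag_add m t s w l hl htw hsw hst := by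
    have hl₀ := hθ l hl
    have hl₁ := hθ _ (latticeC_sub hl)
    have hl₂ := hθ _ (latticeC_add hl)
    have htw₀ := htw.1
    have hsw₀ := hsw.1
    have hst₀ := hst.1
    rw [show l + 2 * η + 2 * η * (m - 1) = l + 2 * η * m by ring, add_sub_cancel_right,
      theta_sub_comm τ t s, theta_eq_neg_theta (show t - s - 2 * η = -(s - t + 2 * η) by ring),
      Nat.cast_succ, add_sub_cancel_right, neg_div_neg_eq]
    field_simp
    linear_combination theta τ (2 * η) * theta τ (l + 2 * η * m) *
      theta_exchange hτ l t s w (2 * η)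

/-- The exchange coefficients of `d` on Bethe vectors built from a vector of weight `2m₀`. -/
def dExchange (hτ : 0 < τ.im) (hθ : ∀ l ∈ latticeC η μ, theta τ l ≠ 0) (m₀ : ℕ) :
    ExchangeCoefficients τ η μ where
  keep m w t l := theta τ (l - 4 * η * (m₀ - (m + 1))) * theta τ (t - w + 2 * η) /
    (theta τ (l - 4 * η * (m₀ - (m + 1)) - 2 * η) * theta τ (t - w))
  swap m w t l := -(theta τ (l - 4 * η * (m₀ - (m + 1)) + t - w) * theta τ (2 * η)) /
    (theta τ (l - 4 * η * (m₀ - (m + 1)) - 2 * η) * theta τ (t - w))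
  diag m l := theta τ (l - 4 * η * (m₀ - m)) / theta τ (l + 2 * η * m)
  offDiag m t w l := -(theta τ (l - 4 * η * (m₀ - m) + t - w) * theta τ (2 * η)) /
    (theta τ (t - w) * theta τ (l + 2 * η * m))
  ratio x := theta τ (x + 2 * η) / theta τ x
  keep_mul_diag m t w l hl _ := by
    have hshift : theta τ (l - 4 * η * (m₀ - (m + 1)) - 2 * η) ≠ 0 := by
      convert hθ _ (latticeC_add_int hl (-2 * (m₀ - (m + 1)) - 1)) using 2
      push_cast
      ring
    rw [show l + 2 * η + 2 * η * m = l + 2 * η * (m + 1) by ring,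
      show l + 2 * η - 4 * η * (m₀ - m) = l - 4 * η * (m₀ - (m + 1)) - 2 * η by ring,
      Nat.cast_succ]
    generalize theta τ (l - 4 * η * (m₀ - (m + 1)) - 2 * η) = X at *
    field_simp
  swap_mul_diag m t w l hl _ := by
    have hshift : theta τ (l - 4 * η * (m₀ - (m + 1)) - 2 * η) ≠ 0 := by
      convert hθ _ (latticeC_add_int hl (-2 * (m₀ - (m + 1)) - 1)) using 2
      push_cast
      ring
    rw [show l + 2 * η + 2 * η * m = l + 2 * η * (m + 1) by ring,
      show l + 2 * η - 4 * η * (m₀ - m) = l - 4 * η * (m₀ - (m + 1)) - 2 * η by ring,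
      Nat.cast_succ]
    generalize theta τ (l - 4 * η * (m₀ - (m + 1)) - 2 * η) = X at *
    field_simp
  keep_mul_offDiag_add m t s w l hl htw hsw hst := by
    have hshift : theta τ (l - 4 * η * (m₀ - (m + 1)) - 2 * η) ≠ 0 := by
      convert hθ _ (latticeC_add_int hl (-2 * (m₀ - (m + 1)) - 1)) using 2
      push_cast
      ring
    have hdenom : theta τ (l + 2 * η * (m + 1)) ≠ 0 := by
      exact_mod_cast hθ _ (latticeC_add_int hl (m + 1))
    have htw₀ := htw.1
    have hsw₀ := hsw.1
    have hst₀ := hst.1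
    rw [show l + 2 * η + 2 * η * m = l + 2 * η * (m + 1) by ring,
      show l + 2 * η - 4 * η * (m₀ - m) = l - 4 * η * (m₀ - (m + 1)) - 2 * η by ring,
      Nat.cast_succ]
    generalize l - 4 * η * (m₀ - (m + 1)) = l' at *
    have hexchange := theta_exchange hτ l' t s w (-(2 * η))
    rw [theta_neg, sub_neg_eq_add, ← sub_eq_add_neg] at hexchange
    rw [theta_sub_comm τ t s,
      theta_eq_neg_theta (show t - s + 2 * η = -(s - t + -(2 * η)) by ring), neg_div_neg_eq]
    field_simp
    linear_combination -theta τ (2 * η) * hexchange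

/-- The factor of the eigenvalue of `d(x)` on a highest weight vector that depends on `x`. -/
def weightRatio {n : ℕ} (τ η : ℂ) (z Λ : Fin n → ℂ) (x : ℂ) : ℂ :=
  ∏ k, theta τ (x - pPar η z Λ k) / theta τ (x - qPar η z Λ k)

/-- A highest weight vector of weight `2m` with respect to spectral parameters in `S` and
dynamical parameters in `C_μ`. -/
structure HighestWeightOn {n : ℕ} (τ η μ : ℂ) (h : Module.End ℂ W)
    (L : ℂ → ℂ → Fin 2 → Fin 2 → Module.End ℂ W) (S : Set ℂ) (z Λ : Fin n → ℂ) (m : ℕ)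
    (v : ℂ → W) : Prop where
  mem : ∀ l, v l ∈ h.eigenspace (2 * (m : ℂ))
  a_apply : ∀ x ∈ S, ∀ l ∈ latticeC η μ, L x l 0 0 (v (l - 2 * η)) = v l
  d_apply : ∀ x ∈ S, ∀ l ∈ latticeC η μ, L x l 1 1 (v (l + 2 * η)) =
    (theta τ (l - 4 * η * m) / theta τ l * weightRatio τ η z Λ x) • v l

theorem RLLOn.a_betheVector (hτ : 0 < τ.im) (H : RLLOn τ η μ h L S) {n m₀ : ℕ} {z Λ : Fin n → ℂ}
    {v : ℂ → W} (hv : HighestWeightOn τ η μ h L S z Λ m₀ v)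
    {m : ℕ} (t : Fin m → ℂ) (htS : ∀ i, t i ∈ S)
    (hsep : Pairwise fun i j => Separated τ η (t i) (t j)) :
    ∀ w ∈ S, (∀ i, Separated τ η (t i) w) → ∀ l ∈ latticeC η μ,
      L w l 0 0 (betheVector η (fun x l => L x l 0 1) v (List.ofFn t) (l - 2 * η)) =
        (theta τ (l + 2 * η * (m - 1)) / theta τ (l - 2 * η) * 1 *
          ∏ j, theta τ (t j - w - 2 * η) / theta τ (t j - w)) •
          betheVector η (fun x l => L x l 0 1) v (List.ofFn t) l +
        ∑ i, (theta τ (l + t i - w) * theta τ (2 * η) * theta τ (l + 2 * η * (m - 1)) /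
            (theta τ (l - 2 * η) * theta τ l * theta τ (t i - w)) * 1 *
            ∏ j ∈ Finset.univ.erase i, theta τ (t j - t i - 2 * η) / theta τ (t j - t i)) •
          betheVector η (fun x l => L x l 0 1) v (List.ofFn (Function.update t i w)) l := by
  have hmem : ∀ l, v l ∈ h.eigenspace (2 * ((m₀ : ℤ) : ℂ)) := by simpa using hv.mem
  refine H.diagonal_betheVector (aExchange hτ H.theta_ne) hmem
    (fun w l F => L w l 0 0 (F (l - 2 * η))) (fun _ => 1) ?_ ?_ t htS hsep
  · intro w hw l hl
    have hdiag : (aExchange hτ H.theta_ne).diag 0 l = 1 := by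
      simpa [aExchange, ← sub_eq_add_neg] using div_self (H.theta_ne _ (latticeC_sub hl))
    rw [hdiag, hv.a_apply w hw l hl, one_mul, one_smul]
  · intro ts t ht w hw htw l hl
    simp only [betheVector, sub_add_cancel, add_sub_cancel_right]
    have hu := betheVector_mem (η := η) (b_mem_eigenspace H.weight) hmem ts l
    exact (H.rll t ht w hw htw.2.1 l hl _ _ hu).a_b
      (H.theta_ne l hl) (H.theta_ne _ (latticeC_sub hl)) htw.1 htw.2.1

theorem RLLOn.d_betheVector (hτ : 0 < τ.im) (H : RLLOn τ η μ h L S) {n m₀ : ℕ} {z Λ : Fin n → ℂ}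
    {v : ℂ → W} (hv : HighestWeightOn τ η μ h L S z Λ m₀ v)
    {m : ℕ} (t : Fin m → ℂ) (htS : ∀ i, t i ∈ S)
    (hsep : Pairwise fun i j => Separated τ η (t i) (t j)) :
    ∀ w ∈ S, (∀ i, Separated τ η (t i) w) → ∀ l ∈ latticeC η μ,
      L w l 1 1 (betheVector η (fun x l => L x l 0 1) v (List.ofFn t) (l + 2 * η)) =
        (theta τ (l - 4 * η * (m₀ - m)) / theta τ (l + 2 * η * m) * weightRatio τ η z Λ w *
          ∏ j, theta τ (t j - w + 2 * η) / theta τ (t j - w)) •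
          betheVector η (fun x l => L x l 0 1) v (List.ofFn t) l +
        ∑ i, (-(theta τ (l - 4 * η * (m₀ - m) + t i - w) * theta τ (2 * η)) /
            (theta τ (t i - w) * theta τ (l + 2 * η * m)) * weightRatio τ η z Λ (t i) *
            ∏ j ∈ Finset.univ.erase i, theta τ (t j - t i + 2 * η) / theta τ (t j - t i)) •
          betheVector η (fun x l => L x l 0 1) v (List.ofFn (Function.update t i w)) l := by
  have hmem : ∀ l, v l ∈ h.eigenspace (2 * ((m₀ : ℤ) : ℂ)) := by simpa using hv.mem
  refine H.diagonal_betheVector (dExchange hτ H.theta_ne m₀) hmem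
    (fun w l F => L w l 1 1 (F (l + 2 * η))) (weightRatio τ η z Λ) ?_ ?_ t htS hsep
  · intro w hw l hl
    rw [hv.d_apply w hw l hl]
    simp [dExchange]
  · intro ts t ht w hw htw l hl
    simp only [betheVector]
    have hu := betheVector_mem (η := η) (b_mem_eigenspace H.weight) hmem ts (l + 2 * η + 2 * η)
    refine (H.rll w hw t ht htw.symm.2.1 l hl _ _ hu).d_b
      ?_ ?_ ?_ htw.1 htw.2.2
    · push_cast
      ring
    · exact H.theta_add_int_ne hl (-2 * (m₀ - (ts.length + 1))) (by push_cast; ring)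
    · exact H.theta_add_int_ne hl (-2 * (m₀ - (ts.length + 1)) - 1) (by push_cast; ring)

theorem prod_theta_sub_shift (τ η : ℂ) (m : ℕ) (l : ℂ) :
    (∏ j ∈ Finset.Icc 1 m, theta τ (l - 2 * η - 2 * η * j)) * theta τ (l - 2 * η) =
      (∏ j ∈ Finset.Icc 1 m, theta τ (l - 2 * η * j)) * theta τ (l - 2 * η * (m + 1)) := by
  induction m with
  | zero => simp
  | succ m ih =>
    rw [Finset.prod_Icc_succ_top (by omega), Finset.prod_Icc_succ_top (by omega)]
    push_cast
    rw [show l - 2 * η - 2 * η * (m + 1) = l - 2 * η * (m + 1 + 1) by ring]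
    linear_combination theta τ (l - 2 * η * (m + 1 + 1)) * ih

theorem differentiable_gFn {τ : ℂ} (hτ : 0 < τ.im) (η c : ℂ) (m : ℕ) :
    Differentiable ℂ (gFn τ η c m) := by
  have hθ := differentiable_theta hτ
  unfold gFn
  fun_prop

theorem gFn_sub_mul_theta (τ η c : ℂ) (m : ℕ) (l : ℂ) :
    gFn τ η c m (l - 2 * η) * theta τ (l - 2 * η) =
      Complex.exp (-2 * η * c) * gFn τ η c m l * theta τ (l - 2 * η * (m + 1)) := by
  unfold gFn
  rw [show c * (l - 2 * η) = -2 * η * c + c * l by ring, Complex.exp_add]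
  linear_combination (Complex.exp (-2 * η * c) * Complex.exp (c * l)) *
    prod_theta_sub_shift τ η m l

theorem gFn_add_mul_theta (τ η c : ℂ) (m : ℕ) (l : ℂ) :
    gFn τ η c m (l + 2 * η) * theta τ (l - 2 * η * m) =
      Complex.exp (2 * η * c) * gFn τ η c m l * theta τ l := by
  have hsub := gFn_sub_mul_theta τ η c m (l + 2 * η)
  have hexp : Complex.exp (2 * η * c) * Complex.exp (-2 * η * c) = 1 := by
    rw [← Complex.exp_add, show 2 * η * c + -2 * η * c = 0 by ring, Complex.exp_zero]
  rw [add_sub_cancel_right, show l + 2 * η - 2 * η * (m + 1) = l - 2 * η * m by ring] at hsub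
  linear_combination (-Complex.exp (2 * η * c)) * hsub -
    (gFn τ η c m (l + 2 * η) * theta τ (l - 2 * η * m)) * hexp

/-- The coefficient of the unwanted term in which `t_i` is replaced by `w`. -/
def unwanted {n m : ℕ} (τ η : ℂ) (z Λ : Fin n → ℂ) (c : ℂ) (t : Fin m → ℂ) (w l : ℂ) (i : Fin m) :
    ℂ :=
  gFn τ η c m (l + 2 * η * m) * (theta τ (l + t i - w) * theta τ (2 * η) /
    (theta τ l * theta τ (t i - w))) *
    (Complex.exp (-2 * η * c) *
        (∏ j ∈ Finset.univ.erase i, theta τ (t j - t i - 2 * η) / theta τ (t j - t i)) -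
      Complex.exp (2 * η * c) * weightRatio τ η z Λ (t i) *
        (∏ j ∈ Finset.univ.erase i, theta τ (t j - t i + 2 * η) / theta τ (t j - t i)))

theorem RLLOn.transfer_betheVector (hτ : 0 < τ.im) (H : RLLOn τ η μ h L S) {n m : ℕ}
    {z Λ : Fin n → ℂ} {v : ℂ → W} (hv : HighestWeightOn τ η μ h L S z Λ m v) (c : ℂ)
    (t : Fin m → ℂ) (htS : ∀ i, t i ∈ S)
    (hsep : Pairwise fun i j => Separated τ η (t i) (t j))
    {w : ℂ} (hw : w ∈ S) (htw : ∀ i, Separated τ η (t i) w) {l : ℂ} (hl : l ∈ latticeC η μ) :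
    let ψ := betheVector η (fun x l => L x l 0 1) (fun l => gFn τ η c m l • v l) (List.ofFn t)
    L w l 0 0 (ψ (l - 2 * η)) + L w l 1 1 (ψ (l + 2 * η)) =
      betheEigenvalue τ η z Λ c t w • ψ l +
      ∑ i, unwanted τ η z Λ c t w l i •
        betheVector η (fun x l => L x l 0 1) v (List.ofFn (Function.update t i w)) l := by
  intro ψ
  have hl₀ : theta τ l ≠ 0 := H.theta_ne l hl
  have hl₁ : theta τ (l - 2 * η) ≠ 0 := H.theta_ne _ (latticeC_sub hl)
  have hlm : theta τ (l + 2 * η * m) ≠ 0 := H.theta_add_int_ne hl m (by push_cast; ring)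
  have hgsub := gFn_sub_mul_theta τ η c m (l + 2 * η * m)
  rw [show l + 2 * η * m - 2 * η * (m + 1) = l - 2 * η by ring,
    show l + 2 * η * m - 2 * η = l + 2 * η * (m - 1) by ring] at hgsub
  have hgadd := gFn_add_mul_theta τ η c m (l + 2 * η * m)
  rw [add_sub_cancel_right] at hgadd
  simp only [ψ, betheVector_smul, List.length_ofFn, map_smul]
  rw [H.a_betheVector hτ hv t htS hsep w hw htw l hl,
    H.d_betheVector hτ hv t htS hsep w hw htw l hl,
    show l - 2 * η + 2 * η * m = l + 2 * η * (m - 1) by ring, add_right_comm l (2 * η),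
    sub_self, mul_zero, sub_zero]
  simp only [smul_add, Finset.smul_sum, smul_smul]
  rw [add_add_add_comm, ← Finset.sum_add_distrib, ← add_smul]
  congr 1
  · congr 1
    simp only [betheEigenvalue, weightRatio]
    generalize Complex.exp (-2 * η * c) = E at *
    generalize Complex.exp (2 * η * c) = E' at *
    generalize (∏ j, theta τ (t j - w - 2 * η) / theta τ (t j - w)) = A
    generalize (∏ j, theta τ (t j - w + 2 * η) / theta τ (t j - w)) = B
    generalize (∏ k, theta τ (w - pPar η z Λ k) / theta τ (w - qPar η z Λ k)) = D
    field_simp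
    linear_combination A * theta τ (l + 2 * η * m) * hgsub + D * B * theta τ (l - 2 * η) * hgadd
  · refine Finset.sum_congr rfl fun i _ => ?_
    rw [← add_smul, unwanted]
    congr 1
    have htwi := (htw i).1
    generalize Complex.exp (-2 * η * c) = E at *
    generalize Complex.exp (2 * η * c) = E' at *
    generalize (∏ j ∈ Finset.univ.erase i, theta τ (t j - t i - 2 * η) / theta τ (t j - t i)) = A
    generalize (∏ j ∈ Finset.univ.erase i, theta τ (t j - t i + 2 * η) / theta τ (t j - t i)) = B
    generalize weightRatio τ η z Λ (t i) = D
    field_simp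
    linear_combination theta τ (l + t i - w) * theta τ (2 * η) *
      (A * theta τ (l + 2 * η * m) * hgsub - D * B * theta τ (l - 2 * η) * hgadd)

end

/-! ### Analytic continuation in the spectral parameters -/

theorem countable_theta_zeros {τ : ℂ} (hτ : 0 < τ.im) : {x | theta τ x = 0}.Countable := by
  refine (Set.countable_range fun p : ℤ × ℤ => (p.1 + p.2 * τ : ℂ)).mono fun x hx => ?_
  obtain ⟨r, s, hrs⟩ := (theta_eq_zero_iff hτ).1 hx
  exact ⟨(r, s), hrs.symm⟩

theorem countable_theta_comp_zeros {τ : ℂ} (hτ : 0 < τ.im) {X : Type*} {f : X → ℂ}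
    (hf : Function.Injective f) : {x | theta τ (f x) = 0}.Countable :=
  (countable_theta_zeros hτ).preimage_of_injOn hf.injOn

theorem eq_of_continuousAt_of_countable {X : Type*} [TopologicalSpace X] [T2Space X] {B : Set ℂ}
    (hB : B.Countable) {f g : ℂ → X} {x : ℂ} (hf : ContinuousAt f x) (hg : ContinuousAt g x)
    (hfg : ∀ᶠ y in 𝓝 x, y ∉ B → f y = g y) : f x = g x := by
  have : (𝓝[Bᶜ] x).NeBot := mem_closure_iff_nhdsWithin_neBot.1 (hB.dense_compl ℝ x)
  refine tendsto_nhds_unique (l := 𝓝[Bᶜ] x) (hf.mono_left nhdsWithin_le_nhds)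
    ((hg.mono_left nhdsWithin_le_nhds).congr' ?_)
  filter_upwards [self_mem_nhdsWithin, nhdsWithin_le_nhds hfg] with y hy h using (h hy).symm

theorem countable_not_separated {τ : ℂ} (hτ : 0 < τ.im) (η t : ℂ) :
    {w | ¬ Separated τ η t w}.Countable := by
  have hzeros (a : ℂ) : {w | theta τ (t - w + a) = 0}.Countable :=
    countable_theta_comp_zeros hτ fun x y hxy => by simpa using hxy
  refine (((hzeros 0).union (hzeros (-(2 * η)))).union (hzeros (2 * η))).mono fun w hw => ?_
  simp only [Separated, Set.mem_ofPred_eq, not_and_or, not_not, Set.mem_union, add_zero,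
    ← sub_eq_add_neg] at hw ⊢
  tauto

theorem Separated.eventually_translate {τ η t w : ℂ} (hτ : 0 < τ.im) (h : Separated τ η t w) :
    ∀ᶠ s in 𝓝 (0 : ℂ), Separated τ η (t + s) w := by
  have hθ : Continuous (theta τ) := (differentiable_theta hτ).continuous
  have hne {f : ℂ → ℂ} (hf : Continuous f) (h₀ : f 0 ≠ 0) : ∀ᶠ s in 𝓝 (0 : ℂ), f s ≠ 0 :=
    hf.continuousAt.eventually_ne h₀
  exact (hne (f := fun s => theta τ (t + s - w)) (by fun_prop) (by simpa using h.1)).and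
    ((hne (f := fun s => theta τ (t + s - w - 2 * η)) (by fun_prop) (by simpa using h.2.1)).and
    (hne (f := fun s => theta τ (t + s - w + 2 * η)) (by fun_prop) (by simpa using h.2.2)))

section
variable {W : Type*} [AddCommGroup W] [Module ℂ W]

theorem vecRegularAt_const (u : W) (p : ℂ) : VecRegularAt (fun _ => u) p :=
  fun _ => analyticAt_const

theorem VecRegularAt.add {x y : ℂ → W} {p : ℂ} (hx : VecRegularAt x p) (hy : VecRegularAt y p) :
    VecRegularAt (fun s => x s + y s) p := fun φ => by
  simp only [map_add]
  exact (hx φ).add (hy φ)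

theorem VecRegularAt.smul {g : ℂ → ℂ} {x : ℂ → W} {p : ℂ} (hg : AnalyticAt ℂ g p)
    (hx : VecRegularAt x p) : VecRegularAt (fun s => g s • x s) p := fun φ => by
  simp only [map_smul]
  exact hg.smul (hx φ)

theorem VecRegularAt.map {x : ℂ → W} {p : ℂ} (hx : VecRegularAt x p) (A : Module.End ℂ W) :
    VecRegularAt (fun s => A (x s)) p := fun φ => hx (φ.comp A)

theorem VecRegularAt.comp {x : ℂ → W} {f : ℂ → ℂ} {p : ℂ} (hx : VecRegularAt x (f p))
    (hf : AnalyticAt ℂ f p) : VecRegularAt (fun s => x (f s)) p :=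
  fun φ => (hx φ).comp_of_eq hf rfl

theorem exists_coordinates (V : Submodule ℂ W) [FiniteDimensional ℂ V] :
    ∃ (n : ℕ) (e : Fin n → W) (g : Fin n → Module.Dual ℂ W), (∀ i, e i ∈ V) ∧
      ∀ u ∈ V, u = ∑ i, g i u • e i := by
  let b := Module.finBasis ℂ V
  choose g hg using fun i => LinearMap.exists_extend (b.coord i)
  refine ⟨_, fun i => (b i : W), g, fun i => (b i).2, fun u hu => ?_⟩
  have hcoord (i) : g i u = b.coord i ⟨u, hu⟩ := LinearMap.congr_fun (hg i) ⟨u, hu⟩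
  have hsum := congrArg Subtype.val (b.sum_repr ⟨u, hu⟩)
  rw [Submodule.coe_sum] at hsum
  simpa only [hcoord, Module.Basis.coord_apply] using! hsum.symm

theorem VecRegularAt.apply {V : Submodule ℂ W} [FiniteDimensional ℂ V] {x : ℂ → W} {p : ℂ}
    {A : ℂ → Module.End ℂ W} (hx : VecRegularAt x p) (hxV : ∀ s, x s ∈ V)
    (hA : ∀ u ∈ V, VecRegularAt (fun s => A s u) p) : VecRegularAt (fun s => A s (x s)) p := by
  obtain ⟨n, e, g, he, hg⟩ := exists_coordinates V
  intro φ
  have hexpand : (fun s => φ (A s (x s))) = fun s => ∑ i, g i (x s) * φ (A s (e i)) := by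
    ext s
    conv_lhs => rw [hg _ (hxV s)]
    simp
  rw [hexpand]
  exact Finset.analyticAt_fun_sum _ fun i _ => (hx (g i)).mul (hA _ (he i) φ)

theorem vecRegularAt_betheVector {h : Module.End ℂ W} {b : ℂ → ℂ → Module.End ℂ W} {η : ℂ}
    {v : ℂ → W} {k : ℤ}
    (hb : ∀ (z l ν : ℂ), ∀ u ∈ h.eigenspace ν, b z l u ∈ h.eigenspace (ν - 2))
    (hv : ∀ l, v l ∈ h.eigenspace (2 * (k : ℂ)))
    [∀ k : ℤ, FiniteDimensional ℂ (h.eigenspace (2 * (k : ℂ)))] (p : ℂ)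
    (ts : List (ℂ → ℂ)) (l : ℂ → ℂ)
    (hreg : ∀ f ∈ ts, ∀ j < ts.length, ∀ i < ts.length,
      ∀ u ∈ h.eigenspace (2 * ((k - i : ℤ) : ℂ)), VecRegularAt (fun s =>
        b (f s) (l s + 2 * η * j) u) p)
    (hvreg : VecRegularAt (fun s => v (l s + 2 * η * ts.length)) p) :
    VecRegularAt (fun s => betheVector η b v (ts.map fun f => f s) (l s)) p := by
  induction ts generalizing l with
  | nil => simpa [betheVector] using! hvreg
  | cons f ts ih =>
    simp only [List.map_cons, betheVector]
    refine VecRegularAt.apply (V := h.eigenspace (2 * ((k - ts.length : ℤ) : ℂ)))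
      (x := fun s => betheVector η b v (ts.map fun f => f s) (l s + 2 * η))
      (A := fun s => b (f s) (l s)) (ih (fun s => l s + 2 * η) ?_ ?_) ?_ ?_
    · intro g hg j hj i hi u hu
      convert hreg g (List.mem_cons_of_mem _ hg) (j + 1) (by simpa using hj) i
        (by rw [List.length_cons]; omega) u hu using 4
      push_cast
      ring
    · convert hvreg using 3
      push_cast [List.length_cons]
      ring
    · intro s
      simpa using betheVector_mem hb hv (ts.map fun f => f s) (l s + 2 * η)
    · intro u hu
      simpa using! hreg f (by simp) 0 (by simp) ts.length (by simp) u hu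

end

/-! ### The Bethe ansatz equations and the eigenvalue -/

section
variable {n m : ℕ} {τ η : ℂ} {z Λ : Fin n → ℂ} {c : ℂ} {t : Fin m → ℂ}

theorem BetheEquations.theta_ne_zero (hbae : BetheEquations τ η z Λ c t) (i : Fin m) :
    (∀ j, j ≠ i → theta τ (t j - t i - 2 * η) ≠ 0 ∧ theta τ (t j - t i + 2 * η) ≠ 0) ∧
    (∀ k, theta τ (t i - qPar η z Λ k) ≠ 0) ∧ ∀ k, theta τ (t i - pPar η z Λ k) ≠ 0 := by
  have hprod := Complex.exp_ne_zero (4 * η * c)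
  rw [← hbae i] at hprod
  have hleft := Finset.prod_ne_zero_iff.1 (left_ne_zero_of_mul hprod)
  have hright := Finset.prod_ne_zero_iff.1 (right_ne_zero_of_mul hprod)
  simp only [div_ne_zero_iff] at hleft hright
  exact ⟨fun j hj => hleft j (by simpa using hj), fun k => (hright k (Finset.mem_univ k)).1,
    fun k => (hright k (Finset.mem_univ k)).2⟩

theorem BetheEquations.pairwise_separated (hbae : BetheEquations τ η z Λ c t) (hτ : 0 < τ.im)
    (ht : ∀ i j, i ≠ j → ∀ r s : ℤ, t i - t j ≠ r + s * τ) :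
    Pairwise fun i j => Separated τ η (t i) (t j) := fun i j hij =>
  ⟨fun hzero => by
    obtain ⟨r, s, hrs⟩ := (theta_eq_zero_iff hτ).1 hzero
    exact ht i j hij r s hrs, (hbae.theta_ne_zero j).1 i hij⟩

theorem BetheEquations.unwanted_eq_zero (hbae : BetheEquations τ η z Λ c t) (w l : ℂ) (i : Fin m) :
    unwanted τ η z Λ c t w l i = 0 := by
  have hsplit : (∏ j ∈ Finset.univ.erase i, theta τ (t j - t i - 2 * η) / theta τ (t j - t i)) =
      (∏ j ∈ Finset.univ.erase i, theta τ (t j - t i - 2 * η) / theta τ (t j - t i + 2 * η)) *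
      ∏ j ∈ Finset.univ.erase i, theta τ (t j - t i + 2 * η) / theta τ (t j - t i) := by
    rw [← Finset.prod_mul_distrib]
    refine Finset.prod_congr rfl fun j hj => ?_
    rw [div_mul_div_cancel₀ ((hbae.theta_ne_zero i).1 j (Finset.ne_of_mem_erase hj)).2]
  have hratio : weightRatio τ η z Λ (t i) *
      (∏ k, theta τ (t i - qPar η z Λ k) / theta τ (t i - pPar η z Λ k)) = 1 := by
    rw [weightRatio, ← Finset.prod_mul_distrib]
    refine Finset.prod_eq_one fun k _ => ?_
    rw [div_mul_div_cancel₀ ((hbae.theta_ne_zero i).2.1 k),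
      div_self ((hbae.theta_ne_zero i).2.2 k)]
  have hexp : Complex.exp (2 * η * c) = Complex.exp (-2 * η * c) * Complex.exp (4 * η * c) := by
    rw [← Complex.exp_add]
    congr 1
    ring
  rw [unwanted, hsplit, hexp, ← hbae i]
  generalize (∏ j ∈ Finset.univ.erase i, theta τ (t j - t i - 2 * η) / theta τ (t j - t i + 2 * η))
    = R
  generalize (∏ j ∈ Finset.univ.erase i, theta τ (t j - t i + 2 * η) / theta τ (t j - t i)) = P
  generalize (∏ k, theta τ (t i - qPar η z Λ k) / theta τ (t i - pPar η z Λ k)) = Q at *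
  refine mul_eq_zero_of_right _ ?_
  linear_combination (-Complex.exp (-2 * η * c) * R * P) * hratio

theorem continuousAt_prod_theta_div (hτ : 0 < τ.im) {X ι : Type*} [TopologicalSpace X]
    (I : Finset ι) {f g : ι → X → ℂ} {x : X} (hf : ∀ i ∈ I, ContinuousAt (f i) x)
    (hg : ∀ i ∈ I, ContinuousAt (g i) x) (hne : ∀ i ∈ I, theta τ (g i x) ≠ 0) :
    ContinuousAt (fun y => ∏ i ∈ I, theta τ (f i y) / theta τ (g i y)) x := by
  have hθ : Continuous (theta τ) := (differentiable_theta hτ).continuous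
  exact tendsto_finsetProd _ fun i hi =>
    (hθ.continuousAt.comp (hf i hi)).div (hθ.continuousAt.comp (hg i hi)) (hne i hi)

theorem continuousAt_weightRatio (hτ : 0 < τ.im) {x : ℂ}
    (hx : ∀ k, theta τ (x - qPar η z Λ k) ≠ 0) : ContinuousAt (weightRatio τ η z Λ) x :=
  continuousAt_prod_theta_div hτ _ (fun _ _ => by fun_prop) (fun _ _ => by fun_prop)
    fun k _ => hx k

theorem continuousAt_betheEigenvalue (hτ : 0 < τ.im) {w : ℂ} (htw : ∀ j, theta τ (t j - w) ≠ 0)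
    (hqw : ∀ k, theta τ (w - qPar η z Λ k) ≠ 0) :
    ContinuousAt (betheEigenvalue τ η z Λ c t) w :=
  (continuousAt_const.mul (continuousAt_prod_theta_div hτ _ (fun _ _ => by fun_prop)
    (fun _ _ => by fun_prop) fun j _ => htw j)).add
  ((continuousAt_const.mul (continuousAt_prod_theta_div hτ _ (fun _ _ => by fun_prop)
    (fun _ _ => by fun_prop) fun j _ => htw j)).mul (continuousAt_weightRatio hτ hqw))

theorem continuousAt_betheEigenvalue_translate (hτ : 0 < τ.im) {w : ℂ}
    (htw : ∀ j, theta τ (t j - w) ≠ 0) :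
    ContinuousAt (fun s => betheEigenvalue τ η z Λ c (fun j => t j + s) w) 0 :=
  (continuousAt_const.mul (continuousAt_prod_theta_div hτ _ (fun _ _ => by fun_prop)
    (fun _ _ => by fun_prop) fun j _ => by simpa using htw j)).add
  ((continuousAt_const.mul (continuousAt_prod_theta_div hτ _ (fun _ _ => by fun_prop)
    (fun _ _ => by fun_prop) fun j _ => by simpa using htw j)).mul continuousAt_const)

theorem continuousAt_unwanted_translate (hτ : 0 < τ.im) {w l : ℂ} {i : Fin m}
    (hti : ∀ k, theta τ (t i - qPar η z Λ k) ≠ 0) (hl : theta τ l ≠ 0)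
    (htw : theta τ (t i - w) ≠ 0) :
    ContinuousAt (fun s => unwanted τ η z Λ c (fun j => t j + s) w l i) 0 := by
  have hθ : Continuous (theta τ) := (differentiable_theta hτ).continuous
  have hratio : ContinuousAt (fun s => weightRatio τ η z Λ (t i + s)) 0 :=
    (continuousAt_weightRatio hτ hti).comp_of_eq (by fun_prop) (add_zero _)
  simp only [unwanted, add_sub_add_right_eq_sub]
  refine (continuousAt_const.mul (ContinuousAt.div (by fun_prop) (by fun_prop) ?_)).mul
    (continuousAt_const.sub ((continuousAt_const.mul hratio).mul continuousAt_const))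
  simpa using mul_ne_zero hl htw

/-- The eigenvalue, with its removable singularities removed. -/
def regularizedEigenvalue {n m : ℕ} (τ η : ℂ) (z Λ : Fin n → ℂ) (c : ℂ) (t : Fin m → ℂ) (w : ℂ) :
    ℂ :=
  limUnder (𝓝[≠] w) (betheEigenvalue τ η z Λ c t)

theorem regularizedEigenvalue_eq (hτ : 0 < τ.im) {w : ℂ} (htw : ∀ j, theta τ (t j - w) ≠ 0)
    (hqw : ∀ k, theta τ (w - qPar η z Λ k) ≠ 0) :
    regularizedEigenvalue τ η z Λ c t w = betheEigenvalue τ η z Λ c t w :=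
  ((continuousAt_betheEigenvalue hτ htw hqw).tendsto.mono_left nhdsWithin_le_nhds).limUnder_eq

theorem regularizedEigenvalue_eq_of_analyticAt (hτ : 0 < τ.im) {B : Set ℂ} (hB : B.Countable)
    {F : ℂ → ℂ} {w : ℂ} (hF : AnalyticAt ℂ F w)
    (hFε : ∀ x ∉ B, F x = betheEigenvalue τ η z Λ c t x) :
    regularizedEigenvalue τ η z Λ c t w = F w := by
  have htw : ∀ᶠ x in 𝓝[≠] w, ∀ j, theta τ (t j - x) ≠ 0 := eventually_all.2 fun j => by
    filter_upwards [eventually_theta_add_ne_zero hτ (-t j) w] with x hx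
    rw [theta_sub_comm]
    exact neg_ne_zero.2 (by rwa [sub_eq_add_neg])
  have hqw : ∀ᶠ x in 𝓝[≠] w, ∀ k, theta τ (x - qPar η z Λ k) ≠ 0 := eventually_all.2 fun k => by
    simpa only [sub_eq_add_neg] using eventually_theta_add_ne_zero hτ (-qPar η z Λ k) w
  have hpunctured : ∀ᶠ x in 𝓝[≠] w, F x = betheEigenvalue τ η z Λ c t x := by
    filter_upwards [htw, hqw, nhdsWithin_le_nhds hF.eventually_analyticAt] with x htx hqx hFx
    exact eq_of_continuousAt_of_countable hB hFx.continuousAt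
      (continuousAt_betheEigenvalue hτ htx hqx) (Eventually.of_forall hFε)
  exact ((hF.continuousAt.tendsto.mono_left nhdsWithin_le_nhds).congr' hpunctured).limUnder_eq

end

section
variable {W : Type*} [AddCommGroup W] [Module ℂ W] {τ η μ : ℂ} {h : Module.End ℂ W}
  {L : ℂ → ℂ → Fin 2 → Fin 2 → Module.End ℂ W} {B : Set ℂ}

/-- The raising operator `b(s,λ)`, for `λ ∈ C_μ` and on even weight spaces, has no pole at `s = x`;
this is what is needed for `b(x)` to act on functions on `C_μ`. -/
def BRegularAt (η μ : ℂ) (h : Module.End ℂ W) (L : ℂ → ℂ → Fin 2 → Fin 2 → Module.End ℂ W)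
    (x : ℂ) : Prop :=
  ∀ l ∈ latticeC η μ, ∀ k : ℤ, ∀ u ∈ h.eigenspace (2 * (k : ℂ)),
    VecRegularAt (fun s => L s l 0 1 u) x

theorem RLLOn.vecRegularAt_betheVector_ofFn (H : RLLOn τ η μ h L B) {m : ℕ} {k : ℤ} {v : ℂ → W}
    (hv : ∀ l, v l ∈ h.eigenspace (2 * (k : ℂ)))
    [∀ k : ℤ, FiniteDimensional ℂ (h.eigenspace (2 * (k : ℂ)))] {f : Fin m → ℂ → ℂ} {p : ℂ}
    (hreg : ∀ i, ∀ l ∈ latticeC η μ, ∀ k : ℤ, ∀ u ∈ h.eigenspace (2 * (k : ℂ)),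
      VecRegularAt (fun s => L (f i s) l 0 1 u) p) {l : ℂ} (hl : l ∈ latticeC η μ) :
    VecRegularAt (fun s =>
      betheVector η (fun x l => L x l 0 1) v (List.ofFn fun i => f i s) l) p := by
  have hlist := vecRegularAt_betheVector (b_mem_eigenspace H.weight) hv p (List.ofFn f)
    (fun _ => l)
    (fun g hg j _ i _ u hu => by
      obtain ⟨i', rfl⟩ := (List.mem_ofFn' _ _).1 hg
      exact hreg i' _ (by simpa using latticeC_add_int hl j) _ u hu) (vecRegularAt_const _ _)
  simpa [List.map_ofFn, Function.comp_def] using! hlist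

variable {n m : ℕ} {z Λ : Fin n → ℂ} {v : ℂ → W} {c : ℂ} {t : Fin m → ℂ}
  [∀ k : ℤ, FiniteDimensional ℂ (h.eigenspace (2 * (k : ℂ)))]

/- The commutation relations need `t_i ∉ B`. Translating all the `t_i` by a common small `s`
achieves this for all but countably many `s`, and keeps the differences `t_i - t_j`; then `s → 0`.
-/
theorem RLLOn.transfer_betheVector_of_generic (hτ : 0 < τ.im) (hB : B.Countable)
    (H : RLLOn τ η μ h L Bᶜ) (hv : HighestWeightOn τ η μ h L Bᶜ z Λ m v)
    (hsep : Pairwise fun i j => Separated τ η (t i) (t j)) (hbae : BetheEquations τ η z Λ c t)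
    (hb : ∀ i, BRegularAt η μ h L (t i)) {w : ℂ} (hw : w ∉ B)
    (htw : ∀ i, Separated τ η (t i) w) {l : ℂ} (hl : l ∈ latticeC η μ) :
    let ψ := betheVector η (fun x l => L x l 0 1) (fun l => gFn τ η c m l • v l) (List.ofFn t)
    L w l 0 0 (ψ (l - 2 * η)) + L w l 1 1 (ψ (l + 2 * η)) =
      betheEigenvalue τ η z Λ c t w • ψ l := by
  intro ψ
  refine Module.eval_apply_injective ℂ (LinearMap.ext fun φ => ?_)
  have hvm : ∀ l, v l ∈ h.eigenspace (2 * ((m : ℤ) : ℂ)) := by simpa using hv.mem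
  have hb' (i) (l) (hl : l ∈ latticeC η μ) (k : ℤ) (u) (hu : u ∈ h.eigenspace (2 * (k : ℂ))) :
      VecRegularAt (fun s => L (t i + s) l 0 1 u) 0 :=
    VecRegularAt.comp (x := fun s => L s l 0 1 u) (by simpa using hb i l hl k u hu)
      (analyticAt_const.add analyticAt_id)
  have hψ {l : ℂ} (hl : l ∈ latticeC η μ) := H.vecRegularAt_betheVector_ofFn
    (fun l => Submodule.smul_mem _ (gFn τ η c m l) (hvm l)) hb' hl
  have hψ' (i : Fin m) : VecRegularAt (fun s => betheVector η (fun x l => L x l 0 1) v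
      (List.ofFn (Function.update (fun j => t j + s) i w)) l) 0 := by
    refine H.vecRegularAt_betheVector_ofFn
      (f := fun j s => Function.update (fun j => t j + s) i w j) hvm (fun j l hl k u hu => ?_) hl
    simp only [Function.update_apply]
    by_cases hj : j = i
    · simpa only [hj, if_true] using vecRegularAt_const _ _
    · simpa only [hj, if_false] using hb' j l hl k u hu
  have hBcount : (⋃ i, {s | t i + s ∈ B}).Countable :=
    Set.countable_iUnion fun i => hB.preimage_of_injOn (add_right_injective (t i)).injOn
  have hlimit := eq_of_continuousAt_of_countable hBcount
    (((hψ (latticeC_sub hl)).map (L w l 0 0)).add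
      ((hψ (latticeC_add hl)).map (L w l 1 1)) φ).continuousAt
    (((continuousAt_betheEigenvalue_translate hτ fun j => (htw j).1).mul
      (hψ hl φ).continuousAt).add (tendsto_finsetSum Finset.univ fun i _ =>
        (continuousAt_unwanted_translate hτ (hbae.theta_ne_zero i).2.1 (H.theta_ne l hl)
          (htw i).1).mul (hψ' i φ).continuousAt)) (by
      filter_upwards [eventually_all.2 fun i => (htw i).eventually_translate hτ] with s hs hsB
      simpa using! congrArg φ (H.transfer_betheVector hτ hv c (fun i => t i + s)
        (by simpa using hsB) (fun i j hij => by simpa [Separated] using hsep hij) hw hs hl))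
  simp only [Pi.add_apply, Pi.mul_apply, add_zero, hbae.unwanted_eq_zero, zero_mul,
    Finset.sum_const_zero] at hlimit
  simpa only [Module.Dual.eval_apply, map_smul, smul_eq_mul] using! hlimit

theorem RLLOn.transfer_bethe (hτ : 0 < τ.im) (hB : B.Countable) (H : RLLOn τ η μ h L Bᶜ)
    (hv : HighestWeightOn τ η μ h L Bᶜ z Λ m v)
    (hsep : Pairwise fun i j => Separated τ η (t i) (t j)) (hbae : BetheEquations τ η z Λ c t)
    (hb : ∀ i, BRegularAt η μ h L (t i)) {w : ℂ}
    (hw : ∀ l ∈ latticeC η μ, ∀ α, ∀ u ∈ h.eigenspace (0 : ℂ),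
      VecRegularAt (fun s => L s l α α u) w) {l : ℂ} (hl : l ∈ latticeC η μ) :
    let ψ := betheVector η (fun x l => L x l 0 1) (fun l => gFn τ η c m l • v l) (List.ofFn t)
    L w l 0 0 (ψ (l - 2 * η)) + L w l 1 1 (ψ (l + 2 * η)) =
      regularizedEigenvalue τ η z Λ c t w • ψ l := by
  intro ψ
  have hψ₀ (l) : ψ l ∈ h.eigenspace (0 : ℂ) := by
    simpa using betheVector_mem (k := m) (b_mem_eigenspace H.weight)
      (fun l => Submodule.smul_mem _ (gFn τ η c m l) (by simpa using hv.mem l)) (List.ofFn t) l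
  set B' : Set ℂ := B ∪ ⋃ i, {w | ¬ Separated τ η (t i) w} with hB'
  have hB'count : B'.Countable :=
    hB.union (Set.countable_iUnion fun i => countable_not_separated hτ η _)
  set T : ℂ → ℂ → W := fun l x => L x l 0 0 (ψ (l - 2 * η)) + L x l 1 1 (ψ (l + 2 * η))
  have hTreg {l} (hl : l ∈ latticeC η μ) : VecRegularAt (T l) w :=
    (hw l hl 0 _ (hψ₀ _)).add (hw l hl 1 _ (hψ₀ _))
  have heigen : ∀ x ∉ B', ∀ l ∈ latticeC η μ, T l x = betheEigenvalue τ η z Λ c t x • ψ l := by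
    intro x hx l hl
    simp only [hB', Set.mem_union, Set.mem_iUnion, Set.mem_ofPred_eq, not_or, not_exists,
      not_not] at hx
    exact H.transfer_betheVector_of_generic hτ hB hv hsep hbae hb hx.1 hx.2 hl
  by_cases hzero : ∀ l ∈ latticeC η μ, ψ l = 0
  · simp [hzero _ (latticeC_sub hl), hzero _ (latticeC_add hl), hzero _ hl]
  push Not at hzero
  obtain ⟨l₁, hl₁, hψl₁⟩ := hzero
  obtain ⟨φ₁, hφ₁⟩ : ∃ φ : Module.Dual ℂ W, φ (ψ l₁) ≠ 0 := by
    simpa using (Module.forall_dual_apply_eq_zero_iff ℂ (ψ l₁)).not.2 hψl₁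
  set F : ℂ → ℂ := fun x => φ₁ (T l₁ x) / φ₁ (ψ l₁) with hF
  have hFan : AnalyticAt ℂ F w := (hTreg hl₁ φ₁).div analyticAt_const hφ₁
  have hFε : ∀ x ∉ B', F x = betheEigenvalue τ η z Λ c t x := by
    intro x hx
    rw [hF, div_eq_iff hφ₁, heigen x hx l₁ hl₁, map_smul, smul_eq_mul]
  rw [regularizedEigenvalue_eq_of_analyticAt hτ hB'count hFan hFε]
  refine Module.eval_apply_injective ℂ (LinearMap.ext fun φ => ?_)
  have hlimit := eq_of_continuousAt_of_countable hB'count (hTreg hl φ).continuousAt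
    (hFan.continuousAt.mul (continuousAt_const (y := φ (ψ l))))
    (Eventually.of_forall fun x hx => by
      simp only [Pi.mul_apply, heigen x hx l hl, hFε x hx, map_smul, smul_eq_mul])
  simpa only [Module.Dual.eval_apply, map_smul, smul_eq_mul] using! hlimit

end

/-! ### Generic dynamical parameters -/

theorem countable_compl_of_mem_codiscrete {s : Set ℂ} (hs : s ∈ codiscrete ℂ) : sᶜ.Countable :=
  (HereditarilyLindelofSpace.isLindelof _).countable_of_isDiscrete (mem_codiscrete'.1 hs).2

theorem eventually_codiscrete_add {p : ℂ → Prop} (hp : ∀ᶠ l in codiscrete ℂ, p l) (a : ℂ) :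
    ∀ᶠ l in codiscrete ℂ, p (l + a) := by
  have hpunctured (x) : ∀ᶠ l in 𝓝[≠] x, p l := by
    simpa using! disjoint_principal_right.1 (mem_codiscrete.1 hp x)
  refine mem_codiscrete.2 fun x => disjoint_principal_right.2 ?_
  rw [compl_compl]
  have htranslate : Tendsto (fun x => x + a) (𝓝[≠] x) (𝓝[≠] (x + a)) := by
    refine tendsto_nhdsWithin_iff.2
      ⟨((continuous_id.add continuous_const).tendsto x).mono_left nhdsWithin_le_nhds, ?_⟩
    filter_upwards [self_mem_nhdsWithin] with y hy
    simpa using hy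
  exact htranslate.eventually (hpunctured (x + a))

theorem countable_exists_mem_latticeC (η : ℂ) {D : Set ℂ} (hD : D.Countable) :
    {μ | ∃ l ∈ latticeC η μ, l ∈ D}.Countable := by
  have hunion : {μ | ∃ l ∈ latticeC η μ, l ∈ D} ⊆ ⋃ k : ℤ, {μ | μ + 2 * η * k ∈ D} := by
    rintro μ ⟨_, ⟨k, rfl⟩, hl⟩
    exact Set.mem_iUnion.2 ⟨k, hl⟩
  have htranslate (k : ℤ) : {μ | μ + 2 * η * k ∈ D}.Countable :=
    hD.preimage_of_injOn (f := fun μ => μ + 2 * η * k) (add_left_injective _).injOn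
  exact (Set.countable_iUnion htranslate).mono hunion

theorem countable_latticeC (η μ : ℂ) : (latticeC η μ).Countable := by
  refine (Set.countable_range fun j : ℤ => μ + 2 * η * j).mono ?_
  rintro _ ⟨j, rfl⟩
  exact ⟨j, rfl⟩

theorem countable_zeros_of_analyticOnNhd {f : ℂ → ℂ} {U : Set ℂ} (hf : AnalyticOnNhd ℂ f U)
    (hU : IsPreconnected U) {x : ℂ} (hx : x ∈ U) (hne : f x ≠ 0) :
    {y | y ∈ U ∧ f y = 0}.Countable := by
  have hcodiscrete := (hf.eqOn_zero_or_eventually_ne_zero_of_preconnected hU).resolve_left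
    fun hzero => hne (hzero hx)
  rw [show {y | y ∈ U ∧ f y = 0} = {y | f y = 0} ∩ U by ext; simp [and_comm]]
  refine (HereditarilyLindelofSpace.isLindelof _).countable_of_isDiscrete
    (isDiscrete_of_codiscreteWithin ?_)
  filter_upwards [hcodiscrete] with y hy hy0 using hy hy0

theorem IsMeromorphic₂.exists_ball_countable {F : ℂ × ℂ → ℂ} (hF : IsMeromorphic₂ F) (p : ℂ × ℂ) :
    ∃ r > 0, ∃ E : Set ℂ, E.Countable ∧ ∀ l ∈ Metric.ball p.2 r, l ∉ E →
      {z | z ∈ Metric.ball p.1 r ∧ ¬ AnalyticAt ℂ F (z, l)}.Countable := by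
  obtain ⟨f, g, hf, hg, hne, hFg⟩ := hF p
  obtain ⟨r, hr, hball⟩ := Metric.eventually_nhds_iff_ball.1
    ((hf.eventually_analyticAt.and hg.eventually_analyticAt).and hFg)
  obtain ⟨⟨z₁, l₁⟩, hg₁, hmem⟩ := (hne.and_eventually (Metric.ball_mem_nhds p hr)).exists
  change (z₁, l₁) ∈ Metric.ball (p.1, p.2) r at hmem
  rw [← Prod.mk.eta (p := p)] at hball
  rw [← ball_prod_same] at hball hmem
  have hg_fst : ∀ l ∈ Metric.ball p.2 r, AnalyticOnNhd ℂ (fun z => g (z, l)) (Metric.ball p.1 r) :=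
    fun l hl z hz => (hball (z, l) ⟨hz, hl⟩).1.2.comp₂ (f := fun z => z) (g := fun _ => l)
      analyticAt_id analyticAt_const
  have hg_snd : ∀ z ∈ Metric.ball p.1 r, AnalyticOnNhd ℂ (fun l => g (z, l)) (Metric.ball p.2 r) :=
    fun z hz l hl => (hball (z, l) ⟨hz, hl⟩).1.2.comp₂ (f := fun _ => z) (g := fun l => l)
      analyticAt_const analyticAt_id
  refine ⟨r, hr, {l | l ∈ Metric.ball p.2 r ∧ g (z₁, l) = 0},
    countable_zeros_of_analyticOnNhd (hg_snd z₁ hmem.1) (convex_ball _ _).isPreconnected hmem.2 hg₁,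
    fun l hl hlE => ?_⟩
  refine (countable_zeros_of_analyticOnNhd (hg_fst l hl) (convex_ball _ _).isPreconnected hmem.1
    (fun hzero => hlE ⟨hl, hzero⟩)).mono ?_
  rintro z ⟨hz, hzF⟩
  refine ⟨hz, by_contra fun hgz => hzF ?_⟩
  obtain ⟨hfz, hgz'⟩ := (hball (z, l) ⟨hz, hl⟩).1
  refine (hfz.div hgz' hgz).congr ?_
  filter_upwards [(Metric.isOpen_ball.prod Metric.isOpen_ball).mem_nhds ⟨hz, hl⟩,
    hgz'.continuousAt.eventually_ne hgz] with q hq hgq using ((hball q hq).2 hgq).symm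

theorem IsMeromorphic₂.exists_countable {F : ℂ × ℂ → ℂ} (hF : IsMeromorphic₂ F) :
    ∃ E : Set ℂ, E.Countable ∧ ∀ l ∉ E, {z | ¬ AnalyticAt ℂ F (z, l)}.Countable := by
  choose r hr E hE hsing using hF.exists_ball_countable
  obtain ⟨s, hs, hcover⟩ := TopologicalSpace.countable_cover_nhds
    (f := fun p : ℂ × ℂ => Metric.ball p.1 (r p) ×ˢ Metric.ball p.2 (r p))
    (fun p => (Metric.isOpen_ball.prod Metric.isOpen_ball).mem_nhds
      ⟨Metric.mem_ball_self (hr p), Metric.mem_ball_self (hr p)⟩)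
  refine ⟨⋃ p ∈ s, E p, hs.biUnion fun p _ => hE p, fun l hl => ?_⟩
  have hsub : {z | ¬ AnalyticAt ℂ F (z, l)} ⊆ ⋃ p ∈ s, {z | (z ∈ Metric.ball p.1 (r p) ∧
      ¬ AnalyticAt ℂ F (z, l)) ∧ l ∈ Metric.ball p.2 (r p)} := by
    intro z hz
    obtain ⟨p, hp, hzp⟩ := Set.mem_iUnion₂.1 (hcover.ge (Set.mem_univ (z, l)))
    exact Set.mem_iUnion₂.2 ⟨p, hp, ⟨hzp.1, hz⟩, hzp.2⟩
  refine (hs.biUnion fun p hp => ?_).mono hsub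
  by_cases hlp : l ∈ Metric.ball p.2 (r p)
  · exact (hsing p l hlp fun h => hl (Set.mem_biUnion hp h)).mono fun z hz => hz.1
  · exact Set.countable_empty.mono fun z hz => hlp hz.2

section
variable {W : Type*} [AddCommGroup W] [Module ℂ W]

theorem countable_zeros_of_vecRegularAt {V : Submodule ℂ W} [FiniteDimensional ℂ V] {ψ : ℂ → W}
    (hV : ∀ l, ψ l ∈ V) (hreg : ∀ᶠ l in codiscrete ℂ, VecRegularAt ψ l)
    (hne : ¬ ψ =ᶠ[codiscrete ℂ] 0) : {l | ψ l = 0}.Countable := by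
  obtain ⟨n, e, g, -, hg⟩ := exists_coordinates V
  set A : Fin n → Set ℂ := fun i => {l | AnalyticAt ℂ (fun x => g i (ψ x)) l}
  have hA (i) : A i ∈ codiscrete ℂ := by
    filter_upwards [hreg] with l hl using hl (g i)
  obtain ⟨i, x, hx, hne⟩ : ∃ i, ∃ x ∈ A i, g i (ψ x) ≠ 0 := by
    by_contra! hzero
    refine hne ?_
    filter_upwards [eventually_all.2 hA] with l hl
    rw [hg _ (hV l)]
    exact Finset.sum_eq_zero fun i _ => by rw [hzero i l (hl i), zero_smul]
  have hcount := countable_compl_of_mem_codiscrete (hA i)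
  have hconn : IsPreconnected (A i) := by
    rw [← compl_compl (A i)]
    exact (hcount.isPathConnected_compl_of_one_lt_rank
      (by rw [Complex.rank_real_complex]; norm_num)).isConnected.isPreconnected
  refine ((countable_zeros_of_analyticOnNhd (fun y hy => hy) hconn hx hne).union hcount).mono
    fun l hl => ?_
  by_cases hlA : l ∈ A i
  · exact Or.inl ⟨hlA, by rw [show ψ l = 0 from hl, map_zero]⟩
  · exact Or.inr hlA

theorem EntryRegularAt.vecRegularAt_fst {h : Module.End ℂ W}
    {L : ℂ → ℂ → Fin 2 → Fin 2 → Module.End ℂ W} {β α : Fin 2} {ν z l : ℂ}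
    (hreg : EntryRegularAt h L β α ν z l) {u : W} (hu : u ∈ h.eigenspace ν) :
    VecRegularAt (fun s => L s l β α u) z := fun φ =>
  (hreg u hu φ).comp₂ (f := fun s => s) (g := fun _ => l) analyticAt_id analyticAt_const

theorem EntryRegularAt.vecRegularAt_snd {h : Module.End ℂ W}
    {L : ℂ → ℂ → Fin 2 → Fin 2 → Module.End ℂ W} {β α : Fin 2} {ν z l a : ℂ}
    (hreg : EntryRegularAt h L β α ν z (l + a)) {u : W} (hu : u ∈ h.eigenspace ν) :
    VecRegularAt (fun s => L z (s + a) β α u) l := fun φ =>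
  (hreg u hu φ).comp₂ (f := fun _ => z) (g := fun s => s + a) analyticAt_const
    (analyticAt_id.add analyticAt_const)

namespace EModule

variable {τ η : ℂ} (M : EModule τ η W)

theorem exists_countable_entryRegularAt (β α : Fin 2) (ν : ℂ) :
    ∃ E : Set ℂ, E.Countable ∧ ∀ l ∉ E, {z | ¬ EntryRegularAt M.h M.L β α ν z l}.Countable := by
  have := M.finite_weight ν
  have := M.finite_weight (ν + sgn α - sgn β)
  obtain ⟨n, e, g, he, hg⟩ := exists_coordinates (M.h.eigenspace ν)
  obtain ⟨n', e', g', -, hg'⟩ := exists_coordinates (M.h.eigenspace (ν + sgn α - sgn β))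
  choose E hE hsing using fun i j => (M.L_merom β α (e i) (g' j)).exists_countable
  refine ⟨⋃ i, ⋃ j, E i j, Set.countable_iUnion fun i => Set.countable_iUnion fun j => hE i j,
    fun l hl => ?_⟩
  simp only [Set.mem_iUnion, not_exists] at hl
  refine (Set.countable_iUnion fun i => Set.countable_iUnion fun j => hsing i j l (hl i j)).mono
    fun z hz => ?_
  by_contra hregular
  simp only [Set.mem_iUnion, Set.mem_ofPred_eq, not_exists, not_not] at hregular
  refine hz fun u hu φ => ?_
  have hexpand : (fun p : ℂ × ℂ => φ (M.L p.1 p.2 β α u)) = fun p => ∑ i, ∑ j,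
      (g i u * φ (e' j)) * g' j (M.L p.1 p.2 β α (e i)) := by
    ext p
    conv_lhs => rw [hg u hu]
    simp only [map_sum, map_smul, smul_eq_mul]
    refine Finset.sum_congr rfl fun i _ => ?_
    conv_lhs => rw [hg' _ (M.L_weight p.1 p.2 β α ν _ (he i))]
    simp only [map_sum, map_smul, smul_eq_mul, Finset.mul_sum]
    exact Finset.sum_congr rfl fun j _ => by ring
  rw [hexpand]
  exact Finset.analyticAt_fun_sum _ fun i _ => Finset.analyticAt_fun_sum _ fun j _ =>
    analyticAt_const.mul (hregular i j)

variable {M} {n m : ℕ} {z Λ : Fin n → ℂ} {v₀ : ℂ → W}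

theorem IsHighestWeightVector.eventually_vecRegularAt (hv : M.IsHighestWeightVector z Λ v₀) :
    ∀ᶠ l in codiscrete ℂ, VecRegularAt v₀ l := by
  have := M.finite_weight (∑ j, Λ j)
  obtain ⟨n', e, g, -, hg⟩ := exists_coordinates (M.h.eigenspace (∑ j, Λ j))
  have hcoord (i) : ∀ᶠ l in codiscrete ℂ, AnalyticAt ℂ (fun x => g i (v₀ x)) l :=
    (meromorphicOn_univ.2 (hv.merom (g i))).eventually_codiscreteWithin_analyticAt
  filter_upwards [eventually_all.2 hcoord] with l hl
  intro φ
  have hexpand : (fun x => φ (v₀ x)) = fun x => ∑ i, g i (v₀ x) * φ (e i) := by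
    ext x
    conv_lhs => rw [hg _ (hv.mem x)]
    simp
  rw [hexpand]
  exact Finset.analyticAt_fun_sum _ fun i _ => (hl i).mul analyticAt_const

theorem IsHighestWeightVector.gFn_smul_mem (hv : M.IsHighestWeightVector z Λ v₀)
    (hΛ : ∑ j, Λ j = 2 * (m : ℂ)) (c l : ℂ) :
    gFn τ η c m l • v₀ l ∈ M.h.eigenspace (2 * ((m : ℤ) : ℂ)) :=
  Submodule.smul_mem _ _ (by simpa [hΛ] using hv.mem l)

theorem IsHighestWeightVector.bethe_mem (hv : M.IsHighestWeightVector z Λ v₀)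
    (hΛ : ∑ j, Λ j = 2 * (m : ℂ)) (c : ℂ) (t : Fin m → ℂ) (l : ℂ) :
    M.bethe v₀ c t l ∈ M.h.eigenspace (0 : ℂ) := by
  simpa [bethe] using betheVector_mem (η := η) (b_mem_eigenspace M.L_weight)
    (hv.gFn_smul_mem hΛ c) (List.ofFn t) l

theorem IsHighestWeightVector.vecRegularAt_bethe (hτ : 0 < τ.im)
    (hv : M.IsHighestWeightVector z Λ v₀) (hΛ : ∑ j, Λ j = 2 * (m : ℂ)) (c : ℂ) (t : Fin m → ℂ)
    {l : ℂ} (hreg : ∀ i j k : Fin m,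
      EntryRegularAt M.h M.L 0 1 (2 * ((m - (k : ℕ) : ℤ) : ℂ)) (t i) (l + 2 * η * (j : ℕ)))
    (hvreg : VecRegularAt v₀ (l + 2 * η * m)) : VecRegularAt (M.bethe v₀ c t) l := by
  have hfinite (k : ℤ) : FiniteDimensional ℂ (M.h.eigenspace (2 * (k : ℂ))) := M.finite_weight _
  have hlist := vecRegularAt_betheVector (η := η) (b_mem_eigenspace M.L_weight)
    (hv.gFn_smul_mem hΛ c) l (List.ofFn fun i => fun _ : ℂ => t i) (fun s => s)
    (by
      intro f hf j hj k hk u hu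
      rw [List.length_ofFn] at hj hk
      obtain ⟨i, rfl⟩ := (List.mem_ofFn' _ _).1 hf
      exact (hreg i ⟨j, hj⟩ ⟨k, hk⟩).vecRegularAt_snd hu)
    (by
      rw [List.length_ofFn]
      have hg := (differentiable_gFn hτ η c m).analyticAt (l + 2 * η * m)
      exact (VecRegularAt.smul hg hvreg).comp
        (f := fun s => s + 2 * η * m) (analyticAt_id.add analyticAt_const))
  simpa [bethe, List.map_ofFn, Function.comp_def] using! hlist

theorem IsHighestWeightVector.eventually_vecRegularAt_bethe (hτ : 0 < τ.im)
    (hv : M.IsHighestWeightVector z Λ v₀) (hΛ : ∑ j, Λ j = 2 * (m : ℂ)) (c : ℂ) {t : Fin m → ℂ}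
    (hb : ∀ i, M.BDefinedAt (t i)) :
    ∀ᶠ l in codiscrete ℂ, VecRegularAt (M.bethe v₀ c t) l := by
  have hregular : ∀ᶠ l in codiscrete ℂ, ∀ i j k : Fin m,
      EntryRegularAt M.h M.L 0 1 (2 * ((m - (k : ℕ) : ℤ) : ℂ)) (t i) (l + 2 * η * (j : ℕ)) :=
    eventually_all.2 fun i => eventually_all.2 fun j => eventually_all.2 fun k =>
      eventually_codiscrete_add (hb i _) _
  filter_upwards [hregular, eventually_codiscrete_add hv.eventually_vecRegularAt (2 * η * m)]
    with l hl hvl using hv.vecRegularAt_bethe hτ hΛ c t hl hvl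

variable (M) in
/-- `C_μ` avoids the zeros of `θ`, the poles of `v₀` and of the operators `b(t_i)`, and at each of
its points every matrix entry of `L` has only countably many poles in the spectral parameter. Only
the weights `2k` enter, since `v₀` has weight `2m`. -/
structure IsGenericParameter (v₀ : ℂ → W) (t : Fin m → ℂ) (μ : ℂ) : Prop where
  theta_ne_zero : ∀ l ∈ latticeC η μ, theta τ l ≠ 0
  vecRegularAt : ∀ l ∈ latticeC η μ, VecRegularAt v₀ l
  b_regular : ∀ l ∈ latticeC η μ, ∀ (i : Fin m) (k : ℤ),
    EntryRegularAt M.h M.L 0 1 (2 * (k : ℂ)) (t i) l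
  countable_singular : ∀ l ∈ latticeC η μ, ∀ (β α : Fin 2) (k : ℤ),
    {x | ¬ EntryRegularAt M.h M.L β α (2 * (k : ℂ)) x l}.Countable

theorem IsHighestWeightVector.countable_not_isGenericParameter (hτ : 0 < τ.im)
    (hv : M.IsHighestWeightVector z Λ v₀) {t : Fin m → ℂ} (hb : ∀ i, M.BDefinedAt (t i)) :
    {μ | ¬ M.IsGenericParameter v₀ t μ}.Countable := by
  choose E hE hsing using fun p : Fin 2 × Fin 2 × ℤ =>
    M.exists_countable_entryRegularAt p.1 p.2.1 (2 * (p.2.2 : ℂ))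
  set D : Set ℂ := {l | theta τ l = 0} ∪ {l | VecRegularAt v₀ l}ᶜ ∪
    (⋃ (i : Fin m) (k : ℤ), {l | EntryRegularAt M.h M.L 0 1 (2 * (k : ℂ)) (t i) l}ᶜ) ∪ ⋃ p, E p
    with hD
  have hDcount : D.Countable :=
    (((countable_theta_zeros hτ).union
      (countable_compl_of_mem_codiscrete hv.eventually_vecRegularAt)).union
      (Set.countable_iUnion fun i => Set.countable_iUnion fun k =>
        countable_compl_of_mem_codiscrete (hb i _))).union (Set.countable_iUnion hE)
  refine (countable_exists_mem_latticeC η hDcount).mono fun μ hμ => ?_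
  by_contra havoid
  have hnotMem : ∀ l ∈ latticeC η μ, l ∉ D := fun l hl hlD => havoid ⟨l, hl, hlD⟩
  simp only [hD, Set.mem_union, Set.mem_iUnion, Set.mem_compl_iff, Set.mem_ofPred_eq, not_or,
    not_exists, not_not] at hnotMem
  exact hμ ⟨fun l hl => (hnotMem l hl).1.1.1, fun l hl => (hnotMem l hl).1.1.2,
    fun l hl => (hnotMem l hl).1.2,
    fun l hl β α k => hsing (β, α, k) l ((hnotMem l hl).2 (β, α, k))⟩

variable (M) in
/-- The spectral parameters at which the `L`-operator has a pole over some point of `C_μ`, together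
with the poles of the highest weight function `D`. -/
def singularParameters (z Λ : Fin n → ℂ) (μ : ℂ) : Set ℂ :=
  (⋃ l ∈ latticeC η μ, ⋃ p : Fin 2 × Fin 2 × ℤ,
    {x | ¬ EntryRegularAt M.h M.L p.1 p.2.1 (2 * (p.2.2 : ℂ)) x l}) ∪
    ⋃ j, {x | theta τ (x - qPar η z Λ j) = 0}

theorem entryRegularAt_of_notMem_singularParameters {x μ l : ℂ}
    (hx : x ∉ M.singularParameters z Λ μ) (hl : l ∈ latticeC η μ) (β α : Fin 2) (k : ℤ) :
    EntryRegularAt M.h M.L β α (2 * (k : ℂ)) x l :=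
  by_contra fun hsing => hx (Or.inl (Set.mem_biUnion hl (Set.mem_iUnion.2 ⟨(β, α, k), hsing⟩)))

theorem theta_sub_qPar_ne_zero_of_notMem_singularParameters {x μ : ℂ}
    (hx : x ∉ M.singularParameters z Λ μ) (j : Fin n) : theta τ (x - qPar η z Λ j) ≠ 0 :=
  fun hzero => hx (Or.inr (Set.mem_iUnion.2 ⟨j, hzero⟩))

variable {t : Fin m → ℂ} {μ : ℂ}

theorem IsGenericParameter.countable_singularParameters (hμ : M.IsGenericParameter v₀ t μ)
    (hτ : 0 < τ.im) (z Λ : Fin n → ℂ) : (M.singularParameters z Λ μ).Countable := by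
  refine Set.Countable.union ?_ (Set.countable_iUnion fun j => ?_)
  · exact (countable_latticeC η μ).biUnion fun l hl => Set.countable_iUnion fun p =>
      hμ.countable_singular l hl p.1 p.2.1 p.2.2
  · exact countable_theta_comp_zeros hτ (f := fun x => x - qPar η z Λ j) sub_left_injective

theorem IsGenericParameter.rllOn (hμ : M.IsGenericParameter v₀ t μ) (z Λ : Fin n → ℂ) :
    RLLOn τ η μ M.h M.L (M.singularParameters z Λ μ)ᶜ := by
  refine ⟨hμ.theta_ne_zero, M.L_weight, fun x hx w hw hxw l hl k u hu =>
    M.rll x w l (2 * k) hxw (hμ.theta_ne_zero l hl) (fun k' => ?_) ?_ u hu⟩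
  · convert hμ.theta_ne_zero _ (latticeC_add_int hl (-(2 * k + k'))) using 2
    push_cast
    ring
  · intro k' _ s _ β α
    rw [show (2 * k + 2 * k' : ℂ) = 2 * ((k + k' : ℤ) : ℂ) by push_cast; ring]
    have hls := latticeC_add_int hl s
    exact ⟨entryRegularAt_of_notMem_singularParameters hx hls β α _,
      entryRegularAt_of_notMem_singularParameters hw hls β α _⟩

theorem IsGenericParameter.highestWeightOn (hμ : M.IsGenericParameter v₀ t μ)
    (hv : M.IsHighestWeightVector z Λ v₀) (hΛ : ∑ j, Λ j = 2 * (m : ℂ)) :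
    HighestWeightOn τ η μ M.h M.L (M.singularParameters z Λ μ)ᶜ z Λ m v₀ := by
  have hentry {x} (hx : x ∈ (M.singularParameters z Λ μ)ᶜ) {l} (hl : l ∈ latticeC η μ) (β α) :
      EntryRegularAt M.h M.L β α (∑ j, Λ j) x l := by
    rw [hΛ, show (2 * (m : ℂ)) = 2 * ((m : ℤ) : ℂ) by simp]
    exact entryRegularAt_of_notMem_singularParameters hx hl β α _
  refine ⟨fun l => hΛ ▸ hv.mem l, fun x hx l hl => hv.a_apply x l (hentry hx hl 0 0)
    (hμ.vecRegularAt _ (latticeC_sub hl)) (hμ.vecRegularAt _ hl), fun x hx l hl => ?_⟩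
  rw [hv.d_apply x l (hentry hx hl 1 1) (hμ.vecRegularAt _ (latticeC_add hl))
    (hμ.vecRegularAt _ hl) (hμ.theta_ne_zero l hl)
    (theta_sub_qPar_ne_zero_of_notMem_singularParameters hx), highestD, hΛ,
    show l - 2 * η * (2 * m) = l - 4 * η * m by ring]
  rfl

theorem IsGenericParameter.vecRegularAt_bethe (hμ : M.IsGenericParameter v₀ t μ) (hτ : 0 < τ.im)
    (hv : M.IsHighestWeightVector z Λ v₀) (hΛ : ∑ j, Λ j = 2 * (m : ℂ)) (c : ℂ) {l : ℂ}
    (hl : l ∈ latticeC η μ) : VecRegularAt (M.bethe v₀ c t) l :=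
  hv.vecRegularAt_bethe hτ hΛ c t
    (fun i j k => by simpa using hμ.b_regular _ (latticeC_add_int hl (j : ℕ)) i (m - (k : ℕ)))
    (by simpa using hμ.vecRegularAt _ (latticeC_add_int hl (m : ℕ)))

theorem IsGenericParameter.countable_not_transferDefinedOn (hμ : M.IsGenericParameter v₀ t μ) :
    {w | ¬ M.TransferDefinedOn μ w}.Countable := by
  have hunion : {w | ¬ M.TransferDefinedOn μ w} ⊆ ⋃ l ∈ latticeC η μ, ⋃ α : Fin 2,
      {w | ¬ EntryRegularAt M.h M.L α α (2 * ((0 : ℤ) : ℂ)) w l} := by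
    intro w hw
    simp only [TransferDefinedOn, Set.mem_ofPred_eq, not_forall, not_and_or] at hw
    obtain ⟨l, hl, hsing⟩ := hw
    rcases hsing with ha | hd
    · exact Set.mem_biUnion hl (Set.mem_iUnion.2 ⟨0, by simpa using ha⟩)
    · exact Set.mem_biUnion hl (Set.mem_iUnion.2 ⟨1, by simpa using hd⟩)
  exact ((countable_latticeC η μ).biUnion fun l hl => Set.countable_iUnion fun α =>
    hμ.countable_singular l hl α α 0).mono hunion

theorem IsGenericParameter.transfer_bethe (hμ : M.IsGenericParameter v₀ t μ) (hτ : 0 < τ.im)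
    (hv : M.IsHighestWeightVector z Λ v₀) (hΛ : ∑ j, Λ j = 2 * (m : ℂ)) {c : ℂ}
    (ht : ∀ i j, i ≠ j → ∀ r s : ℤ, t i - t j ≠ r + s * τ)
    (hbae : BetheEquations τ η z Λ c t) {w : ℂ} (hw : M.TransferDefinedOn μ w) {l : ℂ}
    (hl : l ∈ latticeC η μ) :
    M.L w l 0 0 (M.bethe v₀ c t (l - 2 * η)) + M.L w l 1 1 (M.bethe v₀ c t (l + 2 * η)) =
      regularizedEigenvalue τ η z Λ c t w • M.bethe v₀ c t l := by
  have hfinite (k : ℤ) : FiniteDimensional ℂ (M.h.eigenspace (2 * (k : ℂ))) := M.finite_weight _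
  refine (hμ.rllOn z Λ).transfer_bethe hτ (hμ.countable_singularParameters hτ z Λ)
    (hμ.highestWeightOn hv hΛ) (hbae.pairwise_separated hτ ht) hbae
    (fun i l hl k u hu => (hμ.b_regular l hl i k).vecRegularAt_fst hu) (fun l hl α u hu => ?_) hl
  fin_cases α
  · exact (hw l hl).1.vecRegularAt_fst hu
  · exact (hw l hl).2.vecRegularAt_fst hu

theorem IsHighestWeightVector.countable_zeros_bethe (hτ : 0 < τ.im)
    (hv : M.IsHighestWeightVector z Λ v₀) (hΛ : ∑ j, Λ j = 2 * (m : ℂ)) (c : ℂ)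
    (hb : ∀ i, M.BDefinedAt (t i)) (hne : ¬ M.bethe v₀ c t =ᶠ[codiscrete ℂ] 0) :
    {l | M.bethe v₀ c t l = 0}.Countable := by
  have := M.finite_weight 0
  exact countable_zeros_of_vecRegularAt (hv.bethe_mem hΛ c t)
    (hv.eventually_vecRegularAt_bethe hτ hΛ c hb) hne

theorem exists_countable_transfer_bethe (hτ : 0 < τ.im) (hΛ : ∑ j, Λ j = 2 * (m : ℂ)) {c : ℂ}
    (ht : ∀ i j, i ≠ j → ∀ r s : ℤ, t i - t j ≠ r + s * τ)
    (hbae : BetheEquations τ η z Λ c t) (hv : M.IsHighestWeightVector z Λ v₀)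
    (hb : ∀ i, M.BDefinedAt (t i)) :
    ∃ E : Set ℂ, E.Countable ∧ ∀ μ ∉ E,
      {w | ¬ M.TransferDefinedOn μ w}.Countable ∧
      (∀ l ∈ latticeC η μ, VecRegularAt (M.bethe v₀ c t) l) ∧
      ∃ ψ : M.FunZero μ, (∀ l, (ψ l : W) = M.bethe v₀ c t l) ∧
        (∀ w, M.TransferDefinedOn μ w →
          M.transfer μ w ψ = regularizedEigenvalue τ η z Λ c t w • ψ) ∧
        (¬ (M.bethe v₀ c t =ᶠ[codiscrete ℂ] 0) → ψ ≠ 0) := by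
  refine ⟨{μ | ¬ M.IsGenericParameter v₀ t μ} ∪
      {μ | M.bethe v₀ c t μ = 0 ∧ ¬ M.bethe v₀ c t =ᶠ[codiscrete ℂ] 0},
    (hv.countable_not_isGenericParameter hτ hb).union ?_, fun μ hμ => ?_⟩
  · by_cases hzero : M.bethe v₀ c t =ᶠ[codiscrete ℂ] 0
    · exact Set.countable_empty.mono fun μ hμ => hμ.2 hzero
    · exact (hv.countable_zeros_bethe hτ hΛ c hb hzero).mono fun μ hμ => hμ.1
  · simp only [Set.mem_union, Set.mem_ofPred_eq, not_or, not_not, not_and] at hμ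
    obtain ⟨hgen, hne⟩ := hμ
    refine ⟨hgen.countable_not_transferDefinedOn,
      fun l hl => hgen.vecRegularAt_bethe hτ hv hΛ c hl,
      fun l => ⟨M.bethe v₀ c t l, hv.bethe_mem hΛ c t l⟩, fun _ => rfl, fun w hw => ?_,
      fun hψ hzero => hψ (hne ?_)⟩
    · exact funext fun l => Subtype.ext (hgen.transfer_bethe hτ hv hΛ ht hbae hw l.2)
    · exact congrArg Subtype.val (congrFun hzero ⟨μ, 0, by simp⟩)

end EModule
end

/-! ### Tensor products of evaluation Verma modules -/

theorem tensorL_apply {ι : Type} [DecidableEq ι] {n : ℕ} (η : ℂ) (wt : Fin n → ι → ℂ)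
    (next : Fin 2 → Fin 2 → ι → ι) (coef : Fin n → ℂ → ℂ → Fin 2 → Fin 2 → ι → ℂ) (x l : ℂ)
    (β α : Fin 2) (v : (Fin n → ι) →₀ ℂ) (K' : Fin n → ι) :
    tensorL η wt next coef x l β α v K' = v.sum fun K a => a * ∑ σ : Fin (n + 1) → Fin 2,
      if (σ 0 = β ∧ σ (Fin.last n) = α) ∧ (fun j => next (σ j.castSucc) (σ j.succ) (K j)) = K' then
        ∏ j, coef j x
            (l - 2 * η * ∑ i ∈ Finset.Ioi j, wt i (next (σ i.castSucc) (σ i.succ) (K i)))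
            (σ j.castSucc) (σ j.succ) (K j)
      else 0 := by
  rw [tensorL, Finsupp.linearCombination_apply, Finsupp.sum_apply]
  refine Finsupp.sum_congr fun K _ => ?_
  rw [Finsupp.smul_apply, Finsupp.finsetSum_apply, smul_eq_mul]
  congr 1
  refine Finset.sum_congr rfl fun σ _ => ?_
  by_cases h : σ 0 = β ∧ σ (Fin.last n) = α
  · simp [h, Finsupp.single_apply]
  · simp [h]

theorem evalCoef_c_zero (τ η Λ y l : ℂ) : evalCoef τ η Λ y l 1 0 0 = 0 := by
  simp [evalCoef]

theorem countable_evalCoef_b_zeros {τ η Λ y : ℂ} (hτ : 0 < τ.im) (hη : theta τ (2 * η) ≠ 0)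
    (hy : theta τ (y - (Λ + 1) * η) ≠ 0) (k : ℕ) :
    {l | evalCoef τ η Λ y l 0 1 k = 0}.Countable := by
  refine ((countable_theta_comp_zeros hτ (f := fun l => l + y - (Λ - 1 - 2 * k) * η)
    fun l l' h => by simpa using h).union (countable_theta_zeros hτ)).mono fun l hl => ?_
  simpa [evalCoef, hη, hy] using hl

theorem countable_evalCoef_d_zeros {τ η Λ y : ℂ} (hτ : 0 < τ.im)
    (hy : theta τ (y - (Λ + 1) * η) ≠ 0) (hy' : theta τ (y - (1 - Λ) * η) ≠ 0) :
    {l | evalCoef τ η Λ y l 1 1 0 = 0}.Countable := by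
  refine ((countable_theta_comp_zeros hτ (f := fun l => l - 2 * Λ * η)
    fun l l' h => by simpa using h).union (countable_theta_zeros hτ)).mono fun l hl => ?_
  simpa [evalCoef, hy, hy'] using hl

theorem countable_gFn_zeros {τ : ℂ} (hτ : 0 < τ.im) (η c : ℂ) (m : ℕ) :
    {l | gFn τ η c m l = 0}.Countable := by
  refine (Set.countable_iUnion fun j : ℕ => countable_theta_comp_zeros hτ
    (sub_left_injective (b := 2 * η * (j : ℂ)))).mono fun l hl => ?_
  obtain ⟨j, _, hj⟩ :=
    Finset.prod_eq_zero_iff.1 ((mul_eq_zero.1 hl).resolve_left (Complex.exp_ne_zero _))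
  exact Set.mem_iUnion.2 ⟨j, hj⟩

section RaisingFirstFactor

variable {n : ℕ} {τ η x : ℂ} {z Λ : Fin (n + 1) → ℂ} {N : ℕ}

/-- The path `0, 1, …, 1` of auxiliary indices. In `b(x,λ) = ∑_σ ⋯` it labels the term in which the
first tensor factor is acted on by `b` and all the others by `d`. -/
def raisePath (n : ℕ) : Fin (n + 2) → Fin 2 := Fin.cons 0 fun _ => 1

/-- The multi-index `(N, 0, …, 0)`, that is, the basis vector `e_N ⊗ e_0 ⊗ ⋯ ⊗ e_0`. -/
def firstIndex (n N : ℕ) : Fin (n + 1) → ℕ := Fin.cons N fun _ => 0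

/-- The coefficient of `e_{N+1} ⊗ e_0 ⊗ ⋯ ⊗ e_0` in `b(x,λ) e_N ⊗ e_0 ⊗ ⋯ ⊗ e_0`. -/
def raiseCoef (τ η : ℂ) (z Λ : Fin (n + 1) → ℂ) (x l : ℂ) (N : ℕ) : ℂ :=
  ∏ j : Fin (n + 1), evalCoef τ η (Λ j) (x - z j)
    (l - 2 * η * ∑ i ∈ Finset.Ioi j, (Λ i - 2 * ((firstIndex n N i + (raisePath n i.succ : ℕ) -
      (raisePath n i.castSucc : ℕ) : ℕ) : ℂ)))
    (raisePath n j.castSucc) (raisePath n j.succ) (firstIndex n N j)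

/-- The vector `v` is a combination of the basis vectors `e_K` with `K₁ < N` and of
`e_N ⊗ e_0 ⊗ ⋯ ⊗ e_0`; the coefficient of the latter plays the role of a leading coefficient. -/
def HasLeadingIndex (N : ℕ) (v : (Fin (n + 1) → ℕ) →₀ ℂ) : Prop :=
  ∀ K, v K ≠ 0 → K 0 < N ∨ K = firstIndex n N

theorem firstIndex_zero (n : ℕ) : firstIndex n 0 = 0 :=
  funext fun j => Fin.cases rfl (fun _ => rfl) j

theorem raisePath_castSucc_succ (j : Fin n) : raisePath n j.succ.castSucc = 1 := by
  rw [← Fin.succ_castSucc]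
  rfl

theorem firstIndex_add_raisePath (n N : ℕ) :
    (fun j => firstIndex n N j + (raisePath n j.succ : ℕ) - (raisePath n j.castSucc : ℕ)) =
      firstIndex n (N + 1) := by
  funext j
  refine Fin.cases rfl (fun j => ?_) j
  rw [raisePath_castSucc_succ]
  rfl

-- Once at `1`, a path cannot return to `0`: that would require `c e_0`, which vanishes.
theorem eq_raisePath_of_prod_ne_zero {l : Fin (n + 1) → ℂ} {σ : Fin (n + 2) → Fin 2}
    (hσ₀ : σ 0 = 0) (hσ₁ : σ 1 = 1)
    (hprod : ∏ j, evalCoef τ η (Λ j) (x - z j) (l j) (σ j.castSucc) (σ j.succ)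
      (firstIndex n N j) ≠ 0) :
    σ = raisePath n := by
  have hstays : ∀ i : Fin (n + 1), σ i.succ = 1 := by
    intro i
    induction i using Fin.induction with
    | zero => exact hσ₁
    | succ i ih =>
      by_contra hne
      refine Finset.prod_ne_zero_iff.1 hprod i.succ (Finset.mem_univ _) ?_
      rw [← Fin.succ_castSucc, ih, show σ i.succ.succ = 0 by lia]
      exact evalCoef_c_zero ..
  exact funext fun i => Fin.cases hσ₀ hstays i

theorem HasLeadingIndex.eq_firstIndex_and_eq_raisePath {v : (Fin (n + 1) → ℕ) →₀ ℂ}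
    (hv : HasLeadingIndex N v) {K : Fin (n + 1) → ℕ} {σ : Fin (n + 2) → Fin 2}
    {l : Fin (n + 1) → ℂ} (hK : v K ≠ 0) (hσ₀ : σ 0 = 0)
    (hN : N + 1 ≤ K 0 + (σ 1 : ℕ) - (σ 0 : ℕ))
    (hprod : ∏ j, evalCoef τ η (Λ j) (x - z j) (l j) (σ j.castSucc) (σ j.succ) (K j) ≠ 0) :
    K = firstIndex n N ∧ σ = raisePath n := by
  have hσ₁_lt := (σ 1).2
  obtain rfl : K = firstIndex n N := (hv K hK).resolve_left (by omega)
  have hσ₁ : σ 1 = 1 := by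
    have hle : N + 1 ≤ N + (σ 1 : ℕ) - (σ 0 : ℕ) := hN
    exact Fin.ext (show (σ 1 : ℕ) = 1 by omega)
  exact ⟨rfl, eq_raisePath_of_prod_ne_zero hσ₀ hσ₁ hprod⟩

theorem HasLeadingIndex.vermaL_b {v : (Fin (n + 1) → ℕ) →₀ ℂ} (hv : HasLeadingIndex N v) (l : ℂ) :
    HasLeadingIndex (N + 1) (vermaL τ η z Λ x l 0 1 v) := by
  intro K' hK'
  rw [vermaL, tensorL_apply] at hK'
  obtain ⟨K, hK, hKsum⟩ := Finset.exists_ne_zero_of_sum_ne_zero hK'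
  obtain ⟨σ, _, hσ⟩ := Finset.exists_ne_zero_of_sum_ne_zero (right_ne_zero_of_mul hKsum)
  obtain ⟨⟨⟨hσ₀, _⟩, rfl⟩, hprod⟩ := ite_ne_right_iff.1 hσ
  refine or_iff_not_imp_left.2 fun hlt => ?_
  obtain ⟨rfl, rfl⟩ := hv.eq_firstIndex_and_eq_raisePath (Finsupp.mem_support_iff.1 hK) hσ₀
    (not_lt.1 hlt) hprod
  exact firstIndex_add_raisePath n N

theorem HasLeadingIndex.vermaL_b_apply {v : (Fin (n + 1) → ℕ) →₀ ℂ} (hv : HasLeadingIndex N v)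
    (l : ℂ) :
    vermaL τ η z Λ x l 0 1 v (firstIndex n (N + 1)) =
      v (firstIndex n N) * raiseCoef τ η z Λ x l N := by
  have honly : ∀ {K : Fin (n + 1) → ℕ} {σ : Fin (n + 2) → Fin 2} {l : Fin (n + 1) → ℂ},
      v K ≠ 0 → σ 0 = 0 →
      (fun j => K j + (σ j.succ : ℕ) - (σ j.castSucc : ℕ)) = firstIndex n (N + 1) →
      ∏ j, evalCoef τ η (Λ j) (x - z j) (l j) (σ j.castSucc) (σ j.succ) (K j) ≠ 0 →
      K = firstIndex n N ∧ σ = raisePath n := fun hK hσ₀ hnext hprod =>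
    hv.eq_firstIndex_and_eq_raisePath hK hσ₀ (congrFun hnext 0).ge hprod
  rw [vermaL, tensorL_apply]
  by_cases hlead : v (firstIndex n N) = 0
  · rw [hlead, zero_mul]
    refine Finset.sum_eq_zero fun K hK => mul_eq_zero_of_right _ (Finset.sum_eq_zero fun σ _ => ?_)
    have hvK := Finsupp.mem_support_iff.1 hK
    by_contra hσ
    obtain ⟨⟨⟨hσ₀, _⟩, hnext⟩, hprod⟩ := ite_ne_right_iff.1 hσ
    exact hvK ((honly hvK hσ₀ hnext hprod).1 ▸ hlead)
  · rw [Finsupp.sum, Finset.sum_eq_single_of_mem _ (Finsupp.mem_support_iff.2 hlead),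
      Finset.sum_eq_single_of_mem (raisePath n) (Finset.mem_univ _), if_pos, raiseCoef]
    · exact ⟨⟨rfl, by rw [← Fin.succ_last]; rfl⟩, firstIndex_add_raisePath n N⟩
    · intro σ _ hne
      by_contra hσ
      obtain ⟨⟨⟨hσ₀, _⟩, hnext⟩, hprod⟩ := ite_ne_right_iff.1 hσ
      exact hne (honly hlead hσ₀ hnext hprod).2
    · intro K hK hne
      refine mul_eq_zero_of_right _ (Finset.sum_eq_zero fun σ _ => ?_)
      by_contra hσ
      obtain ⟨⟨⟨hσ₀, _⟩, hnext⟩, hprod⟩ := ite_ne_right_iff.1 hσ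
      exact hne (honly (Finsupp.mem_support_iff.1 hK) hσ₀ hnext hprod).1

theorem countable_raiseCoef_zeros (hτ : 0 < τ.im) (hη : theta τ (2 * η) ≠ 0)
    (hq : ∀ k, theta τ (x - qPar η z Λ k) ≠ 0) (hp : ∀ k, theta τ (x - pPar η z Λ k) ≠ 0) (N : ℕ) :
    {l | raiseCoef τ η z Λ x l N = 0}.Countable := by
  have hq' (j) : theta τ (x - z j - (Λ j + 1) * η) ≠ 0 := by
    convert hq j using 2
    rw [qPar]
    ring
  have hp' (j) : theta τ (x - z j - (1 - Λ j) * η) ≠ 0 := by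
    convert hp j using 2
    rw [pPar]
    ring
  have hfactor (j : Fin (n + 1)) : {l | evalCoef τ η (Λ j) (x - z j) l (raisePath n j.castSucc)
      (raisePath n j.succ) (firstIndex n N j) = 0}.Countable := by
    refine Fin.cases (countable_evalCoef_b_zeros hτ hη (hq' 0) N) (fun j => ?_) j
    rw [raisePath_castSucc_succ]
    exact countable_evalCoef_d_zeros hτ (hq' _) (hp' _)
  simp only [raiseCoef, Finset.prod_eq_zero_iff, Finset.mem_univ, true_and, Set.ofPred_exists]
  exact Set.countable_iUnion fun j => (hfactor j).preimage_of_injOn sub_left_injective.injOn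

theorem hasLeadingIndex_betheVector (τ η : ℂ) (z Λ : Fin (n + 1) → ℂ) (c : ℂ) (m : ℕ)
    (ts : List ℂ) (l : ℂ) :
    HasLeadingIndex ts.length (betheVector η (fun x l => vermaL τ η z Λ x l 0 1)
      (fun l => gFn τ η c m l • Finsupp.single 0 1) ts l) := by
  induction ts generalizing l with
  | nil =>
    refine fun K hK => Or.inr ?_
    contrapose! hK
    rw [List.length_nil, firstIndex_zero] at hK
    simp [betheVector, hK.symm]
  | cons t ts ih => exact (ih _).vermaL_b l

theorem countable_betheVector_firstIndex_zeros (hτ : 0 < τ.im) (hη : theta τ (2 * η) ≠ 0) (c : ℂ)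
    (m : ℕ) (ts : List ℂ) (hq : ∀ t ∈ ts, ∀ k, theta τ (t - qPar η z Λ k) ≠ 0)
    (hp : ∀ t ∈ ts, ∀ k, theta τ (t - pPar η z Λ k) ≠ 0) :
    {l | betheVector η (fun x l => vermaL τ η z Λ x l 0 1)
      (fun l => gFn τ η c m l • Finsupp.single 0 1) ts l (firstIndex n ts.length) =
        0}.Countable := by
  induction ts with
  | nil =>
    refine (countable_gFn_zeros hτ η c m).mono fun l hl => ?_
    simpa [betheVector, firstIndex_zero] using hl
  | cons t ts ih =>
    rw [List.forall_mem_cons] at hq hp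
    refine (((ih hq.2 hp.2).preimage_of_injOn (f := fun l => l + 2 * η)
      (add_left_injective _).injOn).union
        (countable_raiseCoef_zeros hτ hη hq.1 hp.1 ts.length)).mono fun l hl => ?_
    rw [Set.mem_ofPred_eq, betheVector, List.length_cons,
      (hasLeadingIndex_betheVector τ η z Λ c m ts _).vermaL_b_apply, mul_eq_zero] at hl
    exact hl

end RaisingFirstFactor

theorem vermaBethe_ne_zero {n m : ℕ} {τ η : ℂ} (hτ : 0 < τ.im) {z Λ : Fin n → ℂ}
    (hΛ : ∑ j, Λ j = 2 * (m : ℂ)) {c : ℂ} {t : Fin m → ℂ}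
    (hbae : BetheEquations τ η z Λ c t) (hη : theta τ (2 * η) ≠ 0) :
    ¬ (vermaBethe τ η z Λ c t =ᶠ[codiscrete ℂ] 0) := by
  intro h0
  suffices h : ∃ K, {l | vermaBethe τ η z Λ c t l K = 0}.Countable by
    obtain ⟨K, hK⟩ := h
    refine not_countable_complex ((hK.union (countable_compl_of_mem_codiscrete h0)).mono
      fun l _ => ?_)
    by_cases hl : vermaBethe τ η z Λ c t l = 0
    · exact Or.inl (by rw [Set.mem_ofPred_eq, hl]; rfl)
    · exact Or.inr hl
  cases n with
  | zero =>
    obtain rfl : m = 0 := by simpa using hΛ.symm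
    refine ⟨0, (countable_gFn_zeros hτ η c 0).mono fun l hl => ?_⟩
    simpa [vermaBethe, betheVector] using hl
  | succ n =>
    refine ⟨_, countable_betheVector_firstIndex_zeros hτ hη c m (List.ofFn t) ?_ ?_⟩
    · exact (List.forall_mem_ofFn_iff).2 fun i => (hbae.theta_ne_zero i).2.1
    · exact (List.forall_mem_ofFn_iff).2 fun i => (hbae.theta_ne_zero i).2.2

/-! ### The dynamical Yang-Baxter equation -/

section WeightOne

/-! On the subspace of weight one, the Yang-Baxter equation consists of the nine identities of
`dybe_weight_one`. Two of them are trivial, and three others follow from the remaining ones by the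
symmetry `x ↔ u`, `l ↔ -L`. -/

variable {τ η x y u l L : ℂ}

theorem alphaFn_neg (τ η x l : ℂ) : alphaFn τ η x (-l) =
    theta τ (l - 2 * η) * theta τ x / (theta τ l * theta τ (x - 2 * η)) := by
  rw [alphaFn, show -l + 2 * η = -(l - 2 * η) by ring, theta_neg, theta_neg, neg_mul, neg_mul,
    neg_div_neg_eq]

theorem betaFn_neg (τ η x l : ℂ) : betaFn τ η x (-l) =
    theta τ (x - l) * theta τ (2 * η) / (theta τ l * theta τ (x - 2 * η)) := by
  rw [betaFn, show -l + x = x - l by ring, theta_neg, neg_mul, neg_div_neg_eq]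

theorem alphaFn_mul_alphaFn_comm (τ η x y l L : ℂ) :
    alphaFn τ η y l * alphaFn τ η x L = alphaFn τ η x l * alphaFn τ η y L := by
  simp only [alphaFn]
  ring

theorem alphaFn_mul_betaFn_exchange (hτ : 0 < τ.im) (hy : y = x + u) (hL : L = l - 2 * η)
    (hl0 : theta τ l ≠ 0) (hL0 : theta τ L ≠ 0) (hx0 : theta τ (x - 2 * η) ≠ 0)
    (hy0 : theta τ (y - 2 * η) ≠ 0) (hu0 : theta τ (u - 2 * η) ≠ 0) :
    alphaFn τ η y (-l) * betaFn τ η x L =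
      alphaFn τ η x (-l) * betaFn τ η y L * betaFn τ η u (-l) +
        betaFn τ η x l * alphaFn τ η u (-l) := by
  have hthree : theta τ y * theta τ (L + x) * (theta τ l * theta τ (u - 2 * η)) =
      theta τ (L + y) * theta τ x * (theta τ (2 * η) * theta τ (u - l)) +
        theta τ (l + x) * theta τ (y - 2 * η) * (theta τ u * theta τ L) := by
    subst hy hL
    exact theta_three_term_of_eq hτ (x + (u + l) / 2 - η) ((u + l) / 2 - η) ((u - l) / 2 + η)
      ((l - u) / 2 + η)
  rw [alphaFn_neg, alphaFn_neg, alphaFn_neg, betaFn_neg, betaFn, betaFn, betaFn, ← hL]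
  field_simp
  linear_combination -theta τ (2 * η) * hthree

theorem betaFn_exchange (hτ : 0 < τ.im) (hy : y = x + u) (hL : L = l - 2 * η)
    (hl0 : theta τ l ≠ 0) (hL0 : theta τ L ≠ 0) (hx0 : theta τ (x - 2 * η) ≠ 0)
    (hy0 : theta τ (y - 2 * η) ≠ 0) (hu0 : theta τ (u - 2 * η) ≠ 0) :
    betaFn τ η y l =
      alphaFn τ η x (-l) * betaFn τ η y L * alphaFn τ η u l +
        betaFn τ η x l * betaFn τ η u l := by
  have hthree : theta τ (L + y) * theta τ (l + 2 * η) * (theta τ x * theta τ u) =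
      theta τ (l + y) * theta τ l * (theta τ (x - 2 * η) * theta τ (u - 2 * η)) +
        theta τ (l + x) * theta τ (l + u) * (theta τ (y - 2 * η) * theta τ (2 * η)) := by
    subst hy hL
    exact theta_three_term_of_eq hτ ((x + u) / 2 + l) ((x + u) / 2) ((x + u) / 2 - 2 * η)
      ((x - u) / 2)
  rw [alphaFn_neg, alphaFn, betaFn, betaFn, betaFn, betaFn, ← hL]
  field_simp
  linear_combination theta τ (2 * η) * hthree

theorem betaFn_mul_alphaFn_exchange (hτ : 0 < τ.im) (hy : y = x + u) (hL : L = l - 2 * η)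
    (hl0 : theta τ l ≠ 0) (hL0 : theta τ L ≠ 0) (hx0 : theta τ (x - 2 * η) ≠ 0)
    (hy0 : theta τ (y - 2 * η) ≠ 0) (hu0 : theta τ (u - 2 * η) ≠ 0) :
    alphaFn τ η u (-L) * betaFn τ η x (-L) +
        betaFn τ η u L * betaFn τ η y (-l) * alphaFn τ η x (-L) =
      betaFn τ η x (-l) * alphaFn τ η y (-L) := by
  have hthree : theta τ (y - 2 * η) * theta τ l * (theta τ u * theta τ (x - L)) =
      theta τ y * theta τ L * (theta τ (u - 2 * η) * theta τ (x - l)) +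
        theta τ (L + u) * theta τ x * (theta τ (y - l) * theta τ (2 * η)) := by
    subst hy hL
    exact theta_three_term_of_eq hτ ((x + u + l) / 2 - η) ((x + u - l) / 2 + η)
      ((x + u - l) / 2 - η) ((u + l - x) / 2 - η)
  rw [alphaFn_neg, alphaFn_neg, alphaFn_neg, betaFn_neg, betaFn_neg, betaFn_neg, betaFn]
  field_simp
  linear_combination theta τ (L - 2 * η) * theta τ (2 * η) * hthree

theorem alphaFn_mul_alphaFn_exchange (hτ : 0 < τ.im) (hy : y = x + u) (hL : L = l - 2 * η)
    (hl0 : theta τ l ≠ 0) (hL0 : theta τ L ≠ 0) (hx0 : theta τ (x - 2 * η) ≠ 0)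
    (hy0 : theta τ (y - 2 * η) ≠ 0) (hu0 : theta τ (u - 2 * η) ≠ 0) :
    alphaFn τ η u (-L) * alphaFn τ η x L +
        betaFn τ η u L * betaFn τ η y (-l) * betaFn τ η x L =
      alphaFn τ η x l * alphaFn τ η u (-l) +
        betaFn τ η x (-l) * betaFn τ η y L * betaFn τ η u (-l) := by
  have hxu : theta τ (y - 2 * η) * theta τ (l + L) * (theta τ u * theta τ x) =
      theta τ (L + y) * theta τ L * (theta τ (u - l) * theta τ (x - l)) +
        theta τ (L + u) * theta τ (L + x) * (theta τ (y - l) * theta τ l) := by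
    subst hy hL
    exact theta_three_term_of_eq hτ ((x + u) / 2 + l - 2 * η) ((x + u) / 2) ((x + u) / 2 - l)
      ((u - x) / 2)
  have hlL : theta τ (l + 2 * η) * theta τ L * (theta τ L * theta τ L) =
      theta τ (l + L) * theta τ (2 * η) * (theta τ (2 * η) * theta τ (2 * η)) +
        theta τ l * theta τ l * (theta τ l * theta τ (L - 2 * η)) := by
    subst hL
    exact theta_three_term_of_eq hτ l (l - 2 * η) (2 * η) 0
  rw [alphaFn_neg, alphaFn_neg, alphaFn, alphaFn, betaFn_neg, betaFn_neg, betaFn_neg, betaFn,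
    betaFn, betaFn, ← hL, show L + 2 * η = l by rw [hL, sub_add_cancel]]
  field_simp
  linear_combination -theta τ u * theta τ x * theta τ (y - 2 * η) * hlL -
    theta τ (2 * η) ^ 3 * hxu

theorem dybe_weight_one (hτ : 0 < τ.im) (hy : y = x + u) (hL : L = l - 2 * η)
    (hl0 : theta τ l ≠ 0) (hL0 : theta τ L ≠ 0) (hx0 : theta τ (x - 2 * η) ≠ 0)
    (hy0 : theta τ (y - 2 * η) ≠ 0) (hu0 : theta τ (u - 2 * η) ≠ 0) :
    (alphaFn τ η y (-l) * alphaFn τ η x (-L) = alphaFn τ η x (-l) * alphaFn τ η y (-L)) ∧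
    (alphaFn τ η y (-l) * betaFn τ η x L =
      alphaFn τ η x (-l) * betaFn τ η y L * betaFn τ η u (-l) +
        betaFn τ η x l * alphaFn τ η u (-l)) ∧
    (betaFn τ η y l =
      alphaFn τ η x (-l) * betaFn τ η y L * alphaFn τ η u l +
        betaFn τ η x l * betaFn τ η u l) ∧
    (alphaFn τ η u (-L) * betaFn τ η x (-L) +
        betaFn τ η u L * betaFn τ η y (-l) * alphaFn τ η x (-L) =
      betaFn τ η x (-l) * alphaFn τ η y (-L)) ∧
    (alphaFn τ η u (-L) * alphaFn τ η x L +
        betaFn τ η u L * betaFn τ η y (-l) * betaFn τ η x L =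
      alphaFn τ η x l * alphaFn τ η u (-l) +
        betaFn τ η x (-l) * betaFn τ η y L * betaFn τ η u (-l)) ∧
    (alphaFn τ η x l * betaFn τ η u l +
        betaFn τ η x (-l) * betaFn τ η y L * alphaFn τ η u l =
      betaFn τ η u L * alphaFn τ η y l) ∧
    (betaFn τ η y (-L) =
      alphaFn τ η u L * betaFn τ η y (-l) * alphaFn τ η x (-L) +
        betaFn τ η u (-L) * betaFn τ η x (-L)) ∧
    (alphaFn τ η y L * betaFn τ η u (-l) =
      alphaFn τ η u L * betaFn τ η y (-l) * betaFn τ η x L +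
        betaFn τ η u (-L) * alphaFn τ η x L) ∧
    (alphaFn τ η u L * alphaFn τ η y l = alphaFn τ η y L * alphaFn τ η u l) := by
  have hy' : y = u + x := by rw [hy, add_comm]
  have hL' : -l = -L - 2 * η := by rw [hL]; ring
  have hl0' : theta τ (-l) ≠ 0 := by rwa [theta_neg, neg_ne_zero]
  have hL0' : theta τ (-L) ≠ 0 := by rwa [theta_neg, neg_ne_zero]
  refine ⟨alphaFn_mul_alphaFn_comm .., alphaFn_mul_betaFn_exchange hτ hy hL hl0 hL0 hx0 hy0 hu0,
    betaFn_exchange hτ hy hL hl0 hL0 hx0 hy0 hu0,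
    betaFn_mul_alphaFn_exchange hτ hy hL hl0 hL0 hx0 hy0 hu0,
    alphaFn_mul_alphaFn_exchange hτ hy hL hl0 hL0 hx0 hy0 hu0, ?_, ?_, ?_,
    alphaFn_mul_alphaFn_comm ..⟩
  · simpa only [neg_neg] using betaFn_mul_alphaFn_exchange hτ hy' hL' hL0' hl0' hu0 hy0 hx0
  · simpa only [neg_neg] using betaFn_exchange hτ hy' hL' hL0' hl0' hu0 hy0 hx0
  · simpa only [neg_neg] using alphaFn_mul_betaFn_exchange hτ hy' hL' hL0' hl0' hu0 hy0 hx0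

end WeightOne

theorem dybe {τ η : ℂ} (hτ : 0 < τ.im) {z w l : ℂ} (hl : theta τ l ≠ 0)
    (hl_sub : theta τ (l - 2 * η) ≠ 0) (hl_add : theta τ (l + 2 * η) ≠ 0)
    (hzw : theta τ (z - w - 2 * η) ≠ 0) (hz : theta τ (z - 2 * η) ≠ 0)
    (hw : theta τ (w - 2 * η) ≠ 0) (k'' k γ δ α β : Fin 2) :
    ∑ α' : Fin 2, ∑ β' : Fin 2, ∑ k' : Fin 2,
      rMat τ η (z - w) (l - 2 * η * sgn k'') γ δ α' β' *
        (rMat τ η z l α' k'' α k' * rMat τ η w (l - 2 * η * sgn α) β' k' β k) =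
    ∑ α' : Fin 2, ∑ β' : Fin 2, ∑ k' : Fin 2,
      rMat τ η w l δ k'' β' k' * rMat τ η z (l - 2 * η * sgn β') γ k' α' k *
        rMat τ η (z - w) l α' β' α β := by
  obtain ⟨a₁, a₂, a₃, a₄, a₅, a₆, a₇, a₈, a₉⟩ :=
    dybe_weight_one hτ (sub_add_cancel z w).symm rfl hl hl_sub hzw hz hw
  -- The matrix elements on the subspace of weight `-1` are obtained from these by `l ↦ -l`.
  have hweight_neg := dybe_weight_one (l := -l) (L := -(l + 2 * η)) hτ (sub_add_cancel z w).symm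
    (by ring) (by rwa [theta_neg, neg_ne_zero]) (by rwa [theta_neg, neg_ne_zero]) hzw hz hw
  simp only [neg_neg] at hweight_neg
  obtain ⟨b₁, b₂, b₃, b₄, b₅, b₆, b₇, b₈, b₉⟩ := hweight_neg
  have hshift : l - 2 * η * (-1) = l + 2 * η := by ring
  fin_cases k'' <;> fin_cases k <;> fin_cases γ <;> fin_cases δ <;> fin_cases α <;> fin_cases β <;>
    simp only [Fin.sum_univ_two, rMat, Fin.zero_eta, Fin.mk_one, sgn_zero, sgn_one, Int.cast_neg,
      Int.cast_one, mul_one, hshift, Fin.isValue, and_true, true_and, and_false, false_and,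
      if_true, if_false, one_ne_zero, zero_ne_one, mul_zero, zero_mul, add_zero, zero_add, one_mul,
      and_self] <;>
    first
      | done
      | linear_combination a₁
      | linear_combination a₂
      | linear_combination a₃
      | linear_combination a₄
      | linear_combination a₅
      | linear_combination -a₆
      | linear_combination -a₇
      | linear_combination -a₈
      | linear_combination a₉
      | linear_combination b₁
      | linear_combination b₂
      | linear_combination b₃
      | linear_combination b₄
      | linear_combination b₅
      | linear_combination -b₆
      | linear_combination -b₇
      | linear_combination -b₈
      | linear_combination b₉

section Fusion

variable {n : ℕ} {τ η : ℂ}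

/-- The matrix `R(y, l)` in the basis `e_α ⊗ e_β` of `V ⊗ V`. -/
def rMatrix (τ η y l : ℂ) : Matrix (Fin 2 × Fin 2) (Fin 2 × Fin 2) ℂ :=
  .of fun a b => rMat τ η y l a.1 a.2 b.1 b.2

/-- The block of `R⁽¹³⁾(x, l) R⁽²³⁾(w, l-2ηh⁽¹⁾)` on `V ⊗ V ⊗ V` that takes `e_k` to `e_{k''}` in
the third factor, as a matrix on the first two factors. -/
def rMatPair (τ η x w l : ℂ) (k'' k : Fin 2) : Matrix (Fin 2 × Fin 2) (Fin 2 × Fin 2) ℂ :=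
  .of fun a b => ∑ k', rMat τ η x l a.1 k'' b.1 k' *
    rMat τ η w (l - 2 * η * sgn b.1) a.2 k' b.2 k

theorem rMatrix_mul_rMatPair (hτ : 0 < τ.im) {x w l : ℂ} (hl : theta τ l ≠ 0)
    (hl_sub : theta τ (l - 2 * η) ≠ 0) (hl_add : theta τ (l + 2 * η) ≠ 0)
    (hxw : theta τ (x - w - 2 * η) ≠ 0) (hx : theta τ (x - 2 * η) ≠ 0)
    (hw : theta τ (w - 2 * η) ≠ 0) (k'' k : Fin 2) :
    rMatrix τ η (x - w) (l - 2 * η * sgn k'') * rMatPair τ η x w l k'' k =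
      (rMatPair τ η w x l k'' k).submatrix Prod.swap Prod.swap * rMatrix τ η (x - w) l := by
  ext ⟨γ, δ⟩ ⟨α, β⟩
  simpa only [Matrix.mul_apply, Fintype.sum_prod_type, rMatrix, rMatPair, Matrix.of_apply,
    Matrix.submatrix_apply, Prod.swap_prod_mk, Prod.fst_swap, Prod.snd_swap, Finset.mul_sum,
    Finset.sum_mul] using dybe hτ hl hl_sub hl_add hxw hx hw k'' k γ δ α β

/-- The matrix element of the `L`-operator of `V(z_1) ⊗ ⋯ ⊗ V(z_n)` that takes `e_α ⊗ e_K` to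
`e_β ⊗ e_{K'}`. -/
def fundEntry (τ η : ℂ) (z : Fin n → ℂ) (x l : ℂ) (β α : Fin 2) (K' K : Fin n → Fin 2) : ℂ :=
  ∑ σ : Fin (n + 1) → Fin 2, if σ 0 = β ∧ σ (Fin.last n) = α then
    ∏ j, rMat τ η (x - z j) (l - 2 * η * ∑ i ∈ Finset.Ioi j, (sgn (K' i) : ℂ))
      (σ j.castSucc) (K' j) (σ j.succ) (K j) else 0

theorem fundEntry_zero (z : Fin 0 → ℂ) (x l : ℂ) (β α : Fin 2) (K' K : Fin 0 → Fin 2) :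
    fundEntry τ η z x l β α K' K = if β = α then 1 else 0 := by
  rw [fundEntry, ← (Equiv.funUnique (Fin 1) (Fin 2)).symm.sum_comp]
  simp [ite_and]

theorem sum_fin_succ_arrow {A M : Type*} [Fintype A] [AddCommMonoid M]
    (f : (Fin (n + 1) → A) → M) :
    ∑ K, f K = ∑ k : A, ∑ K : Fin n → A, f (Fin.cons k K) := by
  rw [← (Fin.consEquiv fun _ : Fin (n + 1) => A).sum_comp, Fintype.sum_prod_type]
  rfl

theorem fundEntry_succ (z : Fin (n + 1) → ℂ) (x l : ℂ) (β α : Fin 2)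
    (K' K : Fin (n + 1) → Fin 2) :
    fundEntry τ η z x l β α K' K = ∑ γ : Fin 2,
      rMat τ η (x - z 0) (l - 2 * η * ∑ i, (sgn (Fin.tail K' i) : ℂ)) β (K' 0) γ (K 0) *
        fundEntry τ η (Fin.tail z) x l γ α (Fin.tail K') (Fin.tail K) := by
  simp only [fundEntry, Finset.mul_sum]
  rw [sum_fin_succ_arrow, Finset.sum_comm, Finset.sum_comm (γ := Fin 2)]
  refine Finset.sum_congr rfl fun σ _ => ?_
  simp only [Fin.cons_zero, ← Fin.succ_last, Fin.cons_succ, ite_and, Finset.sum_ite_eq', mul_ite,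
    mul_zero, Finset.mem_univ, if_true, Fin.prod_univ_succ, Finset.sum_ite_eq, Fin.castSucc_zero,
    ← Fin.succ_castSucc, Fin.sum_Ioi_zero, Fin.sum_Ioi_succ, Fin.tail]

theorem rMat_conservation {x l : ℂ} {γ δ α β : Fin 2} (h : rMat τ η x l γ δ α β ≠ 0) :
    sgn γ + sgn δ = sgn α + sgn β := by
  revert h
  fin_cases γ <;> fin_cases δ <;> fin_cases α <;> fin_cases β <;> simp [rMat]

theorem rMat_eq_next {x l : ℂ} {γ δ α β : Fin 2} (h : rMat τ η x l γ δ α β ≠ 0) :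
    δ = if γ = α then β else α := by
  revert h
  fin_cases γ <;> fin_cases δ <;> fin_cases α <;> fin_cases β <;> simp [rMat]

theorem fundEntry_conservation {z : Fin n → ℂ} {x l : ℂ} {β α : Fin 2} {K' K : Fin n → Fin 2}
    (h : fundEntry τ η z x l β α K' K ≠ 0) :
    sgn β + ∑ i, sgn (K' i) = sgn α + ∑ i, sgn (K i) := by
  induction n generalizing β with
  | zero =>
    have hβα : β = α := by simpa [fundEntry_zero] using h
    simp [hβα]
  | succ n ih =>
    rw [fundEntry_succ] at h
    obtain ⟨γ, _, hγ⟩ := Finset.exists_ne_zero_of_sum_ne_zero h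
    have htail := ih (right_ne_zero_of_mul hγ)
    have hhead := rMat_conservation (left_ne_zero_of_mul hγ)
    simp only [Fin.tail] at htail
    rw [Fin.sum_univ_succ, Fin.sum_univ_succ]
    linarith

theorem fundL_apply (z : Fin n → ℂ) (x l : ℂ) (β α : Fin 2) (v : (Fin n → Fin 2) →₀ ℂ)
    (K' : Fin n → Fin 2) :
    fundL τ η z x l β α v K' = ∑ K, fundEntry τ η z x l β α K' K * v K := by
  rw [fundL, tensorL_apply, Finsupp.sum_fintype _ _ (by simp)]
  refine Finset.sum_congr rfl fun K _ => ?_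
  rw [mul_comm]
  congr 1
  refine Finset.sum_congr rfl fun σ _ => ?_
  by_cases hends : σ 0 = β ∧ σ (Fin.last n) = α
  swap
  · rw [if_neg hends, if_neg fun h => hends h.1]
  rw [if_pos hends]
  split_ifs with hnext
  · rw [← hnext.2]
  · by_contra hne
    refine hnext ⟨hends, funext fun j => ?_⟩
    exact (rMat_eq_next (Finset.prod_ne_zero_iff.1 (Ne.symm hne) j (Finset.mem_univ _))).symm

/-- The block of `L⁽¹³⁾(x, l) L⁽²³⁾(w, l-2ηh⁽¹⁾)` that takes `e_K` to `e_{K''}` in the third factor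
`V(z_1) ⊗ ⋯ ⊗ V(z_n)`, as a matrix on the first two factors `V ⊗ V`. -/
def fundPair (τ η : ℂ) (z : Fin n → ℂ) (x w l : ℂ) (K'' K : Fin n → Fin 2) :
    Matrix (Fin 2 × Fin 2) (Fin 2 × Fin 2) ℂ :=
  .of fun a b => ∑ K', fundEntry τ η z x l a.1 b.1 K'' K' *
    fundEntry τ η z w (l - 2 * η * sgn b.1) a.2 b.2 K' K

theorem fundPair_zero (z : Fin 0 → ℂ) (x w l : ℂ) (K'' K : Fin 0 → Fin 2) :
    fundPair τ η z x w l K'' K = 1 := by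
  ext ⟨γ, δ⟩ ⟨α, β⟩
  simp [fundPair, fundEntry_zero, Matrix.one_apply, ← ite_and, and_comm]

theorem rMat_mul_fundEntry_shift (z : Fin n → ℂ) (x y l : ℂ) (a b c d ρ α : Fin 2)
    (K'' K' : Fin n → Fin 2) :
    rMat τ η y (l - 2 * η * sgn α - 2 * η * ∑ i, (sgn (K' i) : ℂ)) a b c d *
        fundEntry τ η z x l ρ α K'' K' =
      rMat τ η y (l - 2 * η * ∑ i, (sgn (K'' i) : ℂ) - 2 * η * sgn ρ) a b c d *
        fundEntry τ η z x l ρ α K'' K' := by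
  by_cases h : fundEntry τ η z x l ρ α K'' K' = 0
  · rw [h, mul_zero, mul_zero]
  · have hweight : (sgn ρ : ℂ) + ∑ i, (sgn (K'' i) : ℂ) = sgn α + ∑ i, (sgn (K' i) : ℂ) := by
      exact_mod_cast fundEntry_conservation h
    congr 2
    linear_combination 2 * η * hweight

theorem sum_comm_cycle {A B C M : Type*} [Fintype A] [Fintype B] [Fintype C] [AddCommMonoid M]
    (f : A → B → C → M) : ∑ a, ∑ b, ∑ c, f a b c = ∑ c, ∑ a, ∑ b, f a b c := by
  rw [Finset.sum_comm (γ := C)]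
  exact Finset.sum_congr rfl fun a _ => Finset.sum_comm

theorem fundPair_succ (z : Fin (n + 1) → ℂ) (x w l : ℂ) (K'' K : Fin (n + 1) → Fin 2) :
    fundPair τ η z x w l K'' K =
      rMatPair τ η (x - z 0) (w - z 0) (l - 2 * η * ∑ i, (sgn (Fin.tail K'' i) : ℂ)) (K'' 0) (K 0) *
        fundPair τ η (Fin.tail z) x w l (Fin.tail K'') (Fin.tail K) := by
  ext ⟨γ, δ⟩ ⟨α, β⟩
  simp only [Matrix.mul_apply, Fintype.sum_prod_type, fundPair, rMatPair, Matrix.of_apply,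
    sum_fin_succ_arrow (A := Fin 2), fundEntry_succ, Fin.cons_zero, Fin.tail_cons,
    Finset.sum_mul_sum]
  rw [sum_comm_cycle]
  refine Finset.sum_congr rfl fun ρ _ => ?_
  rw [sum_comm_cycle]
  refine Finset.sum_congr rfl fun σ _ => Finset.sum_congr rfl fun k' _ =>
    Finset.sum_congr rfl fun K' _ => ?_
  linear_combination
    rMat τ η (x - z 0) (l - 2 * η * ∑ i, (sgn (Fin.tail K'' i) : ℂ)) γ (K'' 0) ρ k' *
    fundEntry τ η (Fin.tail z) w (l - 2 * η * sgn α) σ β K' (Fin.tail K) *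
    rMat_mul_fundEntry_shift (Fin.tail z) x (w - z 0) l δ k' σ (K 0) ρ α (Fin.tail K'') K'

theorem rMatrix_mul_fundPair (hτ : 0 < τ.im) {z : Fin n → ℂ} {x w l : ℂ}
    (hl : ∀ k : ℤ, theta τ (l + 2 * η * k) ≠ 0) (hxw : theta τ (x - w - 2 * η) ≠ 0)
    (hx : ∀ j, theta τ (x - z j - 2 * η) ≠ 0) (hw : ∀ j, theta τ (w - z j - 2 * η) ≠ 0)
    (K'' K : Fin n → Fin 2) :
    rMatrix τ η (x - w) (l - 2 * η * ∑ i, (sgn (K'' i) : ℂ)) * fundPair τ η z x w l K'' K =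
      (fundPair τ η z w x l K'' K).submatrix Prod.swap Prod.swap * rMatrix τ η (x - w) l := by
  induction n with
  | zero => simp [fundPair_zero, Matrix.submatrix_one _ Prod.swap_injective]
  | succ n ih =>
    set l' := l - 2 * η * ∑ i, (sgn (Fin.tail K'' i) : ℂ) with hl'
    have hshift : l - 2 * η * ∑ i, (sgn (K'' i) : ℂ) = l' - 2 * η * sgn (K'' 0) := by
      rw [hl', Fin.sum_univ_succ]
      simp only [Fin.tail]
      ring
    have hl'_ne : ∀ k : ℤ, theta τ (l' + 2 * η * k) ≠ 0 := fun k => by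
      convert hl (k - ∑ i, sgn (Fin.tail K'' i)) using 2
      rw [hl']
      push_cast
      ring
    have hsite := rMatrix_mul_rMatPair (η := η) hτ (x := x - z 0) (w := w - z 0) (l := l')
      (by simpa using hl'_ne 0) (by simpa [sub_eq_add_neg] using hl'_ne (-1))
      (by simpa using hl'_ne 1) (by rwa [sub_sub_sub_cancel_right]) (hx 0) (hw 0) (K'' 0) (K 0)
    rw [sub_sub_sub_cancel_right] at hsite
    have htail := ih (z := Fin.tail z) (fun j => hx j.succ) (fun j => hw j.succ) (Fin.tail K'')
      (Fin.tail K)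
    rw [hshift, fundPair_succ, fundPair_succ, ← hl', ← Matrix.mul_assoc, hsite, Matrix.mul_assoc,
      htail, ← Matrix.mul_assoc]
    exact congrArg (· * _) (Matrix.submatrix_mul_equiv _ _ _ (Equiv.prodComm _ _) _)

end Fusion

/-! ### Tensor products of fundamental representations -/

section FundamentalRepresentations

variable {n m : ℕ} {τ η μ : ℂ} {z Λ : Fin n → ℂ}

/-- The operator `h` on `V(z_1) ⊗ ⋯ ⊗ V(z_n)`. -/
def fundH (n : ℕ) : Module.End ℂ ((Fin n → Fin 2) →₀ ℂ) :=
  Finsupp.linearCombination ℂ fun K => Finsupp.single K (∑ i, (sgn (K i) : ℂ))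

theorem fundH_apply (v : (Fin n → Fin 2) →₀ ℂ) (K : Fin n → Fin 2) :
    fundH n v K = v K * ∑ i, (sgn (K i) : ℂ) := by
  rw [fundH, Finsupp.linearCombination_apply, Finsupp.sum_fintype _ _ (by simp),
    Finsupp.finsetSum_apply]
  simp [Finsupp.single_apply]

theorem mem_eigenspace_fundH {ν : ℂ} {v : (Fin n → Fin 2) →₀ ℂ} :
    v ∈ (fundH n).eigenspace ν ↔ ∀ K, v K ≠ 0 → ∑ i, (sgn (K i) : ℂ) = ν := by
  rw [Module.End.mem_eigenspace_iff, DFunLike.ext_iff]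
  refine forall_congr' fun K => ?_
  rw [fundH_apply, Finsupp.smul_apply, smul_eq_mul, mul_comm ν]
  by_cases h : v K = 0
  · simp [h]
  · simp [h]

theorem single_zero_mem_eigenspace_fundH (n : ℕ) :
    Finsupp.single 0 1 ∈ (fundH n).eigenspace (n : ℂ) := by
  rw [mem_eigenspace_fundH]
  intro K hK
  have hK0 : K = 0 := by
    by_contra h
    exact hK (Finsupp.single_eq_of_ne h)
  simp [hK0]

theorem fundL_weight (x l : ℂ) (β α : Fin 2) (ν : ℂ) (u : (Fin n → Fin 2) →₀ ℂ)
    (hu : u ∈ (fundH n).eigenspace ν) :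
    fundL τ η z x l β α u ∈ (fundH n).eigenspace (ν + sgn α - sgn β) := by
  rw [mem_eigenspace_fundH] at hu ⊢
  intro K' hK'
  rw [fundL_apply] at hK'
  obtain ⟨K, _, hK⟩ := Finset.exists_ne_zero_of_sum_ne_zero hK'
  have hweight : (sgn β : ℂ) + ∑ i, (sgn (K' i) : ℂ) = sgn α + ∑ i, (sgn (K i) : ℂ) := by
    exact_mod_cast fundEntry_conservation (left_ne_zero_of_mul hK)
  rw [← hu K (right_ne_zero_of_mul hK)]
  linear_combination hweight

theorem fundPair_conservation {x w l : ℂ} {K'' K : Fin n → Fin 2} {a b : Fin 2 × Fin 2}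
    (h : fundPair τ η z x w l K'' K a b ≠ 0) :
    sgn a.1 + sgn a.2 + ∑ i, sgn (K'' i) = sgn b.1 + sgn b.2 + ∑ i, sgn (K i) := by
  obtain ⟨K', _, hK'⟩ := Finset.exists_ne_zero_of_sum_ne_zero h
  have hx := fundEntry_conservation (left_ne_zero_of_mul hK')
  have hw := fundEntry_conservation (right_ne_zero_of_mul hK')
  linarith

theorem fundL_fundL_apply (x w l : ℂ) (γ δ α β : Fin 2) (u : (Fin n → Fin 2) →₀ ℂ)
    (K'' : Fin n → Fin 2) :
    fundL τ η z x l γ α (fundL τ η z w (l - 2 * η * sgn α) δ β u) K'' =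
      ∑ K, fundPair τ η z x w l K'' K (γ, δ) (α, β) * u K := by
  simp only [fundL_apply, fundPair, Matrix.of_apply, Finset.mul_sum, Finset.sum_mul, mul_assoc]
  exact Finset.sum_comm

theorem fundL_rllRelation (hτ : 0 < τ.im) {x w l : ℂ}
    (hl : ∀ k : ℤ, theta τ (l + 2 * η * k) ≠ 0) (hxw : theta τ (x - w - 2 * η) ≠ 0)
    (hx : ∀ j, theta τ (x - z j - 2 * η) ≠ 0) (hw : ∀ j, theta τ (w - z j - 2 * η) ≠ 0) {ν : ℂ}
    {u : (Fin n → Fin 2) →₀ ℂ} (hu : u ∈ (fundH n).eigenspace ν) :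
    RLLRelation τ η (fundL τ η z) x w l ν u := by
  intro γ δ α β
  ext K''
  simp only [Finsupp.finsetSum_apply, Finsupp.smul_apply, fundL_fundL_apply, smul_eq_mul,
    Finset.mul_sum]
  refine (sum_comm_cycle _).trans (Eq.trans ?_ (sum_comm_cycle _).symm)
  refine Finset.sum_congr rfl fun K _ => ?_
  have hmatrix := congrArg (· * u K)
    (congrFun₂ (rMatrix_mul_fundPair hτ hl hxw hx hw K'' K) (γ, δ) (α, β))
  simp only [Matrix.mul_apply, Fintype.sum_prod_type, Matrix.submatrix_apply, Prod.swap_prod_mk,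
    rMatrix, Matrix.of_apply, Finset.sum_mul] at hmatrix
  have hshift (α' β' : Fin 2) :
      rMat τ η (x - w) (l - 2 * η * (ν + sgn α + sgn β - sgn α' - sgn β')) γ δ α' β' *
          (fundPair τ η z x w l K'' K (α', β') (α, β) * u K) =
        rMat τ η (x - w) (l - 2 * η * ∑ i, (sgn (K'' i) : ℂ)) γ δ α' β' *
          fundPair τ η z x w l K'' K (α', β') (α, β) * u K := by
    by_cases hzero : fundPair τ η z x w l K'' K (α', β') (α, β) * u K = 0
    · rw [mul_assoc _ (fundPair ..), hzero, mul_zero, mul_zero]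
    have hweight : (sgn α' : ℂ) + sgn β' + ∑ i, (sgn (K'' i) : ℂ) =
        sgn α + sgn β + ∑ i, (sgn (K i) : ℂ) := by
      exact_mod_cast fundPair_conservation (left_ne_zero_of_mul hzero)
    have hν := mem_eigenspace_fundH.1 hu K (right_ne_zero_of_mul hzero)
    rw [mul_assoc _ (fundPair ..), ← hν]
    congr 3
    linear_combination -2 * η * hweight
  simp only [hshift, hmatrix]
  refine Finset.sum_congr rfl fun α' _ => Finset.sum_congr rfl fun β' _ => ?_
  ring

theorem fundL_rllOn (hτ : 0 < τ.im) (z : Fin n → ℂ) (hμ : ∀ l ∈ latticeC η μ, theta τ l ≠ 0) :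
    RLLOn τ η μ (fundH n) (fundL τ η z) {x | ∃ j, theta τ (x - z j - 2 * η) = 0}ᶜ where
  theta_ne := hμ
  weight := fundL_weight
  rll x hx w hw hxw l hl k u hu := by
    simp only [Set.mem_compl_iff, Set.mem_ofPred_eq, not_exists] at hx hw
    exact fundL_rllRelation hτ (fun k => hμ _ (latticeC_add_int hl k)) hxw hx hw hu

theorem eq_zero_of_sum_sgn {K : Fin n → Fin 2} (h : ∑ i, sgn (K i) = n) : K = 0 := by
  have sgn_le_one : ∀ k : Fin 2, sgn k ≤ 1 := by decide
  have eq_zero_of_sgn : ∀ k : Fin 2, 1 - sgn k = 0 → k = 0 := by decide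
  have hsum : ∑ i, (1 - sgn (K i)) = 0 := by simp [h]
  rw [Finset.sum_eq_zero_iff_of_nonneg fun i _ => sub_nonneg.2 (sgn_le_one _)] at hsum
  exact funext fun i => eq_zero_of_sgn _ (hsum i (Finset.mem_univ i))

theorem fundEntry_zero_zero_highest (τ η : ℂ) (z : Fin n → ℂ) (x l : ℂ) :
    fundEntry τ η z x l 0 0 0 0 = 1 := by
  induction n with
  | zero => simp [fundEntry_zero]
  | succ n ih =>
    have htail : Fin.tail (0 : Fin (n + 1) → Fin 2) = 0 := rfl
    rw [fundEntry_succ, Fin.sum_univ_two]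
    simp [rMat, htail, ih]

theorem fundEntry_one_one_highest (z : Fin n → ℂ) (x : ℂ) {l : ℂ}
    (hl : ∀ k : ℤ, theta τ (l + 2 * η * k) ≠ 0) :
    fundEntry τ η z x l 1 1 0 0 = theta τ (l - 2 * η * n) / theta τ l *
      ∏ j, theta τ (x - z j) / theta τ (x - z j - 2 * η) := by
  have hl₀ : theta τ l ≠ 0 := by simpa using hl 0
  induction n with
  | zero => simp [fundEntry_zero, hl₀]
  | succ n ih =>
    have hln : theta τ (l - 2 * η * n) ≠ 0 := by simpa [sub_eq_add_neg] using hl (-n)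
    have htail : Fin.tail (0 : Fin (n + 1) → Fin 2) = 0 := rfl
    have hhead : fundEntry τ η z x l 1 1 0 0 = alphaFn τ η (x - z 0) (-(l - 2 * η * n)) *
        fundEntry τ η (Fin.tail z) x l 1 1 0 0 := by
      rw [fundEntry_succ, Fin.sum_univ_two]
      simp [rMat, htail]
    rw [hhead, ih, alphaFn_neg, Fin.prod_univ_succ]
    simp only [Fin.tail]
    rw [show l - 2 * η * n - 2 * η = l - 2 * η * (n + 1 : ℕ) by push_cast; ring]
    field_simp

theorem fundL_diag_single_zero (x l : ℂ) (α : Fin 2) :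
    fundL τ η z x l α α (Finsupp.single 0 1) =
      fundEntry τ η z x l α α 0 0 • Finsupp.single 0 1 := by
  ext K'
  rw [fundL_apply, Finset.sum_eq_single 0 (fun K _ hK => by simp [hK]) (by simp)]
  by_cases hK : K' = 0
  · simp [hK]
  · rw [Finsupp.smul_apply, Finsupp.single_eq_of_ne hK, smul_zero, Finsupp.single_eq_same,
      mul_one]
    by_contra hne
    exact hK (eq_zero_of_sum_sgn (by simpa using fundEntry_conservation hne))

theorem fundL_highestWeightOn (hΛ : ∀ j, Λ j = 1) (hm : ∑ j, Λ j = 2 * (m : ℂ))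
    (hμ : ∀ l ∈ latticeC η μ, theta τ l ≠ 0) (S : Set ℂ) :
    HighestWeightOn τ η μ (fundH n) (fundL τ η z) S z Λ m fun _ => Finsupp.single 0 1 where
  mem _ := by
    have hn : (n : ℂ) = 2 * m := by simpa [hΛ] using hm
    exact hn ▸ single_zero_mem_eigenspace_fundH n
  a_apply x _ l _ := by rw [fundL_diag_single_zero, fundEntry_zero_zero_highest, one_smul]
  d_apply x _ l hl := by
    have hn : (n : ℂ) = 2 * m := by simpa [hΛ] using hm
    rw [fundL_diag_single_zero,
      fundEntry_one_one_highest _ _ fun k => hμ _ (latticeC_add_int hl k), weightRatio]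
    simp only [pPar, qPar, hΛ]
    congr 2
    · rw [hn]
      ring_nf
    · refine Finset.prod_congr rfl fun j _ => ?_
      congr 2 <;> ring

theorem analyticAt_alphaFn (hτ : 0 < τ.im) {f g : ℂ → ℂ} {p : ℂ} (hf : AnalyticAt ℂ f p)
    (hg : AnalyticAt ℂ g p) (hfp : theta τ (f p - 2 * η) ≠ 0) (hgp : theta τ (g p) ≠ 0) :
    AnalyticAt ℂ (fun s => alphaFn τ η (f s) (g s)) p := by
  have hθ {f : ℂ → ℂ} (hf : AnalyticAt ℂ f p) : AnalyticAt ℂ (fun s => theta τ (f s)) p :=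
    (analyticAt_theta hτ _).fun_comp hf
  exact ((hθ (hg.add analyticAt_const)).mul (hθ hf)).div
    ((hθ hg).mul (hθ (hf.sub analyticAt_const))) (mul_ne_zero hgp hfp)

theorem analyticAt_betaFn (hτ : 0 < τ.im) {f g : ℂ → ℂ} {p : ℂ} (hf : AnalyticAt ℂ f p)
    (hg : AnalyticAt ℂ g p) (hfp : theta τ (f p - 2 * η) ≠ 0) (hgp : theta τ (g p) ≠ 0) :
    AnalyticAt ℂ (fun s => betaFn τ η (f s) (g s)) p := by
  have hθ {f : ℂ → ℂ} (hf : AnalyticAt ℂ f p) : AnalyticAt ℂ (fun s => theta τ (f s)) p :=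
    (analyticAt_theta hτ _).fun_comp hf
  exact (((hθ (hg.add hf)).mul analyticAt_const).neg).div
    ((hθ hg).mul (hθ (hf.sub analyticAt_const))) (mul_ne_zero hgp hfp)

theorem analyticAt_rMat (hτ : 0 < τ.im) {f g : ℂ → ℂ} {p : ℂ} (hf : AnalyticAt ℂ f p)
    (hg : AnalyticAt ℂ g p) (hfp : theta τ (f p - 2 * η) ≠ 0) (hgp : theta τ (g p) ≠ 0)
    (γ δ α β : Fin 2) : AnalyticAt ℂ (fun s => rMat τ η (f s) (g s) γ δ α β) p := by
  have hgp' : theta τ (-g p) ≠ 0 := by rwa [theta_neg, neg_ne_zero]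
  unfold rMat
  split_ifs
  exacts [analyticAt_const, analyticAt_alphaFn hτ hf hg hfp hgp,
    analyticAt_alphaFn hτ hf hg.neg hfp hgp', analyticAt_betaFn hτ hf hg hfp hgp,
    analyticAt_betaFn hτ hf hg.neg hfp hgp', analyticAt_const]

theorem abs_sgn (k : Fin 2) : |sgn k| = 1 := by
  fin_cases k <;> simp

theorem abs_sum_sgn_le {ι : Type*} (s : Finset ι) (K : ι → Fin 2) :
    |∑ i ∈ s, sgn (K i)| ≤ s.card := by
  simpa [abs_sgn] using Finset.abs_sum_le_sum_abs (fun i => sgn (K i)) s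

theorem analyticAt_fundEntry (hτ : 0 < τ.im) {f g : ℂ → ℂ} {p : ℂ}
    (hf : AnalyticAt ℂ f p) (hg : AnalyticAt ℂ g p) (hfp : ∀ j, theta τ (f p - z j - 2 * η) ≠ 0)
    (hgp : ∀ k : ℤ, |k| ≤ n → theta τ (g p + 2 * η * k) ≠ 0) (β α : Fin 2) (K' K : Fin n → Fin 2) :
    AnalyticAt ℂ (fun s => fundEntry τ η z (f s) (g s) β α K' K) p := by
  unfold fundEntry
  refine Finset.analyticAt_fun_sum _ fun σ _ => ?_
  split_ifs
  · refine Finset.analyticAt_fun_prod _ fun j _ => analyticAt_rMat hτ (hf.sub analyticAt_const)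
      (hg.sub analyticAt_const) (hfp j) ?_ _ _ _ _
    convert hgp (-∑ i ∈ Finset.Ioi j, sgn (K' i)) ?_ using 2
    · simp only [Pi.sub_apply]
      push_cast
      ring
    · rw [abs_neg]
      refine (abs_sum_sgn_le _ _).trans ?_
      exact_mod_cast (Finset.card_le_univ _).trans (by simp)
  · exact analyticAt_const

theorem vecRegularAt_of_analyticAt {ι : Type*} [Finite ι] {v : ℂ → (ι →₀ ℂ)} {p : ℂ}
    (h : ∀ K, AnalyticAt ℂ (fun s => v s K) p) : VecRegularAt v p := by
  cases nonempty_fintype ι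
  intro φ
  have hexpand (s) : φ (v s) = ∑ K, v s K * φ (Finsupp.single K 1) := by
    conv_lhs => rw [← Finsupp.univ_sum_single (v s)]
    rw [map_sum]
    refine Finset.sum_congr rfl fun K _ => ?_
    rw [← smul_eq_mul, ← map_smul, Finsupp.smul_single_one]
  simp_rw [hexpand]
  exact Finset.analyticAt_fun_sum _ fun K _ => (h K).mul analyticAt_const

theorem vecRegularAt_fundL (hτ : 0 < τ.im) {f g : ℂ → ℂ} {p : ℂ}
    (hf : AnalyticAt ℂ f p) (hg : AnalyticAt ℂ g p) (hfp : ∀ j, theta τ (f p - z j - 2 * η) ≠ 0)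
    (hgp : ∀ k : ℤ, |k| ≤ n → theta τ (g p + 2 * η * k) ≠ 0) (β α : Fin 2)
    (u : (Fin n → Fin 2) →₀ ℂ) :
    VecRegularAt (fun s => fundL τ η z (f s) (g s) β α u) p := by
  refine vecRegularAt_of_analyticAt fun K => ?_
  simp only [fundL_apply]
  exact Finset.analyticAt_fun_sum _ fun K' _ =>
    (analyticAt_fundEntry hτ hf hg hfp hgp _ _ _ _).mul analyticAt_const

theorem gFn_smul_single_zero_mem (hn : (n : ℂ) = 2 * m) (c l : ℂ) :
    gFn τ η c m l • Finsupp.single 0 1 ∈ (fundH n).eigenspace (2 * ((m : ℤ) : ℂ)) := by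
  refine Submodule.smul_mem _ _ ?_
  simpa [hn] using single_zero_mem_eigenspace_fundH n

theorem fundBethe_mem {c : ℂ} {t : Fin m → ℂ} (hn : (n : ℂ) = 2 * m) (l : ℂ) :
    fundBethe τ η z c t l ∈ (fundH n).eigenspace (0 : ℂ) := by
  have hmem := betheVector_mem (η := η) (b_mem_eigenspace (L := fundL τ η z) fundL_weight)
    (gFn_smul_single_zero_mem (τ := τ) (η := η) hn c) (List.ofFn t) l
  rwa [List.length_ofFn, sub_self, Int.cast_zero, mul_zero] at hmem

theorem vecRegularAt_fundBethe (hτ : 0 < τ.im) (hn : (n : ℂ) = 2 * m) {c : ℂ} {t : Fin m → ℂ}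
    (ht : ∀ i j, theta τ (t i - z j - 2 * η) ≠ 0) {l : ℂ}
    (hl : ∀ k : ℤ, |k| ≤ n + m → theta τ (l + 2 * η * k) ≠ 0) :
    VecRegularAt (fundBethe τ η z c t) l := by
  have hlist := vecRegularAt_betheVector (η := η)
    (b_mem_eigenspace (L := fundL τ η z) fundL_weight)
    (gFn_smul_single_zero_mem (τ := τ) (η := η) hn c) l (List.ofFn fun i => fun _ : ℂ => t i)
    (fun s => s) ?_ ?_
  · simp only [List.map_ofFn, Function.comp_def] at hlist
    exact hlist
  · intro f hf j hj _ _ u _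
    rw [List.length_ofFn] at hj
    obtain ⟨i, rfl⟩ := (List.mem_ofFn' _ _).1 hf
    refine vecRegularAt_fundL hτ analyticAt_const (analyticAt_id.add analyticAt_const) (ht i)
      (fun k hk => ?_) 0 1 u
    have hkj : |k + j| ≤ (n + m : ℤ) := by
      rw [abs_le] at hk ⊢
      lia
    convert hl (k + j) hkj using 2
    simp only [id, Pi.add_apply]
    push_cast
    ring
  · exact VecRegularAt.smul (x := fun _ => Finsupp.single 0 1)
      (((differentiable_gFn hτ η c m).analyticAt _).fun_comp
        (analyticAt_id.add analyticAt_const)) (vecRegularAt_const _ _)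

theorem countable_fundBethe_zeros (hτ : 0 < τ.im) (hn : (n : ℂ) = 2 * m) {c : ℂ} {t : Fin m → ℂ}
    (ht : ∀ i j, theta τ (t i - z j - 2 * η) ≠ 0)
    (hne : ¬ fundBethe τ η z c t =ᶠ[codiscrete ℂ] 0) :
    {l | fundBethe τ η z c t l = 0}.Countable := by
  refine countable_zeros_of_vecRegularAt (V := ⊤) (fun _ => trivial) ?_ hne
  have hgeneric : ∀ᶠ l in codiscrete ℂ, ∀ k ∈ Finset.Icc (-((n + m : ℕ) : ℤ)) (n + m : ℕ),
      theta τ (l + 2 * η * k) ≠ 0 :=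
    (Finset.eventually_all _).2 fun k _ => by
      refine mem_codiscrete.2 fun t => disjoint_principal_right.2 ?_
      rw [compl_compl]
      exact eventually_theta_add_ne_zero hτ _ t
  filter_upwards [hgeneric] with l hl
  refine vecRegularAt_fundBethe hτ hn ht fun k hk => hl k ?_
  rw [Finset.mem_Icc, ← abs_le]
  exact_mod_cast hk

theorem sub_qPar_of_eq_one (hΛ : ∀ j, Λ j = 1) (x : ℂ) (j : Fin n) :
    x - qPar η z Λ j = x - z j - 2 * η := by
  rw [qPar, hΛ]
  ring

theorem fundL_transfer_bethe (hτ : 0 < τ.im) (hΛ : ∀ j, Λ j = 1) (hm : ∑ j, Λ j = 2 * (m : ℂ))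
    {c : ℂ} {t : Fin m → ℂ} (ht : ∀ i j, i ≠ j → ∀ r s : ℤ, t i - t j ≠ r + s * τ)
    (hbae : BetheEquations τ η z Λ c t) (hμ : ∀ l ∈ latticeC η μ, theta τ l ≠ 0) {w : ℂ}
    (hw : ∀ k, theta τ (w - qPar η z Λ k) ≠ 0) {l : ℂ} (hl : l ∈ latticeC η μ) :
    fundL τ η z w l 0 0 (fundBethe τ η z c t (l - 2 * η)) +
      fundL τ η z w l 1 1 (fundBethe τ η z c t (l + 2 * η)) =
      regularizedEigenvalue τ η z Λ c t w • fundBethe τ η z c t l := by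
  simp only [sub_qPar_of_eq_one hΛ] at hw
  have htq (i) := (hbae.theta_ne_zero i).2.1
  simp only [sub_qPar_of_eq_one hΛ] at htq
  have hpoles : {x | ∃ j, theta τ (x - z j - 2 * η) = 0}.Countable := by
    rw [Set.ofPred_exists]
    exact Set.countable_iUnion fun j => countable_theta_comp_zeros hτ fun a b h => by simpa using h
  have hreg {x l : ℂ} (hx : ∀ j, theta τ (x - z j - 2 * η) ≠ 0) (hl : l ∈ latticeC η μ)
      (β α : Fin 2) (u : (Fin n → Fin 2) →₀ ℂ) :
      VecRegularAt (fun s => fundL τ η z s l β α u) x :=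
    vecRegularAt_fundL hτ analyticAt_id analyticAt_const hx
      (fun k _ => hμ _ (latticeC_add_int hl k)) β α u
  exact (fundL_rllOn hτ z hμ).transfer_bethe hτ hpoles (fundL_highestWeightOn hΛ hm hμ _)
    (hbae.pairwise_separated hτ ht) hbae (fun i l hl k u _ => hreg (htq i) hl 0 1 u)
    (fun l hl α u _ => hreg hw hl α α u) hl

end FundamentalRepresentations

/-! ### Interaction-round-a-face models -/

section IRF

variable {n m : ℕ} {τ η κ w c : ℂ} {z Λ : Fin n → ℂ} {t : Fin m → ℂ} {a b : Fin (n + 1) → ℤ}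

theorem idx_sgn (s : Fin 2) : idx (sgn s) = s := by
  fin_cases s <;> simp [idx]

theorem sgn_idx {s : ℤ} (hs : |s| = 1) : sgn (idx s) = s := by
  rcases (abs_eq zero_le_one).1 hs with rfl | rfl <;> simp [idx]

theorem sum_castSucc_sub_succ {A : Type*} [AddCommGroup A] (f : Fin (n + 1) → A) :
    ∑ i : Fin n, (f i.castSucc - f i.succ) = f 0 - f (Fin.last n) := by
  rw [Finset.sum_sub_distrib, sub_eq_sub_iff_add_eq_add, ← Fin.sum_univ_castSucc,
    Fin.sum_univ_succ]

theorem sum_Ioi_castSucc_sub_succ {A : Type*} [AddCommGroup A] (f : Fin (n + 1) → A) (j : Fin n) :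
    ∑ i ∈ Finset.Ioi j, (f i.castSucc - f i.succ) = f j.succ - f (Fin.last n) := by
  induction n with
  | zero => exact j.elim0
  | succ n ih =>
    cases j using Fin.cases with
    | zero =>
      rw [Fin.sum_Ioi_zero]
      exact sum_castSucc_sub_succ fun i => f i.succ
    | succ j =>
      rw [Fin.sum_Ioi_succ]
      exact ih (fun i => f i.succ) j

theorem exists_castSucc_sub_succ_eq {A : Type*} [AddCommGroup A] {f : Fin n → A}
    (hf : ∑ i, f i = 0) :
    ∃ a : Fin (n + 1) → A, a 0 = 0 ∧ a (Fin.last n) = 0 ∧ ∀ j, a j.castSucc - a j.succ = f j := by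
  have hstep (j : Fin n) : -Fin.partialSum f j.castSucc - -Fin.partialSum f j.succ = f j := by
    rw [Fin.partialSum_succ]
    abel
  refine ⟨fun j => -Fin.partialSum f j, by simp, ?_, hstep⟩
  have htotal := sum_castSucc_sub_succ fun j => -Fin.partialSum f j
  simpa [hstep, hf, eq_comm] using htotal

/-- The label `j ↦ idx (a_j - a_{j+1})` of the tensor basis vector
`e[a_1-a_2] ⊗ ⋯ ⊗ e[a_n-a_{n+1}]`, in which the path `a` is encoded. -/
def pathLabel (a : Fin (n + 1) → ℤ) (j : Fin n) : Fin 2 := idx (a j.castSucc - a j.succ)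

theorem IsClosedPath.sgn_pathLabel (hb : IsClosedPath b) (j : Fin n) :
    sgn (pathLabel b j) = b j.castSucc - b j.succ :=
  sgn_idx (hb.2 j)

theorem IsClosedPath.sub_sum_Ioi_sgn_pathLabel (hb : IsClosedPath b) (j : Fin n) :
    -2 * η * (κ + b 0) - 2 * η * ∑ i ∈ Finset.Ioi j, (sgn (pathLabel b i) : ℂ) =
      -2 * η * (κ + b j.succ) := by
  have hsum : ∑ i ∈ Finset.Ioi j, (sgn (pathLabel b i) : ℂ) = b j.succ - b 0 := by
    simp only [hb.sgn_pathLabel, hb.1, Int.cast_sub]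
    exact sum_Ioi_castSucc_sub_succ (fun i => (b i : ℂ)) j
  rw [hsum]
  ring

theorem IsClosedPath.add_sgn_iff (hb : IsClosedPath b) (σ : Fin (n + 1) → Fin 2) :
    IsClosedPath (fun j => b j + sgn (σ j)) ↔ σ 0 = σ (Fin.last n) ∧
      ∀ j : Fin n, |b j.castSucc + sgn (σ j.castSucc) - (b j.succ + sgn (σ j.succ))| = 1 := by
  have hsgn : Function.Injective sgn := Function.LeftInverse.injective idx_sgn
  simp only [IsClosedPath, hb.1, add_right_inj, hsgn.eq_iff]

theorem prod_rMat_eq_prod_boltzmann (z : Fin n → ℂ) (w : ℂ) (σ : Fin (n + 1) → Fin 2)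
    (ha : ∀ j, a j = b j + sgn (σ j)) :
    ∏ j, rMat τ η (w - z j) (-2 * η * (κ + b j.succ)) (σ j.castSucc) (pathLabel b j) (σ j.succ)
        (pathLabel a j) =
      ∏ j : Fin n,
        boltzmann τ η κ (b j.castSucc) (a j.castSucc) (a j.succ) (b j.succ) (w - z j) := by
  refine Finset.prod_congr rfl fun j _ => ?_
  rw [boltzmann, ha j.castSucc, ha j.succ, add_sub_cancel_left, add_sub_cancel_left, idx_sgn,
    idx_sgn, pathLabel, pathLabel, ha, ha]

theorem sgn_eq_of_prod_rMat_ne_zero (hb : IsClosedPath b) {σ : Fin (n + 1) → Fin 2}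
    (ha : ∀ j, a j = b j + sgn (σ j)) {K : Fin n → Fin 2}
    (hK : ∏ j, rMat τ η (w - z j) (-2 * η * (κ + b j.succ)) (σ j.castSucc) (pathLabel b j)
      (σ j.succ) (K j) ≠ 0) (j : Fin n) :
    sgn (K j) = a j.castSucc - a j.succ := by
  have hice := rMat_conservation (Finset.prod_ne_zero_iff.1 hK j (Finset.mem_univ j))
  rw [hb.sgn_pathLabel] at hice
  linarith [ha j.castSucc, ha j.succ]

open Classical in
theorem sum_prod_rMat_mul (hb : IsClosedPath b) {σ : Fin (n + 1) → Fin 2}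
    (ha : ∀ j, a j = b j + sgn (σ j)) (v : (Fin n → Fin 2) →₀ ℂ) :
    ∑ K, (∏ j, rMat τ η (w - z j) (-2 * η * (κ + b j.succ)) (σ j.castSucc) (pathLabel b j)
        (σ j.succ) (K j)) * v K =
      if ∀ j : Fin n, |a j.castSucc - a j.succ| = 1 then
        (∏ j : Fin n, boltzmann τ η κ (b j.castSucc) (a j.castSucc) (a j.succ) (b j.succ)
          (w - z j)) * v (pathLabel a)
      else 0 := by
  rw [← prod_rMat_eq_prod_boltzmann z w σ ha]
  split_ifs with hpath
  · refine Finset.sum_eq_single _ (fun K _ hK => mul_eq_zero_of_left ?_ _) (by simp)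
    contrapose! hK
    funext j
    rw [pathLabel, ← sgn_eq_of_prod_rMat_ne_zero hb ha hK, idx_sgn]
  · refine Finset.sum_eq_zero fun K _ => mul_eq_zero_of_left ?_ _
    contrapose! hpath
    intro j
    rw [← sgn_eq_of_prod_rMat_ne_zero hb ha hpath, abs_sgn]

open Classical in
theorem fundL_diag_apply_pathLabel (hb : IsClosedPath b) (ψ : ℂ → ((Fin n → Fin 2) →₀ ℂ))
    (α : Fin 2) :
    fundL τ η z w (-2 * η * (κ + b 0)) α α (ψ (-2 * η * (κ + b 0) - 2 * η * sgn α))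
        (pathLabel b) =
      ∑ σ : Fin (n + 1) → Fin 2, if σ 0 = α ∧ IsClosedPath fun j => b j + sgn (σ j) then
        (∏ j : Fin n, boltzmann τ η κ (b j.castSucc) (b j.castSucc + sgn (σ j.castSucc))
          (b j.succ + sgn (σ j.succ)) (b j.succ) (w - z j)) *
          pathCoeff η κ ψ fun j => b j + sgn (σ j)
      else 0 := by
  rw [fundL_apply]
  simp only [fundEntry, hb.sub_sum_Ioi_sgn_pathLabel, Finset.sum_mul, ite_mul, zero_mul]
  rw [Finset.sum_comm]
  refine Finset.sum_congr rfl fun σ _ => ?_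
  by_cases hσ : σ 0 = α ∧ σ (Fin.last n) = α
  · obtain ⟨rfl, hlast⟩ := hσ
    have hpoint : -2 * η * (κ + b 0) - 2 * η * sgn (σ 0) =
        -2 * η * (κ + (b 0 + sgn (σ 0) : ℤ)) := by
      push_cast
      ring
    simp only [hlast, and_self, if_true, true_and, hb.add_sgn_iff, hpoint]
    exact sum_prod_rMat_mul hb (fun _ => rfl) _
  · have hopen : ¬ (σ 0 = α ∧ IsClosedPath fun j => b j + sgn (σ j)) :=
      fun ⟨hfirst, hclosed⟩ => hσ ⟨hfirst, ((hb.add_sgn_iff σ).1 hclosed).1 ▸ hfirst⟩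
    simp [hσ, hopen]

theorem irfTransfer_pathCoeff (hb : IsClosedPath b) (ψ : ℂ → ((Fin n → Fin 2) →₀ ℂ)) :
    irfTransfer τ η κ z w (pathCoeff η κ ψ) b =
      ∑ α, fundL τ η z w (-2 * η * (κ + b 0)) α α (ψ (-2 * η * (κ + b 0) - 2 * η * sgn α))
        (pathLabel b) := by
  classical
  simp only [fundL_diag_apply_pathLabel hb]
  rw [irfTransfer, Finset.sum_comm]
  refine Finset.sum_congr rfl fun σ _ => ?_
  simp only [ite_and, Finset.sum_ite_eq, Finset.mem_univ, if_true]

theorem irfTransfer_pathCoeff_fundBethe (hτ : 0 < τ.im) (hΛ : ∀ j, Λ j = 1)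
    (hm : ∑ j, Λ j = 2 * (m : ℂ)) (ht : ∀ i j, i ≠ j → ∀ r s : ℤ, t i - t j ≠ r + s * τ)
    (hbae : BetheEquations τ η z Λ c t) (hκ : ∀ k : ℤ, theta τ (-2 * η * (κ + k)) ≠ 0)
    (hw : ∀ k, theta τ (w - qPar η z Λ k) ≠ 0) (hb : IsClosedPath b) :
    irfTransfer τ η κ z w (pathCoeff η κ (fundBethe τ η z c t)) b =
      regularizedEigenvalue τ η z Λ c t w * pathCoeff η κ (fundBethe τ η z c t) b := by
  have hμ : ∀ l ∈ latticeC η (-2 * η * κ), theta τ l ≠ 0 := by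
    rintro l ⟨k, rfl⟩
    convert hκ (-k) using 2
    push_cast
    ring
  have hmem : -2 * η * (κ + b 0) ∈ latticeC η (-2 * η * κ) := ⟨-b 0, by push_cast; ring⟩
  have heigen := DFunLike.congr_fun (fundL_transfer_bethe hτ hΛ hm ht hbae hμ hw hmem)
    (pathLabel b)
  rw [irfTransfer_pathCoeff hb, Fin.sum_univ_two]
  simpa [pathCoeff] using! heigen

theorem exists_pathCoeff_ne_zero {ψ : ℂ → ((Fin n → Fin 2) →₀ ℂ)} (hψ : ψ (-2 * η * κ) ≠ 0)
    (hmem : ψ (-2 * η * κ) ∈ (fundH n).eigenspace (0 : ℂ)) :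
    ∃ b, IsClosedPath b ∧ pathCoeff η κ ψ b ≠ 0 := by
  obtain ⟨K, hK⟩ := DFunLike.ne_iff.1 hψ
  have hweight : ∑ i, sgn (K i) = 0 := by exact_mod_cast mem_eigenspace_fundH.1 hmem K hK
  obtain ⟨b, hb_zero, hb_last, hb⟩ := exists_castSucc_sub_succ_eq hweight
  refine ⟨b, ⟨hb_zero.trans hb_last.symm, fun j => by rw [hb, abs_sgn]⟩, ?_⟩
  simpa [pathCoeff, hb, idx_sgn, hb_zero] using hK

theorem exists_countable_irfTransfer_fundBethe (hτ : 0 < τ.im) (hη : η ≠ 0) (hΛ : ∀ j, Λ j = 1)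
    (hm : ∑ j, Λ j = 2 * (m : ℂ)) (ht : ∀ i j, i ≠ j → ∀ r s : ℤ, t i - t j ≠ r + s * τ)
    (hbae : BetheEquations τ η z Λ c t) :
    ∃ E : Set ℂ, E.Countable ∧ ∀ κ ∉ E,
      (∀ w, (∀ k, theta τ (w - qPar η z Λ k) ≠ 0) → ∀ b, IsClosedPath b →
        irfTransfer τ η κ z w (pathCoeff η κ (fundBethe τ η z c t)) b
          = regularizedEigenvalue τ η z Λ c t w * pathCoeff η κ (fundBethe τ η z c t) b) ∧
      (¬ (fundBethe τ η z c t =ᶠ[codiscrete ℂ] 0) →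
        ∃ b, IsClosedPath b ∧ pathCoeff η κ (fundBethe τ η z c t) b ≠ 0) := by
  have hn : (n : ℂ) = 2 * m := by simpa [hΛ] using hm
  have hscale : Function.Injective fun κ : ℂ => -2 * η * κ :=
    mul_right_injective₀ (by simpa using hη)
  have hheights : (⋃ k : ℤ, {κ | theta τ (-2 * η * (κ + k)) = 0}).Countable :=
    Set.countable_iUnion fun k =>
      countable_theta_comp_zeros hτ (hscale.comp (add_left_injective (k : ℂ)))
  have hzeros : {κ | ¬ (fundBethe τ η z c t =ᶠ[codiscrete ℂ] 0) ∧
      fundBethe τ η z c t (-2 * η * κ) = 0}.Countable := by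
    by_cases hne : fundBethe τ η z c t =ᶠ[codiscrete ℂ] 0
    · simp [hne]
    have htq (i j) : theta τ (t i - z j - 2 * η) ≠ 0 :=
      sub_qPar_of_eq_one hΛ (t i) j ▸ (hbae.theta_ne_zero i).2.1 j
    exact ((countable_fundBethe_zeros hτ hn htq hne).preimage hscale).mono fun κ hκ => hκ.2
  refine ⟨_, hheights.union hzeros, fun κ hκ => ?_⟩
  simp only [Set.mem_union, Set.mem_iUnion, Set.mem_ofPred_eq, not_or, not_exists, not_and] at hκ
  exact ⟨fun w hw b hb => irfTransfer_pathCoeff_fundBethe hτ hΛ hm ht hbae hκ.1 hw hb,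
    fun hne => exists_pathCoeff_ne_zero (hκ.2 hne) (fundBethe_mem hn _)⟩

end IRF

end EllipticBethe

end

open EllipticBethe in
theorem mainTheorem9 (τ η : ℂ) (hτ : 0 < τ.im) (n m : ℕ) (z Λ : Fin n → ℂ)
    (hΛ : ∑ j, Λ j = 2 * (m : ℂ)) (c : ℂ) (t : Fin m → ℂ)
    (ht : ∀ i j, i ≠ j → ∀ r s : ℤ, t i - t j ≠ r + s * τ)
    (hbae : BetheEquations τ η z Λ c t) :
    ∃ ε : ℂ → ℂ,
      -- the eigenvalue
      (∀ w, (∀ j, theta τ (t j - w) ≠ 0) → (∀ k, theta τ (w - qPar η z Λ k) ≠ 0) →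
        ε w = betheEigenvalue τ η z Λ c t w) ∧
      -- every module with a highest weight vector
      (∀ (W : Type*) [AddCommGroup W] [Module ℂ W] (M : EModule τ η W) (v₀ : ℂ → W),
        M.IsHighestWeightVector z Λ v₀ → (∀ i, M.BDefinedAt (t i)) →
        ∃ E : Set ℂ, E.Countable ∧ ∀ μ ∉ E,
          {w | ¬ M.TransferDefinedOn μ w}.Countable ∧
          (∀ l ∈ latticeC η μ, VecRegularAt (M.bethe v₀ c t) l) ∧
          ∃ ψ : M.FunZero μ, (∀ l, (ψ l : W) = M.bethe v₀ c t l) ∧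
            (∀ w, M.TransferDefinedOn μ w → M.transfer μ w ψ = ε w • ψ) ∧
            (¬ (M.bethe v₀ c t =ᶠ[Filter.codiscrete ℂ] 0) → ψ ≠ 0)) ∧
      -- in tensor products of evaluation Verma modules, the Bethe vector does not vanish
      (theta τ (2 * η) ≠ 0 → ¬ (vermaBethe τ η z Λ c t =ᶠ[Filter.codiscrete ℂ] 0)) ∧
      -- interaction-round-a-face models
      (η ≠ 0 → (∀ j, Λ j = 1) →
        ∃ K : Set ℂ, K.Countable ∧ ∀ κ ∉ K,
          (∀ w, (∀ k, theta τ (w - qPar η z Λ k) ≠ 0) → ∀ b, IsClosedPath b →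
            irfTransfer τ η κ z w (pathCoeff η κ (fundBethe τ η z c t)) b
              = ε w * pathCoeff η κ (fundBethe τ η z c t) b) ∧
          (¬ (fundBethe τ η z c t =ᶠ[Filter.codiscrete ℂ] 0) →
            ∃ b, IsClosedPath b ∧ pathCoeff η κ (fundBethe τ η z c t) b ≠ 0)) :=
  ⟨regularizedEigenvalue τ η z Λ c t,
    fun _ htw hwq => regularizedEigenvalue_eq hτ htw hwq,
    fun _ _ _ _ _ hv hb => EModule.exists_countable_transfer_bethe hτ hΛ ht hbae hv hb,
    vermaBethe_ne_zero hτ hΛ hbae,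
    fun hη hΛ₁ => exists_countable_irfTransfer_fundBethe hτ hη hΛ₁ hΛ ht hbae⟩
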